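/- For $0<r<\frac13$ let $S_j(x)=rx+\frac{j-1}{2}(1-r)$, $x\in\mathbb R$, $1\le j\le 3$, and let $P=P_r$ be the unique Borel probability measure on $\mathbb R$ with $P=\sum_{j=1}^3\frac13\,P\circ S_j^{-1}$ (the triadic uniform Cantor distribution with ratio $r$). For $\alpha\subset\mathbb R$ let $V(P;\alpha)=\int\min_{a\in\alpha}|x-a|^2\,dP(x)$ and $V_n(P)=\inf\{V(P;\alpha):\emptyset\ne\alpha\subset\mathbb R,\ \operatorname{card}\alpha\le n\}$; a nonempty set $\alpha$ with $\operatorname{card}\alpha\le n$ and $V(P;\alpha)=V_n(P)$ is called an optimal set of $n$-means. For a word $\sigma=\sigma_1\cdots\sigma_k$ over $\{1,2,3\}$ put $S_\sigma=S_{\sigma_1}\circ\cdots\circ S_{\sigma_k}$, $J_\sigma=S_\sigma([0,1])$ and $a(\sigma)=S_\sigma(\frac12)$; for several words put $a(\sigma,\tau,\dots,\delta)=\frac{1}{P(J_\sigma\cup J_\tau\cup\cdots\cup J_\delta)}\int_{J_\sigma\cup J_\tau\cup\cdots\cup J_\delta}x\,dP(x)$. Let $$\beta_2=\{a(1),a(2,3)\},\qquad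 \gamma_2=\{a(1,21),a(22,23,3)\},\qquad \beta_3=\gamma_3=\{a(1),a(2),a(3)\}.$$ For $n\ge3$ let $\ell=\ell(n)$ be the natural number with $3^{\ell}\le n<3^{\ell+1}$, and let $I\subset\{1,2,3\}^{\ell}$ be any set with $\operatorname{card}I=n-3^{\ell}$ if $n\le 2\cdot3^{\ell}$ and $\operatorname{card}I=n-2\cdot3^{\ell}$ if $n>2\cdot3^{\ell}$. Put $$\beta_n(I)=\begin{cases}\{a(\omega):\omega\in\{1,2,3\}^{\ell}\setminus I\}\cup\bigcup_{\omega\in I}S_\omega(\beta_2)&\text{if }3^{\ell}\le n\le2\cdot3^{\ell},\\[2pt] \bigcup_{\omega\in\{1,2,3\}^{\ell}\setminus I}S_\omega(\beta_2)\cup\bigcup_{\omega\in I}S_\omega(\beta_3)&\text{if }2\cdot3^{\ell}<n<3^{\ell+1},\end{cases}$$ and define $\gamma_n(I)$ in the same way with $\gamma_2,\gamma_3$ in place of $\beta_2,\beta_3$. We say that the sets $\beta_n$ are optimal for all $n\ge2$ if $\beta_2$ is an optimal set of two-means and, for every $n\ge3$ and every such $I$, $\beta_n(I)$ is an optimal set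 of $n$-means; likewise for $\gamma_n$. **Theorem.** Each of the equations $$-\frac{3r^5+15r^4+6r^3-42r^2+31r-13}{240(r+1)}=-\frac{3r^3-3r^2+r-1}{24(r+1)},$$ $$-\frac{3r^5+15r^4+6r^3-42r^2+31r-13}{240(r+1)}=-\frac{3r^7+15r^6+60r^5+66r^4+18r^3-324r^2+283r-121}{2184(r+1)}$$ has exactly one root in $(0,\frac13)$; denote these roots by $r_0$ and $r_1$, respectively. To ten decimal places, $r_0=0.1622776602$ and $r_1=0.2317626315$, that is, $|r_0-0.1622776602|<5\cdot10^{-11}$ and $|r_1-0.2317626315|<5\cdot10^{-11}$. Moreover: 1. for every $r$ with $0<r\le r_0$, the sets $\beta_n$ are optimal for all $n\ge2$; 2. for $0<r<\frac13$, the sets $\gamma_n$ are optimal for all $n\ge2$ if and only if $r_0\le r\le r_1$. -/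

import Mathlib

open MeasureTheory ProbabilityTheory Set
open scoped ENNReal

noncomputable section

namespace TriadicCantor

/-! ### The similarities

The alphabet `{1, 2, 3}` is `Fin 3`: the letter `j` is represented by `j - 1`. Words of any finite
length are lists of letters, the empty word being `[]`. -/

/-- The contractive similarities `S_j(x) = r x + ((j - 1) / 2) (1 - r)`. -/
def S (r : ℝ) (j : Fin 3) (x : ℝ) : ℝ := r * x + (j : ℕ) / 2 * (1 - r)

/-- `S_σ = S_{σ₁} ∘ ⋯ ∘ S_{σₙ}` for a word `σ = σ₁ ⋯ σₙ`; the identity for the empty word. -/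
def SWord (r : ℝ) : List (Fin 3) → ℝ → ℝ
  | [] => id
  | j :: σ => S r j ∘ SWord r σ

/-- The basic interval `J_σ = S_σ([0, 1])`. -/
def J (r : ℝ) (σ : List (Fin 3)) : Set ℝ := SWord r σ '' Icc 0 1

/-! ### The triadic uniform Cantor distribution

It is built as the law of `∑ₖ rᵏ (ωₖ / 2) (1 - r)` with independent digits `ωₖ` uniform on
`{0, 1, 2}`; this is the point with address `ω`, i.e. the limit of `S_{ω₀} ∘ ⋯ ∘ S_{ωₖ}`.
Below it is proved that for `0 < r < 1 / 3` it is the unique Borel probability measure `P`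
on `ℝ` with `P = ∑ⱼ (1 / 3) P ∘ S_j⁻¹`. -/

/-- The point of the Cantor set with address `ω`. -/
def point (r : ℝ) (ω : ℕ → Fin 3) : ℝ := ∑' k, r ^ k * ((ω k : ℕ) / 2 * (1 - r))

/-- The law of a sequence of independent digits, each uniform on `Fin 3`. -/
def digits : Measure (ℕ → Fin 3) :=
  Measure.infinitePi fun _ => uniformOn (univ : Set (Fin 3))

/-- The triadic uniform Cantor distribution with ratio `r`. -/
def cantorDist (r : ℝ) : Measure ℝ := digits.map (point r)

/-- Prepending a digit. -/
def prepend (j : Fin 3) (ω : ℕ → Fin 3) : ℕ → Fin 3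
  | 0 => j
  | k + 1 => ω k

instance : IsProbabilityMeasure digits := by unfold digits; infer_instance

lemma measurable_prepend (j : Fin 3) : Measurable (prepend j) := by
  refine measurable_pi_lambda _ fun k => ?_
  cases k with
  | zero => exact measurable_const
  | succ k => exact measurable_pi_apply k

lemma uniformOn_eq (s : Set (Fin 3)) :
    uniformOn (univ : Set (Fin 3)) s = ∑ j : Fin 3, (3 : ℝ≥0∞)⁻¹ * s.indicator 1 j := by
  classical
  rw [uniformOn_univ, ← Finset.mul_sum, div_eq_mul_inv, mul_comm]
  congr 1
  rw [Measure.count_apply (Set.toFinite s).measurableSet, Set.encard_eq_coe_toFinset_card]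
  simp [Set.indicator_apply, Finset.sum_boole, Set.toFinset_card, Fintype.card_subtype]

/-- A sequence of independent uniform digits is a uniform digit followed by such a sequence. -/
lemma digits_eq : digits = ∑ j : Fin 3, (3 : ℝ≥0∞)⁻¹ • digits.map (prepend j) := by
  classical
  symm
  unfold digits
  refine Measure.eq_infinitePi _ fun s t ht => ?_
  set ν : ℕ → Measure (Fin 3) := fun _ => uniformOn (univ : Set (Fin 3))
  set s' : Finset ℕ := s.preimage Nat.succ Nat.succ_injective.injOn with hs'
  have hms : MeasurableSet (Set.pi (s : Set ℕ) t) :=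
    MeasurableSet.pi s.countable_toSet fun i _ => ht i
  have hpre : ∀ j : Fin 3, prepend j ⁻¹' (Set.pi (s : Set ℕ) t)
      = if 0 ∈ s → j ∈ t 0 then Set.pi (s' : Set ℕ) (fun k => t (k + 1)) else ∅ := by
    intro j
    ext ω
    split_ifs with h
    · simp only [mem_preimage, Set.mem_pi, hs', Finset.coe_preimage, Finset.mem_coe]
      constructor
      · intro H k hk
        exact H (k + 1) hk
      · intro H k hk
        cases k with
        | zero => exact h hk
        | succ k => exact H k hk
    · simp only [mem_preimage, Set.mem_pi, Finset.mem_coe, mem_empty_iff_false, iff_false]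
      intro H
      exact h fun h0 => H 0 h0
  have hval : ∀ j : Fin 3, (Measure.infinitePi ν) (prepend j ⁻¹' (Set.pi (s : Set ℕ) t))
      = (if 0 ∈ s → j ∈ t 0 then 1 else 0) * ∏ k ∈ s', ν (k + 1) (t (k + 1)) := by
    intro j
    rw [hpre j]
    split_ifs with h
    · rw [one_mul]
      exact Measure.infinitePi_pi (μ := ν) (t := fun k => t (k + 1)) fun i _ => ht (i + 1)
    · simp
  have hprod : ∏ i ∈ s, ν i (t i)
      = (if 0 ∈ s then ν 0 (t 0) else 1) * ∏ k ∈ s', ν (k + 1) (t (k + 1)) := by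
    have h1 : ∏ k ∈ s', ν (k + 1) (t (k + 1)) = ∏ i ∈ s with i ≠ 0, ν i (t i) := by
      refine Finset.prod_bij (fun k _ => k + 1) ?_ ?_ ?_ ?_
      · intro k hk
        simpa [hs'] using hk
      · intro a _ b _ h
        exact Nat.succ_injective h
      · intro b hb
        rw [Finset.mem_filter] at hb
        obtain ⟨k, rfl⟩ := Nat.exists_eq_succ_of_ne_zero hb.2
        exact ⟨k, by simpa [hs'] using hb.1, rfl⟩
      · intro k _
        rfl
    rw [h1, ← Finset.prod_filter_mul_prod_filter_not s (fun i => i = 0)]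
    congr 1
    rw [Finset.filter_eq']
    split_ifs <;> simp
  rw [hprod, Measure.finsetSum_apply]
  simp only [Measure.smul_apply, smul_eq_mul, Measure.map_apply (measurable_prepend _) hms]
  simp only [hval, ← mul_assoc]
  rw [← Finset.sum_mul]
  congr 1
  by_cases h0 : 0 ∈ s
  · simp only [h0, forall_const, if_true]
    change _ = uniformOn (univ : Set (Fin 3)) (t 0)
    rw [uniformOn_eq]
    refine Finset.sum_congr rfl fun j _ => ?_
    simp [Set.indicator_apply]
  · simp only [h0, false_imp_iff, if_true, if_false, mul_one]
    simp [ENNReal.mul_inv_cancel]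

lemma digit_bound {r : ℝ} (h0 : 0 < r) (h1 : r < 1 / 3) (k : ℕ) (j : Fin 3) :
    ‖r ^ k * ((j : ℕ) / 2 * (1 - r))‖ ≤ r ^ k := by
  have hk : (0 : ℝ) < r ^ k := pow_pos h0 k
  have hj : ((j : ℕ) : ℝ) ≤ 2 := by exact_mod_cast Nat.le_of_lt_succ j.2
  have hj0 : (0 : ℝ) ≤ ((j : ℕ) : ℝ) := Nat.cast_nonneg _
  have hnn : 0 ≤ ((j : ℕ) : ℝ) / 2 * (1 - r) := mul_nonneg (by linarith) (by linarith)
  rw [Real.norm_of_nonneg (mul_nonneg hk.le hnn)]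
  have : ((j : ℕ) : ℝ) / 2 * (1 - r) ≤ 1 := by nlinarith
  nlinarith

lemma summable_bound {r : ℝ} (h0 : 0 < r) (h1 : r < 1 / 3) : Summable fun k : ℕ => r ^ k :=
  summable_geometric_of_lt_one h0.le (by linarith)

lemma measurable_point {r : ℝ} (h0 : 0 < r) (h1 : r < 1 / 3) : Measurable (point r) := by
  have : Continuous (point r) := by
    unfold point
    refine continuous_tsum (fun k => ?_) (summable_bound h0 h1)
      fun k ω => digit_bound h0 h1 k (ω k)
    exact (continuous_of_discreteTopology
      (f := fun j : Fin 3 => r ^ k * (((j : ℕ) : ℝ) / 2 * (1 - r)))).comp (continuous_apply k)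
  exact this.measurable

lemma point_prepend {r : ℝ} (h0 : 0 < r) (h1 : r < 1 / 3) (j : Fin 3) (ω : ℕ → Fin 3) :
    point r (prepend j ω) = S r j (point r ω) := by
  have hs : ∀ ω : ℕ → Fin 3, Summable fun k => r ^ k * (((ω k : ℕ) : ℝ) / 2 * (1 - r)) :=
    fun ω => Summable.of_norm_bounded (summable_bound h0 h1) fun k => digit_bound h0 h1 k (ω k)
  unfold point S
  rw [(hs (prepend j ω)).tsum_eq_zero_add, ← tsum_mul_left]
  simp only [prepend, pow_zero, one_mul, pow_succ']
  rw [add_comm]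
  congr 1
  exact tsum_congr fun k => by ring

lemma measurable_S (r : ℝ) (j : Fin 3) : Measurable (S r j) := by
  unfold S
  fun_prop

lemma isProbabilityMeasure_cantorDist {r : ℝ} (h0 : 0 < r) (h1 : r < 1 / 3) :
    IsProbabilityMeasure (cantorDist r) :=
  Measure.isProbabilityMeasure_map (measurable_point h0 h1).aemeasurable

/-- The defining equation `P = ∑ⱼ (1 / 3) P ∘ S_j⁻¹`. -/
theorem cantorDist_selfSimilar {r : ℝ} (h0 : 0 < r) (h1 : r < 1 / 3) :
    cantorDist r = ∑ j : Fin 3, (3 : ℝ≥0∞)⁻¹ • (cantorDist r).map (S r j) := by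
  have hm := measurable_point h0 h1
  have hj : ∀ j : Fin 3, (cantorDist r).map (S r j) = (digits.map (prepend j)).map (point r) := by
    intro j
    unfold cantorDist
    rw [Measure.map_map (measurable_S r j) hm, Measure.map_map hm (measurable_prepend j)]
    congr 1
    funext ω
    exact (point_prepend h0 h1 j ω).symm
  simp only [hj]
  conv_lhs => rw [cantorDist, digits_eq]
  ext s hs
  rw [Measure.map_apply hm hs]
  simp only [Measure.finsetSum_apply, Measure.smul_apply, Measure.map_apply hm hs]

/-- The defining equation has only one solution among the Borel probability measures. -/
theorem eq_cantorDist {r : ℝ} (h0 : 0 < r) (h1 : r < 1 / 3) (P : Measure ℝ)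
    [IsProbabilityMeasure P] (hP : P = ∑ j : Fin 3, (3 : ℝ≥0∞)⁻¹ • P.map (S r j)) :
    P = cantorDist r := by
  have := isProbabilityMeasure_cantorDist h0 h1
  have key : ∀ (μ : Measure ℝ), IsProbabilityMeasure μ →
      μ = ∑ j : Fin 3, (3 : ℝ≥0∞)⁻¹ • μ.map (S r j) → ∀ t : ℝ, charFun μ t
        = (∑ j : Fin 3, (3 : ℂ)⁻¹ * Complex.exp (t * ((j : ℕ) / 2 * (1 - r) : ℝ) * Complex.I))
          * charFun μ (r * t) := by
    intro μ _ hμ t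
    have hint : ∀ ν : Measure ℝ, IsFiniteMeasure ν →
        Integrable (fun x : ℝ => Complex.exp (t * x * Complex.I)) ν := by
      intro ν _
      refine Integrable.of_bound (C := 1) (by fun_prop) (Filter.Eventually.of_forall fun x => ?_)
      rw [show (t : ℂ) * x * Complex.I = ((t * x : ℝ) : ℂ) * Complex.I by push_cast; ring,
        Complex.norm_exp_ofReal_mul_I]
    conv_lhs => rw [hμ]
    have hfin : ∀ j : Fin 3, IsFiniteMeasure ((3 : ℝ≥0∞)⁻¹ • μ.map (S r j)) := by
      intro j
      refine ⟨?_⟩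
      rw [Measure.smul_apply, smul_eq_mul, Measure.map_apply (measurable_S r j) .univ]
      simp
    rw [charFun_apply_real, integral_finsetSum_measure fun j _ => hint _ (hfin j),
      Finset.sum_mul]
    refine Finset.sum_congr rfl fun j _ => ?_
    rw [integral_smul_measure, integral_map (measurable_S r j).aemeasurable (by fun_prop),
      charFun_apply_real, ← integral_const_mul, ← integral_smul]
    refine integral_congr_ae (Filter.Eventually.of_forall fun x => ?_)
    simp only [S, ENNReal.toReal_inv, ENNReal.toReal_ofNat, Complex.real_smul]
    rw [mul_assoc (3 : ℂ)⁻¹, ← Complex.exp_add]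
    push_cast
    congr 2
    ring
  have hc : ∀ t : ℝ, ‖∑ j : Fin 3,
      (3 : ℂ)⁻¹ * Complex.exp (t * ((j : ℕ) / 2 * (1 - r) : ℝ) * Complex.I)‖ ≤ 1 := by
    intro t
    refine (norm_sum_le _ _).trans ?_
    have : ∀ j : Fin 3,
        ‖(3 : ℂ)⁻¹ * Complex.exp (t * ((j : ℕ) / 2 * (1 - r) : ℝ) * Complex.I)‖ = 3⁻¹ := by
      intro j
      rw [norm_mul, ← Complex.ofReal_mul, Complex.norm_exp_ofReal_mul_I]
      simp
    rw [Finset.sum_congr rfl fun j _ => this j]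
    norm_num
  have hcont : ∀ (μ : Measure ℝ), IsProbabilityMeasure μ → Continuous (charFun μ) := by
    intro μ _
    exact continuous_charFun
  refine Measure.ext_of_charFun (funext fun t => ?_)
  have step : ∀ t : ℝ, ‖charFun P t - charFun (cantorDist r) t‖
      ≤ ‖charFun P (r * t) - charFun (cantorDist r) (r * t)‖ := by
    intro t
    rw [key P inferInstance hP t, key _ inferInstance (cantorDist_selfSimilar h0 h1) t, ← mul_sub,
      norm_mul]
    exact mul_le_of_le_one_left (norm_nonneg _) (hc t)
  have iter : ∀ n : ℕ, ‖charFun P t - charFun (cantorDist r) t‖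
      ≤ ‖charFun P (r ^ n * t) - charFun (cantorDist r) (r ^ n * t)‖ := by
    intro n
    induction n with
    | zero => simp
    | succ n ih =>
      refine ih.trans ((step _).trans (le_of_eq ?_))
      rw [pow_succ', mul_assoc]
  have hlim : Filter.Tendsto
      (fun n : ℕ => ‖charFun P (r ^ n * t) - charFun (cantorDist r) (r ^ n * t)‖)
      Filter.atTop (nhds 0) := by
    have h2 : Filter.Tendsto (fun n : ℕ => r ^ n * t) Filter.atTop (nhds 0) := by
      simpa using (tendsto_pow_atTop_nhds_zero_of_lt_one h0.le (by linarith)).mul_const t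
    have h3 := ((((hcont P inferInstance).sub (hcont (cantorDist r) inferInstance)).norm).tendsto
      0).comp h2
    simpa [Function.comp_def] using h3
  have := le_of_tendsto_of_tendsto' tendsto_const_nhds hlim iter
  exact sub_eq_zero.mp (norm_le_zero_iff.mp this)

/-! ### Optimal sets of `n`-means -/

/-- The distortion error `V(P; α) = ∫ min_{a ∈ α} |x - a|² dP(x)`, as an element of `[0, ∞]`
(it is `∞` for `α = ∅` and `P ≠ 0`). -/
def distortion (P : Measure ℝ) (α : Set ℝ) : ℝ≥0∞ :=
  ∫⁻ x, ⨅ a ∈ α, ENNReal.ofReal (|x - a| ^ 2) ∂P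

/-- The `n`th quantization error `V_n(P) = inf {V(P; α) : card α ≤ n}`. -/
def quantizationError (P : Measure ℝ) (n : ℕ) : ℝ≥0∞ :=
  ⨅ (α : Set ℝ) (_ : α.encard ≤ n), distortion P α

/-- `α` is an optimal set of `n`-means for `P`. -/
def IsOptimalSet (P : Measure ℝ) (n : ℕ) (α : Set ℝ) : Prop :=
  α.encard ≤ n ∧ distortion P α = quantizationError P n

/-! ### The sets `β_n` and `γ_n` -/

/-- `a(σ) = S_σ(1 / 2)` for a single word `σ`. -/
def centre (r : ℝ) (σ : List (Fin 3)) : ℝ := SWord r σ (1 / 2)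

/-- `a(σ, τ, …, δ) = E(X | X ∈ J_σ ∪ J_τ ∪ ⋯ ∪ J_δ)`, the mean of `P` over this union, for a
finite collection `W` of words. -/
def condMean (r : ℝ) (W : Finset (List (Fin 3))) : ℝ :=
  ((cantorDist r).real (⋃ σ ∈ W, J r σ))⁻¹ * ∫ x in ⋃ σ ∈ W, J r σ, x ∂cantorDist r

/-- `β_2 = {a(1), a(2, 3)}`. -/
def beta2 (r : ℝ) : Set ℝ := {centre r [0], condMean r {[1], [2]}}

/-- `γ_2 = {a(1, 21), a(22, 23, 3)}`. -/
def gamma2 (r : ℝ) : Set ℝ := {condMean r {[0], [1, 0]}, condMean r {[1, 1], [1, 2], [2]}}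

/-- `β_3 = γ_3 = {a(1), a(2), a(3)}`. -/
def triple (r : ℝ) : Set ℝ := {centre r [0], centre r [1], centre r [2]}

/-- `ℓ(n)`, the natural number with `3 ^ ℓ(n) ≤ n < 3 ^ (ℓ(n) + 1)`. -/
def ell (n : ℕ) : ℕ := Nat.log 3 n

lemma ell_spec {n : ℕ} (hn : 3 ≤ n) : 3 ^ ell n ≤ n ∧ n < 3 ^ (ell n + 1) :=
  ⟨Nat.pow_log_le_self 3 (by omega), Nat.lt_pow_succ_log_self (by norm_num) n⟩

/-- The index sets `I ⊂ {1, 2, 3}^ℓ(n)` allowed for `n ≥ 3`: the cardinality is `n - 3 ^ ℓ(n)` if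
`n ≤ 2 · 3 ^ ℓ(n)`, and `n - 2 · 3 ^ ℓ(n)` otherwise. -/
def Admissible (n : ℕ) (I : Finset (List (Fin 3))) : Prop :=
  (∀ ω ∈ I, ω.length = ell n) ∧
    I.card = if n ≤ 2 * 3 ^ ell n then n - 3 ^ ell n else n - 2 * 3 ^ ell n

/-- The set built for `n ≥ 3` from a two-point set `A` (which is `β_2` or `γ_2`) and an index
set `I`: if `n ≤ 2 · 3 ^ ℓ(n)`, it consists of the points `a(ω)` with `ω ∉ I` and of the sets
`S_ω(A)` with `ω ∈ I`; otherwise, of the sets `S_ω(A)` with `ω ∉ I` and of the sets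
`S_ω({a(1), a(2), a(3)})` with `ω ∈ I`. Here `ω` runs over the words of length `ℓ(n)`. -/
def meansSet (r : ℝ) (A : Set ℝ) (n : ℕ) (I : Finset (List (Fin 3))) : Set ℝ :=
  if n ≤ 2 * 3 ^ ell n then
    (⋃ (ω : List (Fin 3)) (_ : ω.length = ell n ∧ ω ∉ I), {centre r ω}) ∪
      ⋃ ω ∈ I, SWord r ω '' A
  else
    (⋃ (ω : List (Fin 3)) (_ : ω.length = ell n ∧ ω ∉ I), SWord r ω '' A) ∪
      ⋃ ω ∈ I, SWord r ω '' triple r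

/-- All the sets of the family built from `A` are optimal sets of `n`-means, for all `n ≥ 2`: the
set `A` itself is one for `n = 2`, and for `n ≥ 3` so is the set for every choice of `I`. -/
def FamilyOptimal (r : ℝ) (A : Set ℝ) : Prop :=
  IsOptimalSet (cantorDist r) 2 A ∧
    ∀ n : ℕ, 3 ≤ n → ∀ I : Finset (List (Fin 3)), Admissible n I →
      IsOptimalSet (cantorDist r) n (meansSet r A n I)

/-- The sets `β_n` are optimal sets of `n`-means for all `n ≥ 2`. -/
def BetaOptimal (r : ℝ) : Prop := FamilyOptimal r (beta2 r)

/-- The sets `γ_n` are optimal sets of `n`-means for all `n ≥ 2`. -/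
def GammaOptimal (r : ℝ) : Prop := FamilyOptimal r (gamma2 r)

/-! ### The equations for the bounds -/

/-- The first equation, whose root in `(0, 1 / 3)` is `r₀`. -/
def Eq0 (r : ℝ) : Prop :=
  -((3 * r ^ 5 + 15 * r ^ 4 + 6 * r ^ 3 - 42 * r ^ 2 + 31 * r - 13) / (240 * (r + 1))) =
    -((3 * r ^ 3 - 3 * r ^ 2 + r - 1) / (24 * (r + 1)))

/-- The second equation, whose root in `(0, 1 / 3)` is `r₁`. -/
def Eq1 (r : ℝ) : Prop :=
  -((3 * r ^ 5 + 15 * r ^ 4 + 6 * r ^ 3 - 42 * r ^ 2 + 31 * r - 13) / (240 * (r + 1))) =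
    -((3 * r ^ 7 + 15 * r ^ 6 + 60 * r ^ 5 + 66 * r ^ 4 + 18 * r ^ 3 - 324 * r ^ 2 + 283 * r - 121)
      / (2184 * (r + 1)))

end TriadicCantor

end

open TriadicCantor

/-!
# Optimal quantization of the triadic uniform Cantor distributions

Let `D r A` be the distortion of a finite set `A` and `var r` the variance of the Cantor
distribution. By self-similarity, `D r A` is `r ^ 2 / 3` times the sum of the distortions of the
three preimages `pull r j A` (`D_selfSimilar`), so a set that is the union of copies of smaller sets
in the basic intervals of level `l` has at most the average of their distortions, times `r ^ (2 l)`
(`D_assembled_le`). If a pair has distortion `var r - G`, the sets built from it with at most `n`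
points therefore have distortion at most `err r G n`, the piecewise linear interpolation between
`n = 3 ^ l`, `2 * 3 ^ l` and `3 ^ (l + 1)`. The pairs `beta2 r` and `gamma2 r` have
`G = (1 - r) ^ 2 / 8` and `G = (3 + r) ^ 2 * (1 - r) ^ 2 / 80`, since they cut off one third and
four ninths of the mass. Cutting off `13 / 27` gives
`G = (1 - r) ^ 2 * (9 + 3 * r + r ^ 2) ^ 2 / 728`. The two equations of the theorem say when the
second of these numbers equals the first and the third, that is `(3 + r) ^ 2 = 10` and
`10 * (9 + 3 * r + r ^ 2) ^ 2 = 91 * (3 + r) ^ 2`.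

*Two points.* For `p ≤ q`, the distortion of `{p, q}` is explicit in terms of the convex function
`phi r s = ∫ (s - 2 t)⁺` at `s = p + q` (`pair_eq`). A line above `phi r` with slope `m` bounds the
distortion from below as if `p` served mass `m` (`le_pair_of_line`), and the self-similarity of
`phi r` provides a few lines one of which lies above it at every point (`phi_le_fine`). Hence no
pair gains more than the largest of the three numbers above, for `r ≤ 29 / 125` (`le_D_pair`); this
bound slightly exceeds the second critical ratio. The same lines show that `gamma2 r` is worse than
`beta2 r` below the first critical ratio (`lt_D_gamma2_of_lt`), and worse than the pair cutting off
`13 / 27` above the second one (`lt_D_gamma2_of_gt`).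

*More points.* The lower bound `err_le_D` is an induction on `n`. Cut a set of `n` points at the
midpoints of the two gaps, so that each of the three intervals has its near points; the others are
its far points. Since `err r G` is convex, the even distribution of the points over the intervals is
the best one (`Admits.err_le_split`), and the bound follows if far points never help. They do not
against three or more near points (`le_D_union`) or two (`le_D_two`), and an interval without near
points is too expensive (`three_var_le`). Against a single near point they help only if they are
near points of a neighbour that protrude far into the gap, and only by `3 / 125` in local
coordinates (`le_D_one`). In an interval with one or two points, protruding costs at least as much;
with three or more, it is better to move one of them to the interval with the single point
(`Admits.err_swap`). The thresholds are chosen so that all this is a matter of polynomial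
inequalities in `r`: in local coordinates half a gap has length `del r`, a point at distance at
least `103 / 200` does not help, and for `r < 247 / 1250` no point of a neighbour is closer than
that.
-/

open MeasureTheory ProbabilityTheory Set
open scoped ENNReal

noncomputable section

namespace TriadicCantor

/-! ### Integration against the Cantor distribution -/

lemma point_mem_Icc {r : ℝ} (h0 : 0 < r) (h1 : r < 1 / 3) (ω : ℕ → Fin 3) :
    point r ω ∈ Icc (0 : ℝ) 1 := by
  have hnn : ∀ k, 0 ≤ r ^ k * (((ω k : ℕ) : ℝ) / 2 * (1 - r)) := fun k =>
    mul_nonneg (by positivity) (mul_nonneg (by positivity) (by linarith))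
  refine ⟨tsum_nonneg hnn, ?_⟩
  have hs : Summable fun k => r ^ k * (((ω k : ℕ) : ℝ) / 2 * (1 - r)) :=
    Summable.of_norm_bounded (summable_bound h0 h1) fun k => digit_bound h0 h1 k (ω k)
  have hle : ∀ k, r ^ k * (((ω k : ℕ) : ℝ) / 2 * (1 - r)) ≤ r ^ k * (1 - r) := by
    intro k
    have hj : (((ω k : Fin 3) : ℕ) : ℝ) ≤ 2 := by exact_mod_cast Nat.le_of_lt_succ (ω k).2
    have : (((ω k : Fin 3) : ℕ) : ℝ) / 2 * (1 - r) ≤ 1 - r := by nlinarith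
    exact mul_le_mul_of_nonneg_left this (by positivity)
  have h2 : Summable fun k : ℕ => r ^ k * (1 - r) := (summable_bound h0 h1).mul_right _
  calc point r ω ≤ ∑' k : ℕ, r ^ k * (1 - r) := hs.tsum_le_tsum hle h2
    _ = 1 := by
      rw [tsum_mul_right, tsum_geometric_of_lt_one h0.le (by linarith)]
      exact inv_mul_cancel₀ (by linarith)

lemma ae_mem_Icc {r : ℝ} (h0 : 0 < r) (h1 : r < 1 / 3) :
    ∀ᵐ x ∂cantorDist r, x ∈ Icc (0 : ℝ) 1 := by
  unfold cantorDist
  refine (ae_map_iff (measurable_point h0 h1).aemeasurable measurableSet_Icc).2 ?_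
  exact Filter.Eventually.of_forall (point_mem_Icc h0 h1)

lemma integrable_of_bounded {r : ℝ} (h0 : 0 < r) (h1 : r < 1 / 3) {f : ℝ → ℝ}
    (hf : Measurable f) {C : ℝ} (hC : ∀ x ∈ Icc (0 : ℝ) 1, |f x| ≤ C) :
    Integrable f (cantorDist r) := by
  have := isProbabilityMeasure_cantorDist h0 h1
  refine Integrable.of_bound (C := C) hf.aestronglyMeasurable ?_
  filter_upwards [ae_mem_Icc h0 h1] with x hx using hC x hx

lemma integrable_of_continuous {r : ℝ} (h0 : 0 < r) (h1 : r < 1 / 3) {f : ℝ → ℝ}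
    (hf : Continuous f) : Integrable f (cantorDist r) := by
  obtain ⟨C, hC⟩ := isCompact_Icc.exists_bound_of_continuousOn (s := Icc (0 : ℝ) 1) hf.continuousOn
  exact integrable_of_bounded h0 h1 hf.measurable hC

lemma S_mem_Icc {r : ℝ} (h0 : 0 < r) (h1 : r < 1 / 3) (j : Fin 3) {x : ℝ}
    (hx : x ∈ Icc (0 : ℝ) 1) : S r j x ∈ Icc (0 : ℝ) 1 := by
  obtain ⟨a, b⟩ := hx
  fin_cases j <;> simp [S] <;> constructor <;> nlinarith

/-- The self-similarity of `P`, tested against a bounded measurable function. -/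
lemma integral_cantorDist {r : ℝ} (h0 : 0 < r) (h1 : r < 1 / 3) {f : ℝ → ℝ}
    (hf : Measurable f) {C : ℝ} (hC : ∀ x ∈ Icc (0 : ℝ) 1, |f x| ≤ C) :
    ∫ x, f x ∂cantorDist r = (∑ j : Fin 3, ∫ x, f (S r j x) ∂cantorDist r) / 3 := by
  have hi : ∀ j, Integrable (fun x => f (S r j x)) (cantorDist r) := fun j =>
    integrable_of_bounded h0 h1 (hf.comp (measurable_S r j))
      fun x hx => hC _ (S_mem_Icc h0 h1 j hx)
  conv_lhs => rw [cantorDist_selfSimilar h0 h1]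
  rw [integral_finsetSum_measure]
  · rw [Finset.sum_div]
    refine Finset.sum_congr rfl fun j _ => ?_
    rw [integral_smul_measure, integral_map (measurable_S r j).aemeasurable
      hf.aestronglyMeasurable]
    simp
    ring
  · intro j _
    refine Integrable.smul_measure ?_ (by simp)
    exact (integrable_map_measure hf.aestronglyMeasurable (measurable_S r j).aemeasurable).2 (hi j)

lemma integral_of_continuous {r : ℝ} (h0 : 0 < r) (h1 : r < 1 / 3) {f : ℝ → ℝ}
    (hf : Continuous f) :
    ∫ x, f x ∂cantorDist r = (∑ j : Fin 3, ∫ x, f (S r j x) ∂cantorDist r) / 3 := by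
  obtain ⟨C, hC⟩ := isCompact_Icc.exists_bound_of_continuousOn (s := Icc (0 : ℝ) 1) hf.continuousOn
  exact integral_cantorDist h0 h1 hf.measurable hC

/-- `P` is invariant under the reflection `x ↦ 1 - x`, being the only solution of the
reflected equation. -/
lemma map_reflect {r : ℝ} (h0 : 0 < r) (h1 : r < 1 / 3) :
    (cantorDist r).map (fun x => 1 - x) = cantorDist r := by
  have := isProbabilityMeasure_cantorDist h0 h1
  have hm : Measurable (fun x : ℝ => 1 - x) := by fun_prop
  have : IsProbabilityMeasure ((cantorDist r).map fun x => 1 - x) :=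
    Measure.isProbabilityMeasure_map hm.aemeasurable
  refine eq_cantorDist h0 h1 _ ?_
  have hc : ∀ j : Fin 3, ((cantorDist r).map (S r j)).map (fun x => 1 - x)
      = ((cantorDist r).map fun x => 1 - x).map (S r (Fin.rev j)) := by
    intro j
    rw [Measure.map_map hm (measurable_S r j), Measure.map_map (measurable_S r _) hm]
    congr 1
    funext x
    fin_cases j <;> simp [S, Fin.rev] <;> ring
  conv_lhs => rw [cantorDist_selfSimilar h0 h1]
  ext s hs
  rw [Measure.map_apply hm hs]
  simp only [Measure.finsetSum_apply, Measure.smul_apply]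
  simp only [← Measure.map_apply hm hs, hc]
  exact Fintype.sum_equiv Fin.revPerm _ _ fun j => by simp

lemma integral_reflect {r : ℝ} (h0 : 0 < r) (h1 : r < 1 / 3) {f : ℝ → ℝ} (hf : Continuous f) :
    ∫ x, f (1 - x) ∂cantorDist r = ∫ x, f x ∂cantorDist r := by
  conv_rhs => rw [← map_reflect h0 h1]
  rw [integral_map (by fun_prop) hf.aestronglyMeasurable]

lemma integral_cst {r : ℝ} (h0 : 0 < r) (h1 : r < 1 / 3) (c : ℝ) :
    ∫ _, c ∂cantorDist r = c := by
  have := isProbabilityMeasure_cantorDist h0 h1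
  simp

lemma integral_id_eq {r : ℝ} (h0 : 0 < r) (h1 : r < 1 / 3) : ∫ x, x ∂cantorDist r = 1 / 2 := by
  have h := integral_reflect h0 h1 continuous_id
  simp only [id] at h
  rw [integral_sub (integrable_of_continuous h0 h1 continuous_const)
    (integrable_of_continuous h0 h1 continuous_id'), integral_cst h0 h1] at h
  linarith

/-- The variance of `P`. -/
def var (r : ℝ) : ℝ := (1 - r) / (6 * (1 + r))

lemma integral_quadratic {r : ℝ} (h0 : 0 < r) (h1 : r < 1 / 3) (a b c : ℝ) :
    ∫ x, (a * x ^ 2 + b * x + c) ∂cantorDist r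
      = a * ∫ x, x ^ 2 ∂cantorDist r + b / 2 + c := by
  have i1 : Integrable (fun x : ℝ => a * x ^ 2) (cantorDist r) :=
    integrable_of_continuous h0 h1 (by fun_prop)
  have i2 : Integrable (fun x : ℝ => b * x) (cantorDist r) :=
    integrable_of_continuous h0 h1 (by fun_prop)
  have i3 : Integrable (fun _ : ℝ => c) (cantorDist r) :=
    integrable_of_continuous h0 h1 (by fun_prop)
  rw [integral_add (f := fun x => a * x ^ 2 + b * x) (i1.add i2) i3, integral_add i1 i2,
    integral_const_mul, integral_const_mul, integral_id_eq h0 h1, integral_cst h0 h1]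
  ring

lemma integral_sq {r : ℝ} (h0 : 0 < r) (h1 : r < 1 / 3) :
    ∫ x, x ^ 2 ∂cantorDist r = var r + 1 / 4 := by
  have h := integral_of_continuous h0 h1 (f := fun x : ℝ => x ^ 2) (by fun_prop)
  have e : ∀ j : Fin 3, ∫ x, S r j x ^ 2 ∂cantorDist r = r ^ 2 * (∫ x, x ^ 2 ∂cantorDist r)
      + (2 * r * ((j : ℕ) / 2 * (1 - r))) / 2 + ((j : ℕ) / 2 * (1 - r)) ^ 2 := by
    intro j
    rw [← integral_quadratic h0 h1]
    congr 1
    funext x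
    simp only [S]
    ring
  rw [Finset.sum_congr rfl fun j _ => e j, Fin.sum_univ_three] at h
  simp only [Fin.val_zero, Fin.val_one, Fin.val_two] at h
  push_cast at h
  have h2 : (1 - r ^ 2) * (∫ x, x ^ 2 ∂cantorDist r) = (1 - r) * (5 + r) / 12 := by linarith
  have h3 : (1 - r ^ 2) ≠ 0 := by nlinarith
  have h4 : 1 + r ≠ 0 := by linarith
  unfold var
  rw [← mul_right_inj' h3, h2]
  field_simp
  ring

/-- The second moment of `P` about a point. -/
lemma integral_sub_sq {r : ℝ} (h0 : 0 < r) (h1 : r < 1 / 3) (b : ℝ) :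
    ∫ x, (x - b) ^ 2 ∂cantorDist r = var r + (b - 1 / 2) ^ 2 := by
  have := integral_quadratic h0 h1 1 (-2 * b) (b ^ 2)
  rw [integral_sq h0 h1] at this
  rw [show (fun x : ℝ => (x - b) ^ 2) = fun x => 1 * x ^ 2 + -2 * b * x + b ^ 2 by funext x; ring,
    this]
  ring

/-! ### The one-sided first moments `Φ` -/

/-- `Φ(s) = ∫ (s - 2t)⁺ dP(t)`, a convex function of `s`. For `p ≤ q`, adding the point `p` to `q`
lowers the distortion by `(q - p) Φ(p + q)`; `(p + q) / 2` separates the two Voronoi regions. -/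
def phi (r s : ℝ) : ℝ := ∫ t, max (s - 2 * t) 0 ∂cantorDist r

lemma integral_mono_Icc {r : ℝ} (h0 : 0 < r) (h1 : r < 1 / 3) {f g : ℝ → ℝ} (hf : Continuous f)
    (hg : Continuous g) (h : ∀ x ∈ Icc (0 : ℝ) 1, f x ≤ g x) :
    ∫ x, f x ∂cantorDist r ≤ ∫ x, g x ∂cantorDist r := by
  refine integral_mono_ae (integrable_of_continuous h0 h1 hf) (integrable_of_continuous h0 h1 hg) ?_
  filter_upwards [ae_mem_Icc h0 h1] with x hx using h x hx

lemma integral_congr_Icc {r : ℝ} (h0 : 0 < r) (h1 : r < 1 / 3) {f g : ℝ → ℝ}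
    (h : ∀ x ∈ Icc (0 : ℝ) 1, f x = g x) :
    ∫ x, f x ∂cantorDist r = ∫ x, g x ∂cantorDist r := by
  refine integral_congr_ae ?_
  filter_upwards [ae_mem_Icc h0 h1] with x hx using h x hx

lemma phi_nonneg (r s : ℝ) : 0 ≤ phi r s := integral_nonneg fun _ => le_max_right _ _

lemma phi_of_nonpos {r s : ℝ} (h0 : 0 < r) (h1 : r < 1 / 3) (hs : s ≤ 0) : phi r s = 0 := by
  unfold phi
  rw [integral_congr_Icc h0 h1 (g := fun _ => (0 : ℝ)), integral_cst h0 h1]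
  intro x hx
  exact max_eq_right (by linarith [hx.1])

lemma integral_linear {r : ℝ} (h0 : 0 < r) (h1 : r < 1 / 3) (s : ℝ) :
    ∫ t, (s - 2 * t) ∂cantorDist r = s - 1 := by
  have := integral_quadratic h0 h1 0 (-2) s
  rw [show (fun t : ℝ => s - 2 * t) = fun t => 0 * t ^ 2 + -2 * t + s by funext x; ring, this]
  ring

lemma phi_of_two_le {r s : ℝ} (h0 : 0 < r) (h1 : r < 1 / 3) (hs : 2 ≤ s) : phi r s = s - 1 := by
  rw [← integral_linear h0 h1]
  exact integral_congr_Icc h0 h1 fun x hx => max_eq_left (by linarith [hx.2])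

lemma phi_ge {r : ℝ} (h0 : 0 < r) (h1 : r < 1 / 3) (s : ℝ) : s - 1 ≤ phi r s := by
  rw [← integral_linear h0 h1]
  exact integral_mono_Icc h0 h1 (by fun_prop) (by fun_prop) fun x _ => le_max_left _ _

lemma phi_mono {r s s' : ℝ} (h0 : 0 < r) (h1 : r < 1 / 3) (h : s ≤ s') : phi r s ≤ phi r s' :=
  integral_mono_Icc h0 h1 (by fun_prop) (by fun_prop) fun x _ =>
    max_le_max (by linarith) le_rfl

lemma phi_symm {r : ℝ} (h0 : 0 < r) (h1 : r < 1 / 3) (s : ℝ) :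
    phi r (2 - s) = phi r s + 1 - s := by
  have h : phi r s - (s - 1) = phi r (2 - s) := by
    unfold phi
    rw [← integral_linear h0 h1, ← integral_sub (integrable_of_continuous h0 h1 (by fun_prop))
      (integrable_of_continuous h0 h1 (by fun_prop)), ← integral_reflect h0 h1 (by fun_prop)]
    congr 1
    funext x
    rcases le_total (s - 2 * (1 - x)) 0 with h | h
    · rw [max_eq_right h, max_eq_left (by linarith)]
      ring
    · rw [max_eq_left h, max_eq_right (by linarith)]
      ring
  linarith

/-- The chord from `0`, where the convex function `Φ` vanishes. -/
lemma phi_le_mul {r s u : ℝ} (h0 : 0 < r) (h1 : r < 1 / 3) (hs : 0 ≤ s) (hu : s ≤ u) (hu0 : 0 < u) :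
    phi r s ≤ s / u * phi r u := by
  unfold phi
  rw [← integral_const_mul]
  refine integral_mono_Icc h0 h1 (by fun_prop) (by fun_prop) fun x hx => ?_
  have h2 : s / u ≤ 1 := (div_le_one hu0).2 hu
  have h3 : 0 ≤ s / u := by positivity
  have h4 : s / u * u = s := div_mul_cancel₀ _ hu0.ne'
  refine max_le ?_ (mul_nonneg h3 (le_max_right _ _))
  refine le_trans ?_ (mul_le_mul_of_nonneg_left (le_max_left _ _) h3)
  nlinarith [hx.1]

lemma phi_le_half {r s : ℝ} (h0 : 0 < r) (h1 : r < 1 / 3) (hs : 0 ≤ s) (hs2 : s ≤ 2) :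
    phi r s ≤ s / 2 := by
  have := phi_le_mul h0 h1 hs hs2 two_pos
  rw [phi_of_two_le h0 h1 le_rfl] at this
  linarith

/-- The self-similarity of `Φ`. -/
lemma phi_selfSimilar {r : ℝ} (h0 : 0 < r) (h1 : r < 1 / 3) (s : ℝ) :
    phi r s = r / 3 * (phi r (s / r) + phi r ((s - (1 - r)) / r)
      + phi r ((s - 2 * (1 - r)) / r)) := by
  have e : ∀ c : ℝ, ∫ t, max (s - 2 * (r * t + c / 2 * (1 - r))) 0 ∂cantorDist r
      = r * phi r ((s - c * (1 - r)) / r) := by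
    intro c
    unfold phi
    rw [← integral_const_mul]
    congr 1
    funext t
    rw [mul_max_of_nonneg _ _ h0.le, mul_zero]
    congr 1
    field_simp
    ring
  have h := integral_of_continuous h0 h1 (f := fun t => max (s - 2 * t) 0) (by fun_prop)
  rw [Fin.sum_univ_three] at h
  simp only [S, Fin.val_zero, Fin.val_one, Fin.val_two, e] at h
  rw [phi, h]
  push_cast
  rw [zero_mul, sub_zero, one_mul]
  ring

lemma phi_one {r : ℝ} (h0 : 0 < r) (h1 : r < 1 / 3) : phi r 1 = (1 - r) / (3 - r) := by
  have h := phi_selfSimilar h0 h1 1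
  rw [phi_of_two_le h0 h1 ((le_div_iff₀ h0).2 (by linarith)),
    show (1 - (1 - r)) / r = 1 by field_simp; ring,
    phi_of_nonpos h0 h1 (s := (1 - 2 * (1 - r)) / r)
      (div_nonpos_of_nonpos_of_nonneg (by linarith) h0.le)] at h
  have h3 : 3 - r ≠ 0 := by linarith
  rw [eq_div_iff h3]
  have : r * (1 / r) = 1 := by field_simp
  linear_combination 3 * h + this

/-! ### Piecewise linear bounds for `Φ` -/

lemma phi_of_le {r s : ℝ} (h0 : 0 < r) (h1 : r < 1 / 3) (hs : s ≤ 1 - r) :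
    phi r s = r / 3 * phi r (s / r) := by
  rw [phi_selfSimilar h0 h1 s, phi_of_nonpos h0 h1 (s := (s - (1 - r)) / r)
      (div_nonpos_of_nonpos_of_nonneg (by linarith) h0.le),
    phi_of_nonpos h0 h1 (s := (s - 2 * (1 - r)) / r)
      (div_nonpos_of_nonpos_of_nonneg (by linarith) h0.le)]
  ring

lemma phi_gap {r s : ℝ} (h0 : 0 < r) (h1 : r < 1 / 3) (hs : 2 * r ≤ s) (hs' : s ≤ 1 - r) :
    phi r s = (s - r) / 3 := by
  rw [phi_of_le h0 h1 hs', phi_of_two_le h0 h1 ((le_div_iff₀ h0).2 hs)]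
  field_simp

lemma phi_mid {r s : ℝ} (h0 : 0 < r) (h1 : r < 1 / 3) (hs : 1 - r ≤ s) (hs' : s ≤ 2 * (1 - r)) :
    phi r s = (s - r) / 3 + r / 3 * phi r ((s - (1 - r)) / r) := by
  rw [phi_selfSimilar h0 h1 s, phi_of_two_le h0 h1 ((le_div_iff₀ h0).2 (by linarith : 2 * r ≤ s)),
    phi_of_nonpos h0 h1 (s := (s - 2 * (1 - r)) / r)
      (div_nonpos_of_nonpos_of_nonneg (by linarith) h0.le)]
  field_simp
  ring

lemma phi_le_sixth {r s : ℝ} (h0 : 0 < r) (h1 : r < 1 / 3) (hs : 0 ≤ s) (hs' : s ≤ 2 * r) :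
    phi r s ≤ s / 6 := by
  rw [phi_of_le h0 h1 (by linarith)]
  have := phi_le_half h0 h1 (s := s / r) (by positivity) ((div_le_iff₀ h0).2 hs')
  calc r / 3 * phi r (s / r) ≤ r / 3 * (s / r / 2) := by gcongr
    _ = s / 6 := by field_simp; ring

lemma phi_le_centre {r s : ℝ} (h0 : 0 < r) (h1 : r < 1 / 3) (hs : 1 - r ≤ s) (hs' : s ≤ 1 + r) :
    phi r s ≤ (s - (1 + r) / 3) / 2 := by
  rw [phi_mid h0 h1 hs (by linarith)]
  have := phi_le_half h0 h1 (s := (s - (1 - r)) / r) (div_nonneg (by linarith) h0.le)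
    ((div_le_iff₀ h0).2 (by linarith))
  calc (s - r) / 3 + r / 3 * phi r ((s - (1 - r)) / r)
      ≤ (s - r) / 3 + r / 3 * ((s - (1 - r)) / r / 2) := by gcongr
    _ = (s - (1 + r) / 3) / 2 := by field_simp; ring

/-- The chords of the convex function `Φ` over the three first-level intervals, together with its
values on the two gaps. -/
lemma phi_le_three {r s : ℝ} (h0 : 0 < r) (h1 : r < 1 / 3) (hs : 0 ≤ s) (hs' : s ≤ 1 + r) :
    (s < 2 * r ∧ phi r s ≤ s / 6) ∨ (2 * r ≤ s ∧ s < 1 - r ∧ phi r s ≤ (s - r) / 3) ∨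
      (1 - r ≤ s ∧ phi r s ≤ (s - (1 + r) / 3) / 2) := by
  rcases lt_or_ge s (2 * r) with h | h
  · exact Or.inl ⟨h, phi_le_sixth h0 h1 hs h.le⟩
  rcases lt_or_ge s (1 - r) with h2 | h2
  · exact Or.inr (Or.inl ⟨h, h2, (phi_gap h0 h1 h h2.le).le⟩)
  · exact Or.inr (Or.inr ⟨h2, phi_le_centre h0 h1 h2 hs'⟩)

/-- The bounds of `phi_le_three` extended to `[0, 2]` by symmetry. -/
lemma phi_le_five {r s : ℝ} (h0 : 0 < r) (h1 : r < 1 / 3) (hs : 0 ≤ s) (hs' : s ≤ 2) :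
    phi r s ≤ s / 6 ∨ phi r s ≤ (s - r) / 3 ∨ phi r s ≤ (s - (1 + r) / 3) / 2 ∨
      phi r s ≤ 2 / 3 * (s - (1 + r) / 2) ∨ phi r s ≤ 5 / 6 * (s - 4 / 5) := by
  rcases le_or_gt s (1 + r) with h | h
  · rcases phi_le_three h0 h1 hs h with h | h | h
    · exact Or.inl h.2
    · exact Or.inr (Or.inl h.2.2)
    · exact Or.inr (Or.inr (Or.inl h.2))
  · have e := phi_symm h0 h1 s
    rcases phi_le_three h0 h1 (s := 2 - s) (by linarith) (by linarith) with h | h | h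
    · exact Or.inr (Or.inr (Or.inr (Or.inr (by linarith [h.2]))))
    · exact Or.inr (Or.inr (Or.inr (Or.inl (by linarith [h.2.2]))))
    · linarith [h.1]

lemma phi_le_chord {r s : ℝ} (h0 : 0 < r) (h1 : r < 1 / 3) (hs : 1 - r ≤ s) (hs' : s ≤ 2) :
    phi r s ≤ 2 / 3 * (s - 1 / 2) := by
  rcases le_or_gt s (1 + r) with h | h
  · linarith [phi_le_centre h0 h1 hs h]
  · have e := phi_symm h0 h1 s
    rcases phi_le_three h0 h1 (s := 2 - s) (by linarith) (by linarith) with h | h | h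
    · linarith [h.2]
    · linarith [h.2.2]
    · linarith [h.1]

/-- A refinement of `phi_le_three` on the first interval, where two levels are used. -/
lemma phi_le_left {r s : ℝ} (h0 : 0 < r) (h1 : r < 1 / 3) (hs : 0 ≤ s) (hs' : s ≤ 1 + r) :
    phi r s ≤ 1 / 18 * (s - 0) ∨ phi r s ≤ 1 / 9 * (s - r ^ 2) ∨ phi r s ≤ 2 / 9 * (s - r / 2) ∨
      phi r s ≤ 1 / 3 * (s - r) ∨ phi r s ≤ 1 / 2 * (s - (1 + r) / 3) := by
  rcases phi_le_three h0 h1 hs hs' with ⟨h, -⟩ | h | h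
  · have hu : s / r ≤ 2 := (div_le_iff₀ h0).2 h.le
    have hu0 : 0 ≤ s / r := by positivity
    have e := phi_of_le h0 h1 (s := s) (by linarith)
    rcases lt_or_ge (s / r) (1 - r) with h2 | h2
    · rcases phi_le_three h0 h1 hu0 (by linarith) with ⟨-, h3⟩ | ⟨-, -, h3⟩ | ⟨h3, -⟩
      · left
        rw [e]
        calc r / 3 * phi r (s / r) ≤ r / 3 * (s / r / 6) := by gcongr
          _ = 1 / 18 * (s - 0) := by field_simp; ring
      · right; left
        rw [e]
        calc r / 3 * phi r (s / r) ≤ r / 3 * ((s / r - r) / 3) := by gcongr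
          _ = 1 / 9 * (s - r ^ 2) := by field_simp; ring
      · linarith
    · right; right; left
      rw [e]
      calc r / 3 * phi r (s / r) ≤ r / 3 * (2 / 3 * (s / r - 1 / 2)) := by
            gcongr
            exact phi_le_chord h0 h1 h2 hu
        _ = 2 / 9 * (s - r / 2) := by field_simp; ring
  · exact Or.inr (Or.inr (Or.inr (Or.inl (by linarith [h.2.2]))))
  · exact Or.inr (Or.inr (Or.inr (Or.inr (by linarith [h.2]))))

/-- Upper bounds for `Φ` left of the centre: the lines cover the first interval, the gap after it
and the left half of the middle interval. Towards the centre the self-similarity of `Φ` is kept, the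
remaining variable `z` being the position relative to an interval of the third level. -/
lemma phi_le_fine {r s : ℝ} (h0 : 0 < r) (h1 : r < 1 / 3) (hs : 0 ≤ s) (hs' : s ≤ 1) :
    phi r s ≤ s / 6 ∨ phi r s ≤ (s - r) / 3 ∨ phi r s ≤ (s - r) / 3 + (s - (1 - r)) / 18 ∨
    phi r s ≤ 4 / 9 * (s - (1 + r) ^ 2 / 4) ∨
    (∃ z, 0 ≤ z ∧ z ≤ 2 ∧ s = 1 - r ^ 2 + r ^ 3 * z ∧
      phi r s = 4 / 9 * (s - (1 + r) ^ 2 / 4) + r ^ 3 / 27 * phi r z) ∨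
    phi r s ≤ 13 / 27 * s - (3 * (1 + r) ^ 2 + 1 - r ^ 2 + r ^ 3) / 27 ∨
    (∃ z, 0 ≤ z ∧ z ≤ 1 ∧ s = 1 - r ^ 3 + r ^ 3 * z ∧
      phi r s = 13 / 27 * s - (3 * (1 + r) ^ 2 + 1 - r ^ 2 + r ^ 3) / 27
        + r ^ 3 / 27 * phi r z) := by
  rcases phi_le_three h0 h1 hs (by linarith) with h | h | h
  · exact Or.inl h.2
  · exact Or.inr (Or.inl h.2.2)
  right; right
  obtain ⟨u, rfl⟩ : ∃ u, s = 1 - r + r * u := ⟨(s - (1 - r)) / r, by field_simp; ring⟩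
  have hu0 : 0 ≤ u := by nlinarith [h.1]
  have hu1 : u ≤ 1 := by nlinarith
  have e := phi_mid h0 h1 h.1 (by linarith)
  rw [show (1 - r + r * u - (1 - r)) / r = u by field_simp; ring] at e
  rcases phi_le_three h0 h1 hu0 (by linarith) with ⟨-, h2⟩ | ⟨-, -, h2⟩ | ⟨h2, -⟩
  · left
    have : r / 3 * phi r u ≤ r / 3 * (u / 6) := by gcongr
    linarith
  · right; left
    have : r / 3 * phi r u ≤ r / 3 * ((u - r) / 3) := by gcongr
    linarith
  right; right
  obtain ⟨w, rfl⟩ : ∃ w, u = 1 - r + r * w := ⟨(u - (1 - r)) / r, by field_simp; ring⟩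
  have hw0 : 0 ≤ w := by nlinarith
  have hw1 : w ≤ 1 := by nlinarith
  have e2 := phi_mid h0 h1 h2 (by linarith)
  rw [show (1 - r + r * w - (1 - r)) / r = w by field_simp; ring] at e2
  rw [e2] at e
  rcases phi_le_three h0 h1 hw0 (by linarith) with ⟨h3, -⟩ | ⟨-, -, h3⟩ | ⟨h3, -⟩
  · left
    refine ⟨w / r, by positivity, (div_le_iff₀ h0).2 h3.le, ?_, ?_⟩
    · field_simp
      ring
    · rw [e, phi_of_le h0 h1 (s := w) (by linarith)]
      ring
  · right; left
    rw [e]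
    have : r / 3 * (r / 3 * phi r w) ≤ r / 3 * (r / 3 * ((w - r) / 3)) := by gcongr
    linarith
  · right; right
    obtain ⟨z, rfl⟩ : ∃ z, w = 1 - r + r * z := ⟨(w - (1 - r)) / r, by field_simp; ring⟩
    have e3 := phi_mid h0 h1 h3 (by linarith)
    rw [show (1 - r + r * z - (1 - r)) / r = z by field_simp; ring] at e3
    refine ⟨z, by nlinarith, by nlinarith, by ring, ?_⟩
    rw [e, e3]
    ring

/-! ### The distortion of finite sets -/

/-- The distortion error of a nonempty finite set, as a real number. -/
def D (r : ℝ) (A : Finset ℝ) : ℝ := ∫ x, Metric.infDist x (A : Set ℝ) ^ 2 ∂cantorDist r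

lemma continuous_infDist_sq (A : Finset ℝ) :
    Continuous fun x : ℝ => Metric.infDist x (A : Set ℝ) ^ 2 :=
  (Metric.continuous_infDist_pt _).pow 2

lemma exists_infDist_eq {A : Finset ℝ} (hA : A.Nonempty) (x : ℝ) :
    ∃ a ∈ A, Metric.infDist x (A : Set ℝ) ^ 2 = (x - a) ^ 2 := by
  obtain ⟨a, ha, h⟩ := A.finite_toSet.isCompact.exists_infDist_eq_dist (by simpa using hA) x
  exact ⟨a, by simpa using ha, by rw [h, Real.dist_eq, sq_abs]⟩

lemma infDist_sq_le {A : Finset ℝ} {a : ℝ} (ha : a ∈ A) (x : ℝ) :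
    Metric.infDist x (A : Set ℝ) ^ 2 ≤ (x - a) ^ 2 := by
  rw [← sq_abs (x - a), ← Real.dist_eq]
  exact pow_le_pow_left₀ Metric.infDist_nonneg (Metric.infDist_le_dist_of_mem (by simpa using ha)) 2

lemma le_D {r : ℝ} (h0 : 0 < r) (h1 : r < 1 / 3) {A : Finset ℝ} (hA : A.Nonempty) {f : ℝ → ℝ}
    (hf : Continuous f) (h : ∀ x ∈ Icc (0 : ℝ) 1, ∀ a ∈ A, f x ≤ (x - a) ^ 2) :
    ∫ x, f x ∂cantorDist r ≤ D r A := by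
  refine integral_mono_Icc h0 h1 hf (continuous_infDist_sq A) fun x hx => ?_
  obtain ⟨a, ha, e⟩ := exists_infDist_eq hA x
  rw [e]
  exact h x hx a ha

lemma D_le {r : ℝ} (h0 : 0 < r) (h1 : r < 1 / 3) {A : Finset ℝ} {f : ℝ → ℝ}
    (hf : Continuous f) (h : ∀ x ∈ Icc (0 : ℝ) 1, ∃ a ∈ A, (x - a) ^ 2 ≤ f x) :
    D r A ≤ ∫ x, f x ∂cantorDist r := by
  refine integral_mono_Icc h0 h1 (continuous_infDist_sq A) hf fun x hx => ?_
  obtain ⟨a, ha, e⟩ := h x hx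
  exact (infDist_sq_le ha x).trans e

lemma D_le_D {r : ℝ} (h0 : 0 < r) (h1 : r < 1 / 3) {A B : Finset ℝ} (hB : B.Nonempty)
    (h : ∀ x ∈ Icc (0 : ℝ) 1, ∀ b ∈ B, ∃ a ∈ A, (x - a) ^ 2 ≤ (x - b) ^ 2) : D r A ≤ D r B := by
  refine D_le h0 h1 (continuous_infDist_sq B) fun x hx => ?_
  obtain ⟨b, hb, e⟩ := exists_infDist_eq hB x
  rw [e]
  exact h x hx b hb

lemma D_nonneg (r : ℝ) (A : Finset ℝ) : 0 ≤ D r A := integral_nonneg fun _ => sq_nonneg _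

lemma D_anti {r : ℝ} (h0 : 0 < r) (h1 : r < 1 / 3) {A B : Finset ℝ} (hB : B.Nonempty)
    (h : B ⊆ A) : D r A ≤ D r B :=
  D_le_D h0 h1 hB fun _ _ b hb => ⟨b, h hb, le_rfl⟩

/-- The preimage of a set under `S_j`, as a finite set. -/
def pull (r : ℝ) (j : Fin 3) (A : Finset ℝ) : Finset ℝ :=
  A.image fun a => (a - (j : ℕ) / 2 * (1 - r)) / r

lemma infDist_S_sq {r : ℝ} (h0 : 0 < r) (j : Fin 3) {A : Finset ℝ} (hA : A.Nonempty) (x : ℝ) :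
    Metric.infDist (S r j x) (A : Set ℝ) ^ 2
      = r ^ 2 * Metric.infDist x (pull r j A : Set ℝ) ^ 2 := by
  have key : ∀ a, (S r j x - a) ^ 2 = r ^ 2 * (x - (a - (j : ℕ) / 2 * (1 - r)) / r) ^ 2 := by
    intro a
    simp only [S]
    field_simp
    ring
  apply le_antisymm
  · obtain ⟨b, hb, e⟩ := exists_infDist_eq (A := pull r j A) (hA.image _) x
    obtain ⟨a, ha, rfl⟩ := Finset.mem_image.1 hb
    rw [e, ← key]
    exact infDist_sq_le ha _
  · obtain ⟨a, ha, e⟩ := exists_infDist_eq hA (S r j x)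
    rw [e, key]
    refine mul_le_mul_of_nonneg_left ?_ (sq_nonneg r)
    exact infDist_sq_le (A := pull r j A) (Finset.mem_image_of_mem _ ha) x

/-- The distortion splits over the three first-level intervals. -/
lemma D_selfSimilar {r : ℝ} (h0 : 0 < r) (h1 : r < 1 / 3) {A : Finset ℝ} (hA : A.Nonempty) :
    D r A = r ^ 2 / 3 * (D r (pull r 0 A) + D r (pull r 1 A) + D r (pull r 2 A)) := by
  have e : ∀ j, ∫ x, Metric.infDist (S r j x) (A : Set ℝ) ^ 2 ∂cantorDist r
      = r ^ 2 * D r (pull r j A) := by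
    intro j
    simp only [infDist_S_sq h0 j hA, D]
    rw [integral_const_mul]
  rw [D, integral_of_continuous h0 h1 (continuous_infDist_sq A), Fin.sum_univ_three, e, e, e]
  ring

/-- The reflection of a finite set at `1 / 2`. -/
def reflect (A : Finset ℝ) : Finset ℝ := A.image fun a => 1 - a

lemma mem_reflect {A : Finset ℝ} {a : ℝ} : a ∈ reflect A ↔ 1 - a ∈ A := by
  simp only [reflect, Finset.mem_image]
  constructor
  · rintro ⟨b, hb, rfl⟩
    simpa using hb
  · intro h
    exact ⟨1 - a, h, by ring⟩

lemma reflect_nonempty {A : Finset ℝ} (hA : A.Nonempty) : (reflect A).Nonempty := hA.image _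

lemma reflect_union (A B : Finset ℝ) : reflect (A ∪ B) = reflect A ∪ reflect B :=
  Finset.image_union _ _

lemma reflect_reflect (A : Finset ℝ) : reflect (reflect A) = A := by
  ext a
  simp [mem_reflect]

lemma D_reflect {r : ℝ} (h0 : 0 < r) (h1 : r < 1 / 3) {A : Finset ℝ} (hA : A.Nonempty) :
    D r (reflect A) = D r A := by
  have key : ∀ {B : Finset ℝ}, B.Nonempty → D r (reflect B) ≤ D r B := by
    intro B hB
    have e : D r B = ∫ x, Metric.infDist (1 - x) (B : Set ℝ) ^ 2 ∂cantorDist r :=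
      (integral_reflect h0 h1 (continuous_infDist_sq B)).symm
    rw [e]
    refine D_le h0 h1 ((continuous_infDist_sq B).comp (by fun_prop)) fun x _ => ?_
    obtain ⟨b, hb, e⟩ := exists_infDist_eq hB (1 - x)
    refine ⟨1 - b, mem_reflect.2 (by simpa using hb), le_of_eq ?_⟩
    rw [e]
    ring
  refine le_antisymm (key hA) ?_
  conv_lhs => rw [← reflect_reflect A]
  exact key (reflect_nonempty hA)

lemma D_singleton {r : ℝ} (h0 : 0 < r) (h1 : r < 1 / 3) (b : ℝ) :
    D r {b} = var r + (b - 1 / 2) ^ 2 := by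
  rw [← integral_sub_sq h0 h1, D]
  simp [Real.dist_eq]

lemma integral_three {r : ℝ} (h0 : 0 < r) (h1 : r < 1 / 3) (b x y : ℝ) :
    ∫ t, ((t - b) ^ 2 - (b + x) * max (b - x - 2 * t) 0
        - (1 + y - b) * max ((1 - b - y) - 2 * (1 - t)) 0) ∂cantorDist r
      = var r + (b - 1 / 2) ^ 2 - (b + x) * phi r (b - x)
        - (1 + y - b) * phi r (1 - b - y) := by
  rw [integral_sub (integrable_of_continuous h0 h1 (by fun_prop))
      (integrable_of_continuous h0 h1 (by fun_prop)),
    integral_sub (integrable_of_continuous h0 h1 (by fun_prop))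
      (integrable_of_continuous h0 h1 (by fun_prop)), integral_sub_sq h0 h1, integral_const_mul,
    integral_const_mul, phi, phi,
    integral_reflect h0 h1 (f := fun t => max ((1 - b - y) - 2 * t) 0) (by fun_prop)]

/-- A lower bound for sets whose points are no better than one of `-x`, `b` and `1 + y`: the
distortion of `b` alone, lowered by the gains from the outer two. -/
lemma le_D_three {r : ℝ} (h0 : 0 < r) (h1 : r < 1 / 3) {b x y : ℝ} (hx : 0 ≤ b + x)
    (hy : 0 ≤ 1 + y - b) {A : Finset ℝ} (hA : A.Nonempty)
    (h : ∀ t ∈ Icc (0 : ℝ) 1, ∀ a ∈ A, (t - b) ^ 2 ≤ (t - a) ^ 2 ∨ (t + x) ^ 2 ≤ (t - a) ^ 2 ∨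
      (t - (1 + y)) ^ 2 ≤ (t - a) ^ 2) :
    var r + (b - 1 / 2) ^ 2 - (b + x) * phi r (b - x) - (1 + y - b) * phi r (1 - b - y)
      ≤ D r A := by
  rw [← integral_three h0 h1 b x y]
  refine le_D h0 h1 hA (by fun_prop) fun t ht a ha => ?_
  have m1 := mul_nonneg hx (le_max_right (b - x - 2 * t) 0)
  have m2 := mul_nonneg hy (le_max_right ((1 - b - y) - 2 * (1 - t)) 0)
  have m3 := mul_le_mul_of_nonneg_left (le_max_left (b - x - 2 * t) 0) hx
  have m4 := mul_le_mul_of_nonneg_left (le_max_left ((1 - b - y) - 2 * (1 - t)) 0) hy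
  rcases h t ht a ha with h | h | h
  · linarith
  · nlinarith
  · nlinarith

lemma pair_eq {r : ℝ} (h0 : 0 < r) (h1 : r < 1 / 3) {p q : ℝ} (hpq : p ≤ q) :
    D r {p, q} = var r + (q - 1 / 2) ^ 2 - (q - p) * phi r (p + q) := by
  apply le_antisymm
  · rw [phi, ← integral_const_mul, ← integral_sub_sq h0 h1, ← integral_sub
      (integrable_of_continuous h0 h1 (by fun_prop)) (integrable_of_continuous h0 h1 (by fun_prop))]
    refine D_le h0 h1 (by fun_prop) fun t _ => ?_
    rcases le_total (p + q - 2 * t) 0 with h | h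
    · refine ⟨q, by simp, ?_⟩
      rw [max_eq_right h]
      linarith
    · refine ⟨p, by simp, ?_⟩
      rw [max_eq_left h]
      nlinarith
  · rw [phi, ← integral_const_mul, ← integral_sub_sq h0 h1, ← integral_sub
      (integrable_of_continuous h0 h1 (by fun_prop)) (integrable_of_continuous h0 h1 (by fun_prop))]
    refine le_D h0 h1 (by simp) (by fun_prop) fun t _ a ha => ?_
    have m1 := mul_nonneg (sub_nonneg.2 hpq) (le_max_right (p + q - 2 * t) 0)
    have m3 := mul_le_mul_of_nonneg_left (le_max_left (p + q - 2 * t) 0) (sub_nonneg.2 hpq)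
    rcases Finset.mem_insert.1 ha with rfl | ha
    · nlinarith
    · rw [Finset.mem_singleton.1 ha]
      linarith

lemma pair_eq' {r : ℝ} (h0 : 0 < r) (h1 : r < 1 / 3) {p q : ℝ} (hpq : p ≤ q) :
    D r {p, q} = var r + (p - 1 / 2) ^ 2 - (q - p) * phi r (2 - p - q) := by
  have := phi_symm h0 h1 (p + q)
  rw [pair_eq h0 h1 hpq, show 2 - p - q = 2 - (p + q) by ring, this]
  ring

/-- If no point of `A` lies in `(-R, R)`, then `A` is no better than the single point `R`. -/
lemma le_D_of_far {r : ℝ} (h0 : 0 < r) (h1 : r < 1 / 3) {A : Finset ℝ} (hA : A.Nonempty) {R : ℝ}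
    (hR : 1 ≤ R) (h : ∀ a ∈ A, a ≤ -R ∨ R ≤ a) : var r + (R - 1 / 2) ^ 2 ≤ D r A := by
  rw [← integral_sub_sq h0 h1]
  refine le_D h0 h1 hA (by fun_prop) fun x hx a ha => ?_
  rcases h a ha with h | h <;> nlinarith [hx.1, hx.2]

/-- If no point of `A` lies in `(-x, 1 + x)`, then `A` is no better than the two ends of this
interval. -/
lemma le_D_of_outside {r : ℝ} (h0 : 0 < r) (h1 : r < 1 / 3) {A : Finset ℝ} (hA : A.Nonempty)
    {x : ℝ} (hx : 0 ≤ x) (h : ∀ a ∈ A, a ≤ -x ∨ 1 + x ≤ a) :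
    var r + (1 / 2 + x) ^ 2 - (1 + 2 * x) * ((1 - r) / (3 - r)) ≤ D r A := by
  have e := pair_eq h0 h1 (p := -x) (q := 1 + x) (by linarith)
  rw [show -x + (1 + x) = 1 by ring, phi_one h0 h1] at e
  have : D r {-x, 1 + x} ≤ D r A := by
    refine D_le_D h0 h1 hA fun t ht a ha => ?_
    rcases h a ha with h | h
    · exact ⟨-x, by simp, by nlinarith [ht.1]⟩
    · exact ⟨1 + x, by simp, by nlinarith [ht.2]⟩
  linarith

/-! ### Two points -/

/-- If `Φ(s) ≤ m s - c` at `s = p + q`, then `m` acts as the mass of the Voronoi region of `p`, and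
completing the square in `p` and `q` bounds the distortion of `{p, q}`. -/
lemma le_pair_of_line {r : ℝ} (h0 : 0 < r) (h1 : r < 1 / 3) {p q m c G : ℝ} (hpq : p ≤ q)
    (hm0 : 0 < m) (hm1 : m < 1) (hG : (m - c) ^ 2 ≤ 4 * m * (1 - m) * G)
    (h : phi r (p + q) ≤ m * (p + q) - c) : var r - G ≤ D r {p, q} := by
  rw [pair_eq h0 h1 hpq]
  have h2 := mul_le_mul_of_nonneg_left h (sub_nonneg.2 hpq)
  have hmm : 0 < 4 * m * (1 - m) := by nlinarith
  have e : 4 * m * (1 - m) * ((q - 1 / 2) ^ 2 - (q - p) * (m * (p + q) - c))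
      = (1 - m) * (2 * m * p - c) ^ 2 + m * (2 * (1 - m) * q - (1 - c)) ^ 2 - (m - c) ^ 2 := by
    ring
  have h3 : 0 ≤ 4 * m * (1 - m) * ((q - 1 / 2) ^ 2 - (q - p) * (m * (p + q) - c) + G) := by
    rw [mul_add, e]
    have := mul_nonneg (sub_nonneg.2 hm1.le) (sq_nonneg (2 * m * p - c))
    have := mul_nonneg hm0.le (sq_nonneg (2 * (1 - m) * q - (1 - c)))
    linarith
  have := nonneg_of_mul_nonneg_right h3 hmm
  linarith

/-- Products that certify polynomial inequalities on `[a, b]`: in those below, the difference of the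
two sides is a nonnegative combination of Bernstein polynomials. -/
lemma bernstein_nonneg {a b r : ℝ} (ha : a ≤ r) (hb : r ≤ b) (i j : ℕ) :
    0 ≤ (r - a) ^ i * (b - r) ^ j :=
  mul_nonneg (pow_nonneg (by linarith) _) (pow_nonneg (by linarith) _)

/-- The hypothesis of `le_pair_of_line` for the refinements `Φ(z) ≤ k z - d` of the line with slope
`4 / 9`. The two ranges of `r` meet near the ratio where `(3 + r) ^ 2 = 10`, at which the two lower
bounds for `G` agree. -/
lemma fine_line_le {r : ℝ} (h0 : 0 < r) (hr : r ≤ 29 / 125) {G : ℝ} (hb : (1 - r) ^ 2 / 8 ≤ G)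
    (hg : (3 + r) ^ 2 * (1 - r) ^ 2 / 80 ≤ G) {k d : ℝ}
    (hk : (k = 1 / 6 ∧ d = 0) ∨ (k = 1 / 3 ∧ d = r / 3) ∨ (k = 1 / 2 ∧ d = (1 + r) / 6) ∨
      (k = 2 / 3 ∧ d = (1 + r) / 3) ∨ (k = 5 / 6 ∧ d = 2 / 3)) :
    ((3 + r) * (1 - r) / 9 + (k * r ^ 2 - d * r ^ 3) / 27) ^ 2
      ≤ 4 * (4 / 9 + k / 27) * (1 - (4 / 9 + k / 27)) * G := by
  rcases le_total r (163 / 1000) with h | h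
  · have B := bernstein_nonneg h0.le h
    rcases hk with ⟨rfl, rfl⟩ | ⟨rfl, rfl⟩ | ⟨rfl, rfl⟩ | ⟨rfl, rfl⟩ | ⟨rfl, rfl⟩ <;>
    linarith [B 0 8, B 1 7, B 2 6, B 3 5, B 4 4, B 5 3, B 6 2, B 7 1, B 8 0]
  · have B := bernstein_nonneg h hr
    rcases hk with ⟨rfl, rfl⟩ | ⟨rfl, rfl⟩ | ⟨rfl, rfl⟩ | ⟨rfl, rfl⟩ | ⟨rfl, rfl⟩ <;>
    linarith [B 0 8, B 1 7, B 2 6, B 3 5, B 4 4, B 5 3, B 6 2, B 7 1, B 8 0]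

/-- The hypothesis of `le_pair_of_line` for the refinements of the line with slope `13 / 27`. -/
lemma central_line_le {r : ℝ} (h0 : 0 < r) (hr : r ≤ 29 / 125) {G : ℝ} (hb : (1 - r) ^ 2 / 8 ≤ G)
    (hg : (3 + r) ^ 2 * (1 - r) ^ 2 / 80 ≤ G) {k d : ℝ}
    (hk : (k = 1 / 6 ∧ d = 0) ∨ (k = 1 / 3 ∧ d = r / 3) ∨ (k = 1 / 2 ∧ d = (1 + r) / 6)) :
    ((9 - 6 * r - 2 * r ^ 2 - r ^ 3) / 27 + (k - d) * r ^ 3 / 27) ^ 2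
      ≤ 4 * (13 / 27 + k / 27) * (1 - (13 / 27 + k / 27)) * G := by
  rcases le_total r (163 / 1000) with h | h
  · have B := bernstein_nonneg h0.le h
    rcases hk with ⟨rfl, rfl⟩ | ⟨rfl, rfl⟩ | ⟨rfl, rfl⟩ <;>
    linarith [B 0 8, B 1 7, B 2 6, B 3 5, B 4 4, B 5 3, B 6 2, B 7 1, B 8 0]
  · have B := bernstein_nonneg h hr
    rcases hk with ⟨rfl, rfl⟩ | ⟨rfl, rfl⟩ | ⟨rfl, rfl⟩ <;>
    linarith [B 0 8, B 1 7, B 2 6, B 3 5, B 4 4, B 5 3, B 6 2, B 7 1, B 8 0]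

/-- The hypothesis of `le_pair_of_line` for the line with slope `7 / 18`. -/
lemma first_chord_le {r : ℝ} (h0 : 0 < r) (hr : r ≤ 29 / 125) {G : ℝ} (hb : (1 - r) ^ 2 / 8 ≤ G)
    (hg : (3 + r) ^ 2 * (1 - r) ^ 2 / 80 ≤ G) :
    ((1 - r) / 3 + r / 18) ^ 2 ≤ 4 * (7 / 18) * (1 - 7 / 18) * G := by
  rcases le_total r (163 / 1000) with h | h
  · have B := bernstein_nonneg h0.le h
    linarith [B 0 4, B 1 3, B 2 2, B 3 1, B 4 0]
  · have B := bernstein_nonneg h hr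
    linarith [B 0 4, B 1 3, B 2 2, B 3 1, B 4 0]

lemma le_pair_of_add_le_one {r : ℝ} (h0 : 0 < r) (hr : r ≤ 29 / 125) {G : ℝ}
    (hb : (1 - r) ^ 2 / 8 ≤ G) (hg : (3 + r) ^ 2 * (1 - r) ^ 2 / 80 ≤ G)
    (hd : (1 - r) ^ 2 * (9 + 3 * r + r ^ 2) ^ 2 / 728 ≤ G) {p q : ℝ} (hpq : p ≤ q)
    (hs : p + q ≤ 1) : var r - G ≤ D r {p, q} := by
  have h1 : r < 1 / 3 := by linarith
  have hG : 0 ≤ G := le_trans (by positivity) hb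
  rcases le_or_gt (p + q) 0 with h | h
  · rw [pair_eq h0 h1 hpq, phi_of_nonpos h0 h1 h]
    nlinarith [sq_nonneg (q - 1 / 2)]
  rcases phi_le_fine h0 h1 h.le hs with h | h | h | h | ⟨z, z0, z2, e, h⟩ | h | ⟨z, z0, z1, e, h⟩
  · refine le_pair_of_line h0 h1 hpq (m := 1 / 6) (c := 0) (by norm_num) (by norm_num) ?_
      (by linarith)
    nlinarith
  · refine le_pair_of_line h0 h1 hpq (m := 1 / 3) (c := r / 3) (by norm_num) (by norm_num) ?_
      (by linarith)
    linarith
  · refine le_pair_of_line h0 h1 hpq (m := 7 / 18) (c := r / 3 + (1 - r) / 18) (by norm_num)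
      (by norm_num) ?_ (by linarith)
    have := first_chord_le h0 hr hb hg
    rw [show 7 / 18 - (r / 3 + (1 - r) / 18) = (1 - r) / 3 + r / 18 by ring]
    exact this
  · refine le_pair_of_line h0 h1 hpq (m := 4 / 9) (c := (1 + r) ^ 2 / 9) (by norm_num)
      (by norm_num) ?_ (by linarith)
    linarith
  · obtain ⟨k, d, hk, hz⟩ : ∃ k d, ((k = 1 / 6 ∧ d = 0) ∨ (k = 1 / 3 ∧ d = r / 3) ∨
        (k = 1 / 2 ∧ d = (1 + r) / 6) ∨ (k = 2 / 3 ∧ d = (1 + r) / 3) ∨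
        (k = 5 / 6 ∧ d = 2 / 3)) ∧ phi r z ≤ k * z - d := by
      rcases phi_le_five h0 h1 z0 z2 with h | h | h | h | h
      · exact ⟨_, _, Or.inl ⟨rfl, rfl⟩, by linarith⟩
      · exact ⟨_, _, Or.inr (Or.inl ⟨rfl, rfl⟩), by linarith⟩
      · exact ⟨_, _, Or.inr (Or.inr (Or.inl ⟨rfl, rfl⟩)), by linarith⟩
      · exact ⟨_, _, Or.inr (Or.inr (Or.inr (Or.inl ⟨rfl, rfl⟩))), by linarith⟩
      · exact ⟨_, _, Or.inr (Or.inr (Or.inr (Or.inr ⟨rfl, rfl⟩))), by linarith⟩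
    have hk0 : 0 < k ∧ k < 1 := by
      rcases hk with hk | hk | hk | hk | hk <;> rw [hk.1] <;> norm_num
    refine le_pair_of_line h0 h1 hpq (m := 4 / 9 + k / 27)
      (c := (1 + r) ^ 2 / 9 + (k * (1 - r ^ 2) + d * r ^ 3) / 27) (by linarith [hk0.1])
      (by linarith [hk0.2]) ?_ ?_
    · convert fine_line_le h0 hr hb hg hk using 1
      ring
    · have : r ^ 3 / 27 * phi r z ≤ r ^ 3 / 27 * (k * z - d) := by gcongr
      rw [h]
      have e2 : k * (p + q) = k * (1 - r ^ 2 + r ^ 3 * z) := by rw [e]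
      linarith
  · refine le_pair_of_line h0 h1 hpq (m := 13 / 27)
      (c := (3 * (1 + r) ^ 2 + 1 - r ^ 2 + r ^ 3) / 27) (by norm_num) (by norm_num) ?_ h
    linarith
  · obtain ⟨k, d, hk, hz⟩ : ∃ k d, ((k = 1 / 6 ∧ d = 0) ∨ (k = 1 / 3 ∧ d = r / 3) ∨
        (k = 1 / 2 ∧ d = (1 + r) / 6)) ∧ phi r z ≤ k * z - d := by
      rcases phi_le_three h0 h1 z0 (by linarith) with h | h | h
      · exact ⟨_, _, Or.inl ⟨rfl, rfl⟩, by linarith [h.2]⟩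
      · exact ⟨_, _, Or.inr (Or.inl ⟨rfl, rfl⟩), by linarith [h.2.2]⟩
      · exact ⟨_, _, Or.inr (Or.inr ⟨rfl, rfl⟩), by linarith [h.2]⟩
    have hk0 : 0 < k ∧ k < 1 := by
      rcases hk with hk | hk | hk <;> rw [hk.1] <;> norm_num
    refine le_pair_of_line h0 h1 hpq (m := 13 / 27 + k / 27)
      (c := (3 * (1 + r) ^ 2 + 1 - r ^ 2 + r ^ 3) / 27 + (k * (1 - r ^ 3) + d * r ^ 3) / 27)
      (by linarith [hk0.1]) (by linarith [hk0.2]) ?_ ?_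
    · convert central_line_le h0 hr hb hg hk using 1
      ring
    · have : r ^ 3 / 27 * phi r z ≤ r ^ 3 / 27 * (k * z - d) := by gcongr
      rw [h]
      have e2 : k * (p + q) = k * (1 - r ^ 3 + r ^ 3 * z) := by rw [e]
      linarith

lemma reflect_pair (p q : ℝ) : reflect {p, q} = {1 - q, 1 - p} := by
  rw [reflect, Finset.image_insert, Finset.image_singleton, Finset.pair_comm]

/-- The lower bound for two points: the three numbers on the left are the reductions of the
variance obtained by cutting off mass `1 / 3`, `4 / 9` and `13 / 27`. -/
lemma le_D_pair {r : ℝ} (h0 : 0 < r) (hr : r ≤ 29 / 125) {G : ℝ}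
    (hb : (1 - r) ^ 2 / 8 ≤ G) (hg : (3 + r) ^ 2 * (1 - r) ^ 2 / 80 ≤ G)
    (hd : (1 - r) ^ 2 * (9 + 3 * r + r ^ 2) ^ 2 / 728 ≤ G) (p q : ℝ) :
    var r - G ≤ D r {p, q} := by
  wlog hpq : p ≤ q generalizing p q
  · rw [Finset.pair_comm]
    exact this q p (by linarith)
  rcases le_total (p + q) 1 with h | h
  · exact le_pair_of_add_le_one h0 hr hb hg hd hpq h
  · rw [← D_reflect h0 (by linarith) (by simp), reflect_pair]
    exact le_pair_of_add_le_one h0 hr hb hg hd (by linarith) (by linarith)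

/-! ### Half of a gap in local coordinates -/

/-- Half the length of a first-level gap, divided by the length `r` of a first-level interval. In
the coordinates of such an interval, the points beyond the midpoint of an adjacent gap are those
outside `(-del r, 1 + del r)`. -/
def del (r : ℝ) : ℝ := (1 - 3 * r) / (4 * r)

lemma del_mul {r : ℝ} (h0 : 0 < r) : 4 * r * del r = 1 - 3 * r := by
  unfold del
  field_simp

/-- A linear lower bound, close to the tangent at `29 / 125`. -/
lemma del_ge {r : ℝ} (h0 : 0 < r) : 131 / 400 + 116 / 25 * (29 / 125 - r) ≤ del r := by
  unfold del
  rw [le_div_iff₀ (by linarith)]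
  nlinarith [sq_nonneg (r - 58 / 250)]

/-- A linear lower bound, close to the tangent at `247 / 1250`, where `del r` is nearly
`103 / 200`. -/
lemma del_ge' {r : ℝ} (h0 : 0 < r) : 103 / 200 + 32 / 5 * (247 / 1250 - r) ≤ del r := by
  unfold del
  rw [le_div_iff₀ (by linarith)]
  nlinarith [sq_nonneg (r - 247 / 1250)]

lemma var_nonneg {r : ℝ} (h0 : 0 < r) (h1 : r < 1 / 3) : 0 ≤ var r :=
  div_nonneg (by linarith) (by linarith)

lemma var_le {r : ℝ} (h0 : 0 < r) (hr : r ≤ 29 / 125) : var r ≤ 1 / 6 - 27 / 100 * r := by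
  unfold var
  rw [div_le_iff₀ (by linarith)]
  nlinarith

lemma phi_one_le {r : ℝ} (h0 : 0 < r) (h1 : r < 1 / 3) :
    (1 - r) / (3 - r) ≤ 1 / 3 - 2 / 9 * r := by
  rw [div_le_iff₀ (by linarith)]
  nlinarith

lemma sq_add_le_sq_add {a x u : ℝ} (h : a ≤ x) (ha : 0 ≤ a) (hu : 0 ≤ u) :
    (a + u) ^ 2 ≤ (x + u) ^ 2 :=
  pow_le_pow_left₀ (by linarith) (by linarith) 2

/-! ### One near point -/

/-- A line above `Φ` bounds the gain from a point `-x` to the left of `b`. -/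
lemma gain_le_of_line {r b x m w : ℝ} (hbx : 0 ≤ b + x) (h : phi r (b - x) ≤ m * (b - x - w)) :
    (b + x) * phi r (b - x) ≤ m * (b - w / 2) ^ 2 - m * (x + w / 2) ^ 2 := by
  have := mul_le_mul_of_nonneg_left h hbx
  linarith

/-- A point `-x` with `x ≥ 103 / 200` gains no more than what the deviation of `b` from the centre
costs. -/
lemma gain_le_of_far {r : ℝ} (h0 : 0 < r) (hr : r ≤ 29 / 125) {b x : ℝ} (hx : del r ≤ x)
    (hx2 : 103 / 200 ≤ x) (hb : b ≤ 1 + del r) (hbx : 0 ≤ b + x) :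
    (b + x) * phi r (b - x) ≤ (b - 1 / 2) ^ 2 := by
  have h1 : r < 1 / 3 := by linarith
  rcases le_or_gt (b - x) 0 with h | h
  · rw [phi_of_nonpos h0 h1 h, mul_zero]
    positivity
  have hd := del_ge' h0
  rcases le_total r (247 / 1250) with h2 | h2
  · -- For the line `m (s - w)`, the square to complete is at `b = (1 / 2 - m w / 2) / (1 - m)`.
    have B := bernstein_nonneg h0.le h2
    have hs := fun u hu => sq_add_le_sq_add (hd.trans hx) (by linarith) (u := u) hu
    rcases phi_le_left h0 h1 h.le (by linarith) with h | h | h | h | h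
    · have := gain_le_of_line hbx h
      linarith [sq_nonneg (b - 9 / 17), hs 0 le_rfl, B 0 2, B 1 1, B 2 0]
    · have := gain_le_of_line hbx h
      linarith [sq_nonneg (b - 9 / 8 * (1 / 2 - r ^ 2 / 18)), hs (r ^ 2 / 2) (by positivity),
        B 0 4, B 1 3, B 2 2, B 3 1, B 4 0]
    · have := gain_le_of_line hbx h
      linarith [sq_nonneg (b - 9 / 7 * (1 / 2 - r / 18)), hs (r / 4) (by positivity),
        B 0 4, B 1 3, B 2 2, B 3 1, B 4 0]
    · have := gain_le_of_line hbx h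
      linarith [sq_nonneg (b - 3 / 2 * (1 / 2 - r / 6)), hs (r / 2) (by positivity),
        B 0 4, B 1 3, B 2 2, B 3 1, B 4 0]
    · have := gain_le_of_line hbx h
      linarith [sq_nonneg (b - 2 * (1 / 2 - (1 + r) / 12)), hs ((1 + r) / 6) (by positivity),
        B 0 4, B 1 3, B 2 2, B 3 1, B 4 0]
  · have B := bernstein_nonneg h2 hr
    have hs := fun u hu => sq_add_le_sq_add hx2 (by linarith) (u := u) hu
    rcases phi_le_left h0 h1 h.le (by linarith) with h | h | h | h | h
    · have := gain_le_of_line hbx h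
      linarith [sq_nonneg (b - 9 / 17), hs 0 le_rfl]
    · have := gain_le_of_line hbx h
      linarith [sq_nonneg (b - 9 / 8 * (1 / 2 - r ^ 2 / 18)), hs (r ^ 2 / 2) (by positivity),
        B 0 4, B 1 3, B 2 2, B 3 1, B 4 0]
    · have := gain_le_of_line hbx h
      linarith [sq_nonneg (b - 9 / 7 * (1 / 2 - r / 18)), hs (r / 4) (by positivity),
        B 0 4, B 1 3, B 2 2, B 3 1, B 4 0]
    · have := gain_le_of_line hbx h
      linarith [sq_nonneg (b - 3 / 2 * (1 / 2 - r / 6)), hs (r / 2) (by positivity),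
        B 0 4, B 1 3, B 2 2, B 3 1, B 4 0]
    · have := gain_le_of_line hbx h
      linarith [sq_nonneg (b - 2 * (1 / 2 - (1 + r) / 12)), hs ((1 + r) / 6) (by positivity),
        B 0 4, B 1 3, B 2 2, B 3 1, B 4 0]

/-- A point beyond the midpoint of the gap gains at most `3 / 125` more than the deviation of `b`
from the centre costs. -/
lemma gain_le {r : ℝ} (h0 : 0 < r) (h2 : 247 / 1250 ≤ r) (hr : r ≤ 29 / 125) {b x : ℝ}
    (hx : del r ≤ x) (hb : b ≤ 1 + del r) (hbx : 0 ≤ b + x) :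
    (b + x) * phi r (b - x) ≤ (b - 1 / 2) ^ 2 + 3 / 125 := by
  have h1 : r < 1 / 3 := by linarith
  rcases le_or_gt (b - x) 0 with h | h
  · rw [phi_of_nonpos h0 h1 h, mul_zero]
    positivity
  have hd := del_ge h0
  have B := bernstein_nonneg h2 hr
  have hs := fun u hu => sq_add_le_sq_add (hd.trans hx) (by linarith) (u := u) hu
  rcases phi_le_left h0 h1 h.le (by linarith) with h | h | h | h | h
  · have := gain_le_of_line hbx h
    linarith [sq_nonneg (b - 9 / 17), hs 0 le_rfl, B 0 2, B 1 1, B 2 0]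
  · have := gain_le_of_line hbx h
    linarith [sq_nonneg (b - 9 / 8 * (1 / 2 - r ^ 2 / 18)), hs (r ^ 2 / 2) (by positivity),
      B 0 4, B 1 3, B 2 2, B 3 1, B 4 0]
  · have := gain_le_of_line hbx h
    linarith [sq_nonneg (b - 9 / 7 * (1 / 2 - r / 18)), hs (r / 4) (by positivity),
      B 0 4, B 1 3, B 2 2, B 3 1, B 4 0]
  · have := gain_le_of_line hbx h
    linarith [sq_nonneg (b - 3 / 2 * (1 / 2 - r / 6)), hs (r / 2) (by positivity),
      B 0 4, B 1 3, B 2 2, B 3 1, B 4 0]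
  · have := gain_le_of_line hbx h
    linarith [sq_nonneg (b - 2 * (1 / 2 - (1 + r) / 12)), hs ((1 + r) / 6) (by positivity),
      B 0 4, B 1 3, B 2 2, B 3 1, B 4 0]

lemma phi_le_ninth {r s : ℝ} (h0 : 0 < r) (h1 : r < 1 / 3) (hs : 0 ≤ s) (hs' : s ≤ r * (1 - r)) :
    phi r s ≤ s / 9 := by
  have hu : s / r ≤ 1 - r := (div_le_iff₀ h0).2 (by linarith)
  rw [phi_of_le h0 h1 (by nlinarith)]
  have : phi r (s / r) ≤ s / r / 3 := by
    have hu0 : 0 ≤ s / r := by positivity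
    rcases phi_le_three h0 h1 hu0 (by linarith) with h | h | h
    · linarith [h.2]
    · linarith [h.2.2]
    · linarith [h.1, phi_le_centre h0 h1 h.1 (by linarith)]
  calc r / 3 * phi r (s / r) ≤ r / 3 * (s / r / 3) := by gcongr
    _ = s / 9 := by field_simp; ring

lemma gain_le_of_le_half {r : ℝ} (h0 : 0 < r) (h2 : 247 / 1250 ≤ r) (hr : r ≤ 29 / 125) {b x : ℝ}
    (hx : del r ≤ x) (hb : b ≤ 1 / 2) (hbx : 0 ≤ b + x) :
    (b + x) * phi r (b - x) ≤ 3 / 125 := by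
  have h1 : r < 1 / 3 := by linarith
  rcases le_or_gt (b - x) 0 with h | h
  · rw [phi_of_nonpos h0 h1 h, mul_zero]
    norm_num
  have hd := del_ge h0
  have := mul_le_mul_of_nonneg_left (phi_le_ninth h0 h1 h.le (by nlinarith)) hbx
  nlinarith

/-- A single near point `b` beyond the end of the interval by at least `2 del r - 103 / 200` loses
at least `3 / 125`, even with the help of a point `-del r` at the other end. -/
lemma gain_le_of_out {r : ℝ} (h0 : 0 < r) (h2 : 247 / 1250 ≤ r) (hr : r ≤ 29 / 125) {b : ℝ}
    (hb : b ≤ 1 + del r) (hb2 : 1 + (2 * del r - 103 / 200) ≤ b) :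
    (b + del r) * phi r (b - del r) + 3 / 125 ≤ (b - 1 / 2) ^ 2 := by
  have h1 : r < 1 / 3 := by linarith
  have hd := del_ge h0
  have h3 := phi_le_mul h0 h1 (s := b - del r) (u := 1) (by linarith) (by linarith) one_pos
  rw [phi_one h0 h1, div_one] at h3
  have h4 := phi_one_le h0 h1
  have h5 : phi r (b - del r) ≤ (b - del r) * (29 / 100) :=
    h3.trans (mul_le_mul_of_nonneg_left (by linarith) (by linarith))
  have h6 := mul_le_mul_of_nonneg_left h5 (by linarith : 0 ≤ b + del r)
  have h7 : (131 / 400) ^ 2 ≤ del r ^ 2 := pow_le_pow_left₀ (by norm_num) (by linarith) 2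
  nlinarith

/-! ### Points avoiding an end of the interval -/

/-- A lower bound for the contribution of the first subinterval when no point lies within distance
`del r` of the left end `0`. -/
def endCost (r : ℝ) : ℝ := (r ^ 2 * var r + (del r - r / 2) ^ 2) / 3

lemma endCost_le_pull {r : ℝ} (h0 : 0 < r) (hr : r ≤ 29 / 125) {A : Finset ℝ} (hA : A.Nonempty)
    (h : ∀ a ∈ A, a ≤ -del r ∨ del r ≤ a) : endCost r ≤ r ^ 2 / 3 * D r (pull r 0 A) := by
  have hd := del_ge h0
  have e : endCost r = r ^ 2 / 3 * (var r + (del r / r - 1 / 2) ^ 2) := by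
    unfold endCost
    field_simp
  rw [e]
  refine mul_le_mul_of_nonneg_left ?_ (by positivity)
  refine le_D_of_far h0 (by linarith) (hA.image _) ?_ fun b hb => ?_
  · rw [le_div_iff₀ h0]
    linarith
  · obtain ⟨a, ha, rfl⟩ := Finset.mem_image.1 hb
    simp only [Fin.val_zero, Nat.cast_zero, zero_div, zero_mul, sub_zero]
    rw [← neg_div]
    exact (h a ha).imp (fun h => div_le_div_of_nonneg_right h h0.le)
      fun h => div_le_div_of_nonneg_right h h0.le

lemma endCost_le {r : ℝ} (h0 : 0 < r) (hr : r ≤ 29 / 125) {A : Finset ℝ} (hA : A.Nonempty)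
    (h : ∀ a ∈ A, a ≤ -del r ∨ del r ≤ a) : endCost r ≤ D r A := by
  refine (endCost_le_pull h0 hr hA h).trans ?_
  rw [D_selfSimilar h0 (by linarith) hA]
  refine mul_le_mul_of_nonneg_left ?_ (by positivity)
  linarith [D_nonneg r (pull r 1 A), D_nonneg r (pull r 2 A)]

lemma pull_two_reflect {r : ℝ} (h0 : 0 < r) (A : Finset ℝ) :
    reflect (pull r 2 A) = pull r 0 (reflect A) := by
  unfold reflect pull
  rw [Finset.image_image, Finset.image_image]
  congr 1
  funext a
  simp only [Function.comp_apply, Fin.val_zero, Fin.val_two]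
  field_simp
  push_cast
  ring

lemma two_endCost_le {r : ℝ} (h0 : 0 < r) (hr : r ≤ 29 / 125) {A : Finset ℝ} (hA : A.Nonempty)
    (h : ∀ a ∈ A, a ≤ -del r ∨ del r ≤ a) (h' : ∀ a ∈ A, a ≤ 1 - del r ∨ 1 + del r ≤ a) :
    2 * endCost r ≤ D r A := by
  have e1 := endCost_le_pull h0 hr hA h
  have e2 := endCost_le_pull h0 hr (reflect_nonempty hA) fun a ha => by
    rcases h' _ (mem_reflect.1 ha) with h | h
    · right; linarith
    · left; linarith
  rw [← pull_two_reflect h0, D_reflect h0 (by linarith) (A := pull r 2 A) (hA.image _)] at e2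
  rw [D_selfSimilar h0 (by linarith) hA]
  have := mul_nonneg (by positivity : 0 ≤ r ^ 2 / 3) (D_nonneg r (pull r 1 A))
  linarith

/-- Either the far points `F` do not help, or the near points `N` leave an end of the interval so
badly approximated that three near points alone would do better. -/
lemma le_D_union {r : ℝ} (h0 : 0 < r) (hr : r ≤ 29 / 125) {N F : Finset ℝ} (hN : N.Nonempty)
    (hNl : ∀ a ∈ N, -del r ≤ a ∧ a ≤ 1 + del r) (hF : ∀ a ∈ F, a ≤ -del r ∨ 1 + del r ≤ a) :
    D r N ≤ D r (N ∪ F) ∨ r ^ 2 * var r ≤ D r (N ∪ F) := by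
  have h1 : r < 1 / 3 := by linarith
  have hd := del_ge h0
  have hV := var_nonneg h0 h1
  have hV2 := var_le h0 hr
  have hE : r ^ 2 * var r ≤ endCost r := by
    unfold endCost
    have : r ^ 2 ≤ (29 / 125) ^ 2 := pow_le_pow_left₀ h0.le hr 2
    have : r ^ 2 * var r ≤ (29 / 125) ^ 2 * (1 / 6) := by
      apply mul_le_mul this (by linarith) hV (by norm_num)
    nlinarith
  have hU : (N ∪ F).Nonempty := hN.mono Finset.subset_union_left
  by_cases hl : ∃ a ∈ N, a ≤ del r
  · by_cases hrr : ∃ a ∈ N, 1 - del r ≤ a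
    · left
      refine D_le_D h0 h1 hU fun t ht b hb => ?_
      rcases Finset.mem_union.1 hb with hb | hb
      · exact ⟨b, hb, le_rfl⟩
      · rcases hF b hb with hb | hb
        · obtain ⟨a, ha, hal⟩ := hl
          exact ⟨a, ha, by nlinarith [hNl a ha, ht.1]⟩
        · obtain ⟨a, ha, hal⟩ := hrr
          exact ⟨a, ha, by nlinarith [hNl a ha, ht.2]⟩
    · right
      push Not at hrr
      refine hE.trans ?_
      rw [← D_reflect h0 h1 hU]
      refine endCost_le h0 hr (reflect_nonempty hU) fun a ha => ?_
      rcases Finset.mem_union.1 (mem_reflect.1 ha) with ha | ha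
      · right; linarith [hrr _ ha]
      · rcases hF _ ha with h | h
        · right; linarith
        · left; linarith
  · right
    push Not at hl
    refine hE.trans (endCost_le h0 hr hU fun a ha => ?_)
    rcases Finset.mem_union.1 ha with ha | ha
    · right; linarith [hl _ ha]
    · rcases hF _ ha with h | h
      · left; linarith
      · right; linarith

/-- An interval without near points costs at least as much as three intervals with one point
each. -/
lemma three_var_le {r : ℝ} (h0 : 0 < r) (hr : r ≤ 29 / 125) {F : Finset ℝ} (hF0 : F.Nonempty)
    (hF : ∀ a ∈ F, a ≤ -del r ∨ 1 + del r ≤ a) : 3 * var r ≤ D r F := by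
  have h1 : r < 1 / 3 := by linarith
  have hd := del_ge h0
  refine le_trans ?_ (le_D_of_outside h0 h1 hF0 (by linarith) hF)
  have h3 := phi_one_le h0 h1
  have h4 := var_le h0 hr
  have h5 := mul_le_mul_of_nonneg_left h3 (by linarith : 0 ≤ 1 + 2 * del r)
  nlinarith

/-! ### Intervals with one near point -/

lemma le_D_one_of_half_le {r : ℝ} (h0 : 0 < r) (hr : r ≤ 29 / 125) {b : ℝ} {F : Finset ℝ}
    (hb : 1 / 2 ≤ b) (hb1 : b ≤ 1 + del r) (hF : ∀ a ∈ F, a ≤ -del r ∨ 1 + del r ≤ a)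
    {oR iL iR : ℝ} (hoR : oR = 0 ∨ oR = 1 ∧ 1 + (2 * del r - 103 / 200) < b)
    (hiL : iL = 1 ∧ 247 / 1250 ≤ r ∨ iL = 0 ∧ ∀ a ∈ F, a ≤ -(103 / 200) ∨ 1 + del r ≤ a)
    (hiR : iR = 1 ∧ 247 / 1250 ≤ r ∨ iR = 0 ∧ ∀ a ∈ F, a ≤ -del r ∨ 1 + 103 / 200 ≤ a) :
    var r + 3 / 125 * (oR - iL - iR) ≤ D r ({b} ∪ F) := by
  have h1 : r < 1 / 3 := by linarith
  have hd := del_ge h0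
  have hd' := del_ge' h0
  have key : ∀ x y : ℝ, del r ≤ x → del r ≤ y → (∀ a ∈ F, a ≤ -x ∨ 1 + y ≤ a) →
      var r + (b - 1 / 2) ^ 2 - (b + x) * phi r (b - x) - (1 + y - b) * phi r (1 - b - y)
        ≤ D r ({b} ∪ F) := by
    intro x y hx hy h
    refine le_D_three h0 h1 (by linarith) (by linarith) (by simp) fun t ht a ha => ?_
    rcases Finset.mem_union.1 ha with ha | ha
    · left
      rw [Finset.mem_singleton.1 ha]
    · right
      rcases h a ha with h | h
      · left
        nlinarith [ht.1]
      · right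
        nlinarith [ht.2]
  have hi : 0 ≤ iL ∧ 0 ≤ iR := by
    constructor
    · rcases hiL with h | h <;> rw [h.1]
      norm_num
    · rcases hiR with h | h <;> rw [h.1]
      norm_num
  rcases hoR with rfl | ⟨rfl, h⟩
  · obtain ⟨x, hx, hxF, hxg⟩ : ∃ x, del r ≤ x ∧ (∀ a ∈ F, a ≤ -x ∨ 1 + del r ≤ a) ∧
        (b + x) * phi r (b - x) ≤ (b - 1 / 2) ^ 2 + 3 / 125 * iL := by
      rcases hiL with ⟨rfl, h2⟩ | ⟨rfl, h2⟩
      · refine ⟨del r, le_rfl, hF, ?_⟩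
        linarith [gain_le h0 h2 hr le_rfl hb1 (by linarith)]
      · refine ⟨max (del r) (103 / 200), le_max_left _ _, fun a ha => ?_, ?_⟩
        · rcases hF a ha with h | h
          · rcases h2 a ha with h3 | h3
            · left
              have : max (del r) (103 / 200) ≤ -a := max_le (by linarith) (by linarith)
              linarith
            · exact Or.inr h3
          · exact Or.inr h
        · have := gain_le_of_far h0 hr (le_max_left (del r) (103 / 200)) (le_max_right _ _) hb1
            (by linarith [le_max_left (del r) (103 / 200)])
          linarith
    obtain ⟨y, hy, hyF, hyg⟩ : ∃ y, del r ≤ y ∧ (∀ a ∈ F, a ≤ -del r ∨ 1 + y ≤ a) ∧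
        (1 + y - b) * phi r (1 - b - y) ≤ 3 / 125 * iR := by
      rcases hiR with ⟨rfl, h2⟩ | ⟨rfl, h2⟩
      · refine ⟨del r, le_rfl, hF, ?_⟩
        have := gain_le_of_le_half h0 h2 hr (b := 1 - b) le_rfl (by linarith) (by linarith)
        rw [show 1 + del r - b = 1 - b + del r by ring]
        linarith
      · refine ⟨max (del r) (103 / 200), le_max_left _ _, fun a ha => ?_, ?_⟩
        · rcases hF a ha with h | h
          · exact Or.inl h
          · rcases h2 a ha with h3 | h3
            · exact Or.inl h3
            · right
              have : max (del r) (103 / 200) ≤ a - 1 := max_le (by linarith) (by linarith)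
              linarith
        · rw [phi_of_nonpos h0 h1 (by linarith [le_max_right (del r) (103 / 200)])]
          simp
    have := key x y hx hy fun a ha => by
      rcases hF a ha with h | h
      · rcases hxF a ha with h2 | h2
        · exact Or.inl h2
        · linarith
      · rcases hyF a ha with h2 | h2
        · linarith
        · exact Or.inr h2
    linarith
  · have h2 : 247 / 1250 ≤ r := by linarith
    have := key (del r) (del r) le_rfl le_rfl hF
    rw [phi_of_nonpos h0 h1 (s := 1 - b - del r) (by linarith)] at this
    have := gain_le_of_out h0 h2 hr hb1 h.le
    linarith

lemma reflect_singleton_union (b : ℝ) (F : Finset ℝ) :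
    reflect ({b} ∪ F) = {1 - b} ∪ reflect F := by
  rw [reflect_union]
  rfl

/-- An interval with one near point `b`. Each near point of a neighbour that protrudes far enough
into the gap (`iL`, `iR`) can lower the distortion by `3 / 125`; protruding itself (`oL`, `oR`)
costs at least as much. -/
lemma le_D_one {r : ℝ} (h0 : 0 < r) (hr : r ≤ 29 / 125) {b : ℝ} {F : Finset ℝ}
    (hb0 : -del r ≤ b) (hb1 : b ≤ 1 + del r) (hF : ∀ a ∈ F, a ≤ -del r ∨ 1 + del r ≤ a)
    {oL oR iL iR : ℝ} (hoL : oL = 0 ∨ oL = 1 ∧ b < -(2 * del r - 103 / 200))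
    (hoR : oR = 0 ∨ oR = 1 ∧ 1 + (2 * del r - 103 / 200) < b)
    (hiL : iL = 1 ∧ 247 / 1250 ≤ r ∨ iL = 0 ∧ ∀ a ∈ F, a ≤ -(103 / 200) ∨ 1 + del r ≤ a)
    (hiR : iR = 1 ∧ 247 / 1250 ≤ r ∨ iR = 0 ∧ ∀ a ∈ F, a ≤ -del r ∨ 1 + 103 / 200 ≤ a) :
    var r + 3 / 125 * (oL + oR - iL - iR) ≤ D r ({b} ∪ F) := by
  have hd := del_ge h0
  rcases le_total (1 / 2) b with h | h
  · have : oL = 0 := by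
      rcases hoL with h2 | h2
      · exact h2
      · linarith [h2.2]
    have := le_D_one_of_half_le h0 hr h hb1 hF hoR hiL hiR
    linarith
  · have : oR = 0 := by
      rcases hoR with h2 | h2
      · exact h2
      · linarith [h2.2]
    rw [← D_reflect h0 (by linarith) (by simp), reflect_singleton_union]
    have hsw : ∀ {u v w : ℝ}, (∀ a ∈ F, a ≤ u ∨ v ≤ a) → u = 1 - w → ∀ a ∈ reflect F,
        a ≤ 1 - v ∨ w ≤ a := by
      intro u v w hh e a ha
      rcases hh _ (mem_reflect.1 ha) with h2 | h2
      · right; linarith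
      · left; linarith
    have := le_D_one_of_half_le h0 hr (b := 1 - b) (F := reflect F) (oR := oL) (iL := iR)
      (iR := iL) (by linarith) (by linarith)
      (by simpa using hsw hF (w := 1 + del r) (by ring))
      (hoL.imp id fun h2 => ⟨h2.1, by linarith [h2.2]⟩)
      (hiR.imp id fun h2 => ⟨h2.1, by
        simpa using hsw h2.2 (w := 1 + del r) (by ring)⟩)
      (hiL.imp id fun h2 => ⟨h2.1, by
        simpa using hsw h2.2 (w := 1 + 103 / 200) (by ring)⟩)
    linarith

/-! ### Intervals with two near points -/

lemma phi_slope {r s s' : ℝ} (h0 : 0 < r) (h1 : r < 1 / 3) (hs : 2 * r ≤ s) (hs' : s ≤ s') :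
    phi r s + (s' - s) / 3 ≤ phi r s' := by
  rw [phi_selfSimilar h0 h1 s, phi_selfSimilar h0 h1 s',
    phi_of_two_le h0 h1 ((le_div_iff₀ h0).2 hs),
    phi_of_two_le h0 h1 ((le_div_iff₀ h0).2 (hs.trans hs'))]
  have m1 := phi_mono h0 h1 (show (s - (1 - r)) / r ≤ (s' - (1 - r)) / r by gcongr)
  have m2 := phi_mono h0 h1 (show (s - 2 * (1 - r)) / r ≤ (s' - 2 * (1 - r)) / r by gcongr)
  have e : r / 3 * (s' / r - s / r) = (s' - s) / 3 := by field_simp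
  rw [← e]
  have := mul_le_mul_of_nonneg_left (add_le_add m1 m2) (by positivity : 0 ≤ r / 3)
  linarith

lemma phi_ge_third {r : ℝ} (h0 : 0 < r) (h1 : r < 1 / 3) (s : ℝ) : (s - r) / 3 ≤ phi r s := by
  rw [phi_selfSimilar h0 h1 s]
  have m0 := phi_ge h0 h1 (s / r)
  have e : r / 3 * (s / r - 1) = (s - r) / 3 := by field_simp
  rw [← e]
  refine mul_le_mul_of_nonneg_left ?_ (by positivity)
  linarith [phi_nonneg r ((s - (1 - r)) / r), phi_nonneg r ((s - 2 * (1 - r)) / r)]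

/-- A pair of which one point protrudes to the right into the gap. -/
lemma le_pair_of_out {r : ℝ} (h0 : 0 < r) (h2 : 247 / 1250 ≤ r) (hr : r ≤ 29 / 125) {G : ℝ}
    (hg : (3 + r) ^ 2 * (1 - r) ^ 2 / 80 ≤ G) {p q : ℝ} (hpq : p ≤ q)
    (hs : 1 - r ≤ p + q) (hq : 1 + (2 * del r - 103 / 200) ≤ q) :
    var r - G + 3 / 125 ≤ D r {p, q} := by
  have h1 : r < 1 / 3 := by linarith
  have hd := del_ge h0
  have B := bernstein_nonneg h2 hr
  have hlam : 2 * (131 / 400 + 116 / 25 * (29 / 125 - r)) - 103 / 200 ≤ q - 1 := by linarith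
  have hsq := fun u hu => sq_add_le_sq_add hlam (by linarith) (u := u) hu
  rw [pair_eq' h0 h1 hpq]
  rcases le_or_gt (2 - p - q) 0 with h | h
  · rw [phi_of_nonpos h0 h1 h]
    linarith [sq_nonneg (p - 1 / 2), B 0 4, B 1 3, B 2 2, B 3 1, B 4 0]
  have hqp := sub_nonneg.2 hpq
  rcases phi_le_three h0 h1 h.le (by linarith) with ⟨-, h⟩ | ⟨-, -, h⟩ | ⟨-, h⟩
  · linarith [mul_le_mul_of_nonneg_left h hqp, sq_nonneg (p - 2 / 5), hsq 0 le_rfl,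
      B 0 4, B 1 3, B 2 2, B 3 1, B 4 0]
  · linarith [mul_le_mul_of_nonneg_left h hqp, sq_nonneg (p - (1 / 4 + r / 4)),
      hsq (r / 2) (by positivity), B 0 4, B 1 3, B 2 2, B 3 1, B 4 0]
  · linarith [mul_le_mul_of_nonneg_left h hqp, sq_nonneg (p - (1 + r) / 6),
      hsq ((1 + r) / 6) (by positivity), B 0 4, B 1 3, B 2 2, B 3 1, B 4 0]

/-- A pair of which both points protrude into the gaps. -/
lemma le_pair_of_out_out {r : ℝ} (h0 : 0 < r) (h2 : 247 / 1250 ≤ r) (hr : r ≤ 29 / 125) {G : ℝ}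
    (hg : (3 + r) ^ 2 * (1 - r) ^ 2 / 80 ≤ G) {p q : ℝ} (hp : p ≤ -(2 * del r - 103 / 200))
    (hq : 1 + (2 * del r - 103 / 200) ≤ q) :
    var r - G + 6 / 125 ≤ D r {p, q} := by
  have h1 : r < 1 / 3 := by linarith
  have hd := del_ge h0
  have B := bernstein_nonneg h2 hr
  have h3 := phi_one_le h0 h1
  have := le_D_of_outside h0 h1 (A := {p, q}) (by simp) (x := 2 * del r - 103 / 200)
    (by linarith) fun a ha => by
      rcases Finset.mem_insert.1 ha with rfl | ha
      · exact Or.inl hp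
      · rw [Finset.mem_singleton.1 ha]
        exact Or.inr hq
  have h4 : (1 + 2 * (2 * del r - 103 / 200)) * ((1 - r) / (3 - r))
      ≤ (1 + 2 * (2 * del r - 103 / 200)) * (29 / 100) :=
    mul_le_mul_of_nonneg_left (by linarith) (by linarith)
  nlinarith [B 0 4, B 1 3, B 2 2, B 3 1, B 4 0]

/-- The gain from a point `-del r` to the left of `p` is at most that from moving `p` to the mean
`(1 + r) / 4` of the first two intervals, when `p` serves exactly these two. -/
lemma gain_le_shift {r : ℝ} (h0 : 0 < r) (h2 : 247 / 1250 ≤ r) (hr : r ≤ 29 / 125) {p : ℝ}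
    (hp : del r ≤ p) (hp1 : p ≤ 1 + del r) :
    (p + del r) * phi r (p - del r) ≤ 2 / 3 * (p - (1 + r) / 4) ^ 2 := by
  have h1 : r < 1 / 3 := by linarith
  have hd := del_ge h0
  have B := bernstein_nonneg h2 hr
  have hs := fun u hu => sq_add_le_sq_add hd (by linarith) (u := u) hu
  rcases phi_le_left h0 h1 (s := p - del r) (by linarith) (by linarith) with h | h | h | h | h
  · have := gain_le_of_line (by linarith) h
    linarith [sq_nonneg (p - 12 / 11 * ((1 + r) / 4)), hs 0 le_rfl, B 0 2, B 1 1, B 2 0]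
  · have := gain_le_of_line (by linarith) h
    linarith [sq_nonneg (p - 9 / 5 * ((1 + r) / 6 - r ^ 2 / 18)), hs (r ^ 2 / 2) (by positivity),
      B 0 4, B 1 3, B 2 2, B 3 1, B 4 0]
  · have := gain_le_of_line (by linarith) h
    linarith [sq_nonneg (p - 9 / 4 * ((1 + r) / 6 - r / 18)), hs (r / 4) (by positivity),
      B 0 4, B 1 3, B 2 2, B 3 1, B 4 0]
  · have := gain_le_of_line (by linarith) h
    linarith [sq_nonneg (p - 3 * ((1 + r) / 6 - r / 6)), hs (r / 2) (by positivity),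
      B 0 4, B 1 3, B 2 2, B 3 1, B 4 0]
  · have := gain_le_of_line (by linarith) h
    linarith [sq_nonneg (p - 6 * ((1 + r) / 6 - (1 + r) / 12)), hs ((1 + r) / 6) (by positivity),
      B 0 4, B 1 3, B 2 2, B 3 1, B 4 0]

/-- Two points `p < q` together with a useful point `-del r` on the left, when the boundary between
the regions of `p` and `q` lies within the third interval. -/
lemma three_points_of_right {r : ℝ} (h0 : 0 < r) (h2 : 247 / 1250 ≤ r) (hr : r ≤ 29 / 125) {G : ℝ}
    (hg : (3 + r) ^ 2 * (1 - r) ^ 2 / 80 ≤ G) {p q : ℝ} (hpq : p ≤ q) (hp : del r ≤ p)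
    (hp1 : p ≤ 1 + del r) (hs0 : 0 ≤ 2 - p - q) (hs : 2 - p - q ≤ 2 * r) :
    var r - G + 21 / 1000 + (q - 1) ^ 2 / 6 ≤ var r + (p - 1 / 2) ^ 2
      - (p + del r) * phi r (p - del r) - (q - p) * phi r (2 - p - q) := by
  have h1 : r < 1 / 3 := by linarith
  have hd := del_ge h0
  have B := bernstein_nonneg h2 hr
  have hsq := fun u hu => sq_add_le_sq_add hd (by linarith) (u := u) hu
  have h6 := mul_le_mul_of_nonneg_left (phi_le_sixth h0 h1 hs0 hs) (sub_nonneg.2 hpq)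
  rcases phi_le_left h0 h1 (s := p - del r) (by linarith) (by linarith) with h | h | h | h | h
  · have := gain_le_of_line (by linarith) h
    linarith [sq_nonneg (p - 3 / 7), hsq 0 le_rfl, B 0 4, B 1 3, B 2 2, B 3 1, B 4 0]
  · have := gain_le_of_line (by linarith) h
    linarith [sq_nonneg (p - 18 / 13 * (1 / 3 - r ^ 2 / 18)), hsq (r ^ 2 / 2) (by positivity),
      B 0 4, B 1 3, B 2 2, B 3 1, B 4 0]
  · have := gain_le_of_line (by linarith) h
    linarith [sq_nonneg (p - 18 / 11 * (1 / 3 - r / 18)), hsq (r / 4) (by positivity),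
      B 0 4, B 1 3, B 2 2, B 3 1, B 4 0]
  · have := gain_le_of_line (by linarith) h
    linarith [sq_nonneg (p - 2 * (1 / 3 - r / 6)), hsq (r / 2) (by positivity),
      B 0 4, B 1 3, B 2 2, B 3 1, B 4 0]
  · have := gain_le_of_line (by linarith) h
    linarith [sq_nonneg (p - 3 * (1 / 3 - (1 + r) / 12)), hsq ((1 + r) / 6) (by positivity),
      B 0 4, B 1 3, B 2 2, B 3 1, B 4 0]

/-- Two near points `p < q` and a useful point `-del r` on the left. -/
lemma three_points {r : ℝ} (h0 : 0 < r) (h2 : 247 / 1250 ≤ r) (hr : r ≤ 29 / 125) {G : ℝ}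
    (hg : (3 + r) ^ 2 * (1 - r) ^ 2 / 80 ≤ G) (h2m : ∀ p q, var r - G ≤ D r {p, q})
    {p q : ℝ} (hpq : p ≤ q) (hp : del r ≤ p) (hp1 : p ≤ 1 + del r) {o : ℝ}
    (ho : o = 0 ∨ o = 1 ∧ 1 + (2 * del r - 103 / 200) < q) :
    var r - G + 3 / 125 * o ≤ var r + (p - 1 / 2) ^ 2
      - (p + del r) * phi r (p - del r) - (q - p) * phi r (2 - p - q) := by
  have h1 : r < 1 / 3 := by linarith
  have hd := del_ge h0
  have B := bernstein_nonneg h2 hr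
  rcases le_or_gt (2 * r) (2 - p - q) with h | h
  · have hsh := gain_le_shift h0 h2 hr hp hp1
    set p' := (1 + r) / 4 with hp'
    have hpp : p' ≤ p := by linarith
    have e := pair_eq' h0 h1 (p := p') (q := q) (by linarith)
    have hsl := phi_slope h0 h1 h (s' := 2 - p' - q) (by linarith)
    have hth := phi_ge_third h0 h1 (2 - p - q)
    have m1 := mul_le_mul_of_nonneg_left hsl (by linarith : 0 ≤ q - p')
    have m2 := mul_le_mul_of_nonneg_left hth (sub_nonneg.2 hpp)
    have hD : var r - G + 3 / 125 * o ≤ D r {p', q} := by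
      rcases ho with rfl | ⟨rfl, ho⟩
      · linarith [h2m p' q]
      · linarith [le_pair_of_out h0 h2 hr hg (p := p') (q := q) (by linarith) (by linarith) ho.le]
    refine hD.trans ?_
    rw [e]
    have e2 : 2 / 3 * (p - p') ^ 2
        = (p - 1 / 2) ^ 2 - (p' - 1 / 2) ^ 2 + (p - p') * (2 - p - r - p') / 3 := by
      rw [hp']
      ring
    linarith
  · rcases le_or_gt 0 (2 - p - q) with h3 | h3
    · have := three_points_of_right h0 h2 hr hg hpq hp hp1 h3 h.le
      refine le_trans ?_ this
      rcases ho with rfl | ⟨rfl, ho⟩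
      · nlinarith [sq_nonneg (q - 1)]
      · nlinarith
    · rw [phi_of_nonpos h0 h1 h3.le]
      have := gain_le h0 h2 hr le_rfl hp1 (by linarith)
      have : o ≤ 1 := by
        rcases ho with rfl | ⟨rfl, -⟩ <;> norm_num
      linarith [B 0 4, B 1 3, B 2 2, B 3 1, B 4 0]

/-- For these `r`, leaving one end uncovered costs at least as much as the best pair. -/
lemma le_endCost {r : ℝ} (h0 : 0 < r) (hr : r ≤ 247 / 1250) {G : ℝ} (hb : (1 - r) ^ 2 / 8 ≤ G) :
    var r - G ≤ endCost r := by
  have hd := del_ge' h0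
  have := mul_nonneg (sq_nonneg r) (var_nonneg h0 (by linarith))
  have hV := var_le h0 (by linarith)
  unfold endCost
  have : (103 / 200 - 247 / 2500) ^ 2 ≤ (del r - r / 2) ^ 2 :=
    pow_le_pow_left₀ (by norm_num) (by linarith) 2
  nlinarith

lemma le_two_endCost {r : ℝ} (h0 : 0 < r) (hr : r ≤ 29 / 125) {G : ℝ}
    (hb : (1 - r) ^ 2 / 8 ≤ G) (hg : (3 + r) ^ 2 * (1 - r) ^ 2 / 80 ≤ G) :
    var r - G ≤ 2 * endCost r := by
  rcases le_total r (247 / 1250) with h | h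
  · have := le_endCost h0 h hb
    have : 0 ≤ endCost r := by
      have := mul_nonneg (sq_nonneg r) (var_nonneg h0 (by linarith))
      unfold endCost
      positivity
    linarith
  · have hd := del_ge h0
    have B := bernstein_nonneg h hr
    have := mul_nonneg (sq_nonneg r) (var_nonneg h0 (by linarith))
    have hV := var_le h0 (by linarith)
    unfold endCost
    have : (131 / 400 + 116 / 25 * (29 / 125 - r) - r / 2) ^ 2 ≤ (del r - r / 2) ^ 2 :=
      pow_le_pow_left₀ (by linarith) (by linarith) 2
    linarith [B 0 4, B 1 3, B 2 2, B 3 1, B 4 0]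

/-- Two near points of which the right one makes all far points on the right useless. -/
lemma le_D_two_of_right {r : ℝ} (h0 : 0 < r) (hr : r ≤ 29 / 125) {G : ℝ}
    (hb : (1 - r) ^ 2 / 8 ≤ G) (hg : (3 + r) ^ 2 * (1 - r) ^ 2 / 80 ≤ G)
    (h2m : ∀ p q, var r - G ≤ D r {p, q}) {p q : ℝ} {F : Finset ℝ} (hpq : p ≤ q)
    (hp0 : -del r ≤ p) (hq1 : q ≤ 1 + del r) (hF : ∀ a ∈ F, a ≤ -del r ∨ 1 + del r ≤ a)
    (hq : 1 - del r ≤ q) {oL oR : ℝ} (hoL : oL = 0 ∨ oL = 1 ∧ p < -(2 * del r - 103 / 200))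
    (hoR : oR = 0 ∨ oR = 1 ∧ 1 + (2 * del r - 103 / 200) < q) :
    var r - G + 3 / 125 * (oL + oR) ≤ D r ({p, q} ∪ F) := by
  have h1 : r < 1 / 3 := by linarith
  have hd := del_ge h0
  have hd' := del_ge' h0
  have hU : ({p, q} ∪ F).Nonempty := ⟨p, by simp⟩
  rcases le_or_gt p (del r) with hp | hp
  · have hDD : D r {p, q} ≤ D r ({p, q} ∪ F) := by
      refine D_le_D h0 h1 hU fun t ht b hb => ?_
      rcases Finset.mem_union.1 hb with hb | hb
      · exact ⟨b, hb, le_rfl⟩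
      · rcases hF b hb with hb | hb
        · exact ⟨p, by simp, by nlinarith [ht.1]⟩
        · exact ⟨q, by simp, by nlinarith [ht.2]⟩
    rcases hoL with rfl | ⟨rfl, hL⟩
    · rcases hoR with rfl | ⟨rfl, hR⟩
      · linarith [h2m p q]
      · have h2 : 247 / 1250 ≤ r := by linarith
        rcases le_or_gt (1 - r) (p + q) with h | h
        · linarith [le_pair_of_out h0 h2 hr hg hpq h hR.le]
        · linarith [le_pair_of_out_out h0 h2 hr hg (p := p) (q := q) (by linarith) hR.le]
    · have h2 : 247 / 1250 ≤ r := by linarith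
      rcases hoR with rfl | ⟨rfl, hR⟩
      · rcases le_or_gt (p + q) (1 + r) with h | h
        · have := le_pair_of_out h0 h2 hr hg (p := 1 - q) (q := 1 - p) (by linarith) (by linarith)
            (by linarith)
          rw [← reflect_pair, D_reflect h0 h1 (by simp)] at this
          linarith
        · linarith [le_pair_of_out_out h0 h2 hr hg (p := p) (q := q) hL.le (by linarith)]
      · linarith [le_pair_of_out_out h0 h2 hr hg hL.le hR.le]
  · have : oL = 0 := by
      rcases hoL with h | h
      · exact h
      · linarith [h.2]
    rcases le_total r (247 / 1250) with h2 | h2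
    · have : oR = 0 := by
        rcases hoR with h | h
        · exact h
        · linarith [h.2]
      have h3 := endCost_le h0 hr hU fun a ha => by
        rcases Finset.mem_union.1 ha with ha | ha
        · right
          rcases Finset.mem_insert.1 ha with rfl | ha
          · exact hp.le
          · rw [Finset.mem_singleton.1 ha]
            linarith
        · rcases hF a ha with h | h
          · exact Or.inl h
          · right; linarith
      have := le_endCost h0 h2 hb
      subst oL oR
      linarith
    · have h3 := three_points h0 h2 hr hg h2m hpq hp.le (by linarith) hoR
      have h4 := le_D_three h0 h1 (b := p) (x := del r) (y := q - 1) (by linarith) (by linarith) hU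
        fun t ht a ha => by
          rcases Finset.mem_union.1 ha with ha | ha
          · rcases Finset.mem_insert.1 ha with rfl | ha
            · left; exact le_rfl
            · right; right
              rw [Finset.mem_singleton.1 ha]
              ring_nf
              exact le_rfl
          · right
            rcases hF a ha with h | h
            · left; nlinarith [ht.1]
            · right; nlinarith [ht.2]
      rw [show 1 + (q - 1) - p = q - p by ring, show 1 - p - (q - 1) = 2 - p - q by ring] at h4
      subst oL
      linarith

/-- An interval with two near points: far points never help, and each near point protruding far
into a gap costs at least `3 / 125`. -/
lemma le_D_two {r : ℝ} (h0 : 0 < r) (hr : r ≤ 29 / 125) {G : ℝ}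
    (hb : (1 - r) ^ 2 / 8 ≤ G) (hg : (3 + r) ^ 2 * (1 - r) ^ 2 / 80 ≤ G)
    (h2m : ∀ p q, var r - G ≤ D r {p, q}) {p q : ℝ} {F : Finset ℝ} (hpq : p ≤ q)
    (hp0 : -del r ≤ p) (hq1 : q ≤ 1 + del r) (hF : ∀ a ∈ F, a ≤ -del r ∨ 1 + del r ≤ a)
    {oL oR : ℝ} (hoL : oL = 0 ∨ oL = 1 ∧ p < -(2 * del r - 103 / 200))
    (hoR : oR = 0 ∨ oR = 1 ∧ 1 + (2 * del r - 103 / 200) < q) :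
    var r - G + 3 / 125 * (oL + oR) ≤ D r ({p, q} ∪ F) := by
  have h1 : r < 1 / 3 := by linarith
  have hd := del_ge h0
  have hd' := del_ge' h0
  have hU : ({p, q} ∪ F).Nonempty := ⟨p, by simp⟩
  rcases le_or_gt (1 - del r) q with hq | hq
  · exact le_D_two_of_right h0 hr hb hg h2m hpq hp0 hq1 hF hq hoL hoR
  rcases le_or_gt p (del r) with hp | hp
  · have := le_D_two_of_right h0 hr hb hg h2m (p := 1 - q) (q := 1 - p) (F := reflect F)
      (by linarith) (by linarith) (by linarith)
      (fun a ha => (hF _ (mem_reflect.1 ha)).symm.imp (fun h => by linarith) fun h => by linarith)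
      (by linarith) (hoR.imp id fun h => ⟨h.1, by linarith [h.2]⟩)
      (hoL.imp id fun h => ⟨h.1, by linarith [h.2]⟩)
    rw [← reflect_pair, ← reflect_union, D_reflect h0 h1 hU] at this
    linarith
  · have h3 := two_endCost_le h0 hr hU
      (fun a ha => by
        rcases Finset.mem_union.1 ha with ha | ha
        · right
          rcases Finset.mem_insert.1 ha with rfl | ha
          · exact hp.le
          · rw [Finset.mem_singleton.1 ha]
            linarith
        · rcases hF a ha with h | h
          · exact Or.inl h
          · right; linarith)
      (fun a ha => by
        rcases Finset.mem_union.1 ha with ha | ha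
        · left
          rcases Finset.mem_insert.1 ha with rfl | ha
          · linarith
          · rw [Finset.mem_singleton.1 ha]
            exact hq.le
        · rcases hF a ha with h | h
          · left; linarith
          · exact Or.inr h)
    have := le_two_endCost h0 hr hb hg
    have : oL = 0 := by
      rcases hoL with h | h
      · exact h
      · linarith [h.2]
    have : oR = 0 := by
      rcases hoR with h | h
      · exact h
      · linarith [h.2]
    subst oL oR
    linarith

/-! ### The piecewise linear sequence of errors -/

/-- The claimed `n`th quantization error, `var r - G` being the one for two points: it interpolates
linearly between `3 ^ l`, `2 * 3 ^ l` and `3 ^ (l + 1)`. -/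
def err (r G : ℝ) (n : ℕ) : ℝ :=
  if n ≤ 2 * 3 ^ ell n then
    (r ^ 2 / 3) ^ ell n * ((2 * 3 ^ ell n - n) * var r + (n - 3 ^ ell n) * (var r - G))
  else
    (r ^ 2 / 3) ^ ell n *
      ((3 * 3 ^ ell n - n) * (var r - G) + (n - 2 * 3 ^ ell n) * (r ^ 2 * var r))

lemma err_first {r G : ℝ} {n l : ℕ} (h : 3 ^ l ≤ n) (h' : n ≤ 2 * 3 ^ l) :
    err r G n = (r ^ 2 / 3) ^ l * ((2 * 3 ^ l - n) * var r + (n - 3 ^ l) * (var r - G)) := by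
  have hl : ell n = l := by
    refine Nat.log_eq_of_pow_le_of_lt_pow h ?_
    rw [pow_succ]
    have : 0 < 3 ^ l := by positivity
    omega
  rw [err, hl, if_pos h']

lemma err_second {r G : ℝ} {n l : ℕ} (h : 2 * 3 ^ l ≤ n) (h' : n ≤ 3 * 3 ^ l) :
    err r G n = (r ^ 2 / 3) ^ l *
      ((3 * 3 ^ l - n) * (var r - G) + (n - 2 * 3 ^ l) * (r ^ 2 * var r)) := by
  rcases h.eq_or_lt with rfl | h2
  · rw [err_first (l := l) (by omega) le_rfl]
    push_cast
    ring
  rcases h'.eq_or_lt with rfl | h3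
  · rw [err_first (l := l + 1) (by rw [pow_succ]; omega) (by rw [pow_succ]; omega)]
    push_cast
    ring
  · have hl : ell n = l := by
      refine Nat.log_eq_of_pow_le_of_lt_pow (by omega) ?_
      rw [pow_succ]
      omega
    rw [err, hl, if_neg (by omega)]

lemma err_one (r G : ℝ) : err r G 1 = var r := by
  rw [err_first (l := 0) (by norm_num) (by norm_num)]
  norm_num

lemma err_two (r G : ℝ) : err r G 2 = var r - G := by
  rw [err_first (l := 0) (by norm_num) (by norm_num)]
  norm_num

lemma err_three (r G : ℝ) : err r G 3 = r ^ 2 * var r := by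
  rw [err_second (l := 0) (by norm_num) (by norm_num)]
  norm_num

/-- The decrements of `err`. -/
def dec (r G : ℝ) (n : ℕ) : ℝ := err r G n - err r G (n + 1)

/-- The recursion behind `err`: `n` points are distributed evenly over the three intervals. -/
lemma err_rec (r G : ℝ) {n : ℕ} (hn : 3 ≤ n) :
    err r G n = r ^ 2 / 3 * (3 * err r G (n / 3) - (n % 3 : ℕ) * dec r G (n / 3)) := by
  obtain ⟨t, s, hs, rfl⟩ : ∃ t s, s < 3 ∧ n = 3 * t + s :=
    ⟨n / 3, n % 3, Nat.mod_lt _ (by norm_num), (Nat.div_add_mod n 3).symm⟩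
  have ht : (3 * t + s) / 3 = t := by omega
  have hsm : (3 * t + s) % 3 = s := by omega
  rw [ht, hsm]
  have ht1 : t ≠ 0 := by omega
  set l := Nat.log 3 t with hl
  have h1 : 3 ^ l ≤ t := Nat.pow_log_le_self 3 ht1
  have h2 : t < 3 ^ (l + 1) := Nat.lt_pow_succ_log_self (by norm_num) t
  rw [pow_succ] at h2
  have hp : 3 ^ (l + 1) = 3 * 3 ^ l := by rw [pow_succ]; ring
  unfold dec
  rcases lt_or_ge t (2 * 3 ^ l) with h | h
  · rw [err_first (l := l + 1) (n := 3 * t + s) (by omega) (by omega),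
      err_first (l := l) h1 h.le, err_first (l := l) (n := t + 1) (by omega) (by omega)]
    push_cast
    ring
  · rw [err_second (l := l + 1) (n := 3 * t + s) (by omega) (by omega),
      err_second (l := l) h (by omega), err_second (l := l) (n := t + 1) (by omega) (by omega)]
    push_cast
    ring

lemma dec_rec (r G : ℝ) {n : ℕ} (hn : 3 ≤ n) : dec r G n = r ^ 2 / 3 * dec r G (n / 3) := by
  rw [dec, err_rec r G hn, err_rec r G (by omega : 3 ≤ n + 1)]
  rcases (by omega : n % 3 = 0 ∨ n % 3 = 1 ∨ n % 3 = 2) with h | h | h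
  · rw [show (n + 1) / 3 = n / 3 by omega, show (n + 1) % 3 = 1 by omega, h]
    push_cast
    ring
  · rw [show (n + 1) / 3 = n / 3 by omega, show (n + 1) % 3 = 2 by omega, h]
    push_cast
    ring
  · rw [show (n + 1) / 3 = n / 3 + 1 by omega, show (n + 1) % 3 = 0 by omega, h]
    unfold dec
    push_cast
    ring

/-- The inequalities on the reduction `G` of the variance by a second point under which the
quantization errors are given by `err`. -/
structure Admits (r G : ℝ) : Prop where
  pos : 0 < r
  le : r ≤ 29 / 125
  third : (1 - r) ^ 2 / 8 ≤ G
  four_ninths : (3 + r) ^ 2 * (1 - r) ^ 2 / 80 ≤ G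
  upper : G * (1 + r ^ 2 / 3) ≤ (1 - r) ^ 2 / 6
  two_means : ∀ p q, var r - G ≤ D r {p, q}

namespace Admits

variable {r G : ℝ}

lemma lt (h : Admits r G) : r < 1 / 3 := by linarith [h.le]

lemma var_mul (h : Admits r G) : (1 - r ^ 2) * var r = (1 - r) ^ 2 / 6 := by
  have := h.pos
  unfold var
  field_simp
  ring

lemma dec_one : dec r G 1 = G := by
  rw [dec, err_one, err_two]
  ring

lemma dec_two (h : Admits r G) : dec r G 2 = (1 - r) ^ 2 / 6 - G := by
  rw [dec, err_two, err_three, ← h.var_mul]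
  ring

lemma G_nonneg (h : Admits r G) : 0 ≤ G := le_trans (by positivity) h.third

lemma dec_two_nonneg (h : Admits r G) : r ^ 2 / 3 * dec r G 1 ≤ dec r G 2 := by
  rw [h.dec_two, dec_one]
  linarith [h.upper]

lemma dec_nonneg (h : Admits r G) (n : ℕ) (hn : 1 ≤ n) : 0 ≤ dec r G n := by
  induction n using Nat.strong_induction_on with
  | _ n ih =>
    rcases (by omega : n = 1 ∨ n = 2 ∨ 3 ≤ n) with rfl | rfl | h3
    · rw [dec_one]
      exact h.G_nonneg
    · refine le_trans ?_ h.dec_two_nonneg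
      rw [dec_one]
      have := h.G_nonneg
      positivity
    · rw [dec_rec r G h3]
      exact mul_nonneg (by positivity) (ih _ (by omega) (by omega))

lemma dec_succ_le (h : Admits r G) (n : ℕ) (hn : 1 ≤ n) : dec r G (n + 1) ≤ dec r G n := by
  induction n using Nat.strong_induction_on with
  | _ n ih =>
    rcases (by omega : n = 1 ∨ n = 2 ∨ 3 ≤ n) with rfl | rfl | h3
    · rw [h.dec_two, dec_one]
      have := h.third
      have := sq_nonneg (1 - r)
      linarith
    · rw [dec_rec r G (by norm_num : 3 ≤ 2 + 1)]
      exact h.dec_two_nonneg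
    · rw [dec_rec r G h3, dec_rec r G (by omega : 3 ≤ n + 1)]
      refine mul_le_mul_of_nonneg_left ?_ (by positivity)
      rcases (by omega : (n + 1) / 3 = n / 3 ∨ (n + 1) / 3 = n / 3 + 1) with e | e
      · rw [e]
      · rw [e]
        exact ih _ (by omega) (by omega)

lemma dec_anti (h : Admits r G) {m n : ℕ} (hm : 1 ≤ m) (hmn : m ≤ n) :
    dec r G n ≤ dec r G m := by
  induction n, hmn using Nat.le_induction with
  | base => exact le_rfl
  | succ n hn ih => exact (h.dec_succ_le n (by omega)).trans ih

lemma err_anti (h : Admits r G) {m n : ℕ} (hm : 1 ≤ m) (hmn : m ≤ n) :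
    err r G n ≤ err r G m := by
  induction n, hmn using Nat.le_induction with
  | base => exact le_rfl
  | succ n hn ih =>
    have := h.dec_nonneg n (by omega)
    unfold dec at this
    linarith

/-- `err` is convex, so it lies above its tangents. -/
lemma err_ge_tangent (h : Admits r G) {t : ℕ} (ht : 1 ≤ t) (k : ℕ) (hk : 1 ≤ k) :
    err r G t - dec r G t * ((k : ℝ) - t) ≤ err r G k := by
  rcases le_total t k with htk | htk
  · induction k, htk using Nat.le_induction with
    | base => simp
    | succ n hn ih =>
      have := ih (by omega)
      have h2 := h.dec_anti ht hn
      have e : dec r G n = err r G n - err r G (n + 1) := rfl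
      push_cast
      linarith
  · induction t, htk using Nat.le_induction with
    | base => simp
    | succ n hn ih =>
      have := ih (by omega)
      have h2 := h.dec_succ_le n (by omega)
      have e : dec r G n = err r G n - err r G (n + 1) := rfl
      have h3 : (0 : ℝ) ≤ n + 1 - k := by
        have : (k : ℝ) ≤ n := by exact_mod_cast hn
        linarith
      push_cast
      nlinarith

/-- The even distribution of points over the three intervals is the best one. -/
lemma err_le_split (h : Admits r G) {a b c : ℕ} (ha : 1 ≤ a) (hb : 1 ≤ b) (hc : 1 ≤ c) :
    err r G (a + b + c) ≤ r ^ 2 / 3 * (err r G a + err r G b + err r G c) := by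
  set n := a + b + c with hn
  rw [err_rec r G (by omega : 3 ≤ n)]
  refine mul_le_mul_of_nonneg_left ?_ (by positivity)
  have ht : 1 ≤ n / 3 := by omega
  have h1 := h.err_ge_tangent ht a ha
  have h2 := h.err_ge_tangent ht b hb
  have h3 := h.err_ge_tangent ht c hc
  have e : (a : ℝ) + b + c = 3 * (n / 3 : ℕ) + (n % 3 : ℕ) := by
    exact_mod_cast hn.symm.trans (Nat.div_add_mod n 3).symm
  have e2 : ((n % 3 : ℕ) : ℝ) = a + b + c - 3 * (n / 3 : ℕ) := by linarith
  rw [e2]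
  linarith

/-- Moving a point from an interval with at least three points to an interval with a single one
gains enough to outweigh two protruding points. -/
lemma err_swap (h : Admits r G) (h2 : 247 / 1250 ≤ r) {k : ℕ} (hk : 3 ≤ k) :
    err r G (k - 1) + err r G 2 + 6 / 125 ≤ err r G k + err r G 1 := by
  have h1 := h.dec_anti (m := 2) (n := k - 1) (by norm_num) (by omega)
  rw [h.dec_two, dec, Nat.sub_add_cancel (by omega)] at h1
  have h3 : err r G 1 - err r G 2 = G := dec_one
  have := h.four_ninths
  have B := bernstein_nonneg h2 h.le
  linarith [B 0 4, B 1 3, B 2 2, B 3 1, B 4 0]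

end Admits

/-! ### The lower bound for `n` points -/

/-- A lower bound for the distortion `x` of an interval with `k ≥ 1` near points, depending on the
number `o` of near points that protrude far into a gap and on the number `i` of protruding points
of its neighbours. -/
def BlockBound (r G : ℝ) (k : ℕ) (o i x : ℝ) : Prop :=
  (k = 1 ∧ err r G 1 + 3 / 125 * (o - i) ≤ x) ∨ (k = 2 ∧ err r G 2 + 3 / 125 * o ≤ x) ∨
    (3 ≤ k ∧ err r G k ≤ x)

/-- Here `N` and `F` are the near and the far points of an interval, in its coordinates; `oL`, `oR`
tell whether a point of `N` protrudes far, and `iL`, `iR` whether a point of a neighbour does. -/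
lemma blockBound {r G : ℝ} (h : Admits r G) {N F : Finset ℝ}
    (hN : ∀ a ∈ N, -del r ≤ a ∧ a ≤ 1 + del r) (hF : ∀ a ∈ F, a ≤ -del r ∨ 1 + del r ≤ a)
    (hN0 : N.Nonempty) (ih : 3 ≤ N.card → err r G N.card ≤ D r N) {oL oR iL iR : ℝ}
    (hoL : oL = 0 ∨ oL = 1 ∧ ∃ a ∈ N, a < -(2 * del r - 103 / 200))
    (hoR : oR = 0 ∨ oR = 1 ∧ ∃ a ∈ N, 1 + (2 * del r - 103 / 200) < a)
    (hiL : iL = 1 ∧ 247 / 1250 ≤ r ∨ iL = 0 ∧ ∀ a ∈ F, a ≤ -(103 / 200) ∨ 1 + del r ≤ a)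
    (hiR : iR = 1 ∧ 247 / 1250 ≤ r ∨ iR = 0 ∧ ∀ a ∈ F, a ≤ -del r ∨ 1 + 103 / 200 ≤ a) :
    BlockBound r G N.card (oL + oR) (iL + iR) (D r (N ∪ F)) := by
  have hc : 1 ≤ N.card := hN0.card_pos
  rcases (by omega : N.card = 1 ∨ N.card = 2 ∨ 3 ≤ N.card) with hk | hk | hk
  · left
    obtain ⟨b, rfl⟩ := Finset.card_eq_one.1 hk
    refine ⟨hk, ?_⟩
    obtain ⟨hb0, hb1⟩ := hN b (by simp)
    have := le_D_one h.pos h.le hb0 hb1 hF (hoL.imp id fun h => ⟨h.1, by simpa using h.2⟩)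
      (hoR.imp id fun h => ⟨h.1, by simpa using h.2⟩) hiL hiR
    rw [err_one]
    linarith
  · right; left
    refine ⟨hk, ?_⟩
    obtain ⟨p, q, hpq, hNe⟩ : ∃ p q, p ≤ q ∧ N = {p, q} := by
      obtain ⟨p, q, -, rfl⟩ := Finset.card_eq_two.1 hk
      rcases le_total p q with h | h
      · exact ⟨p, q, h, rfl⟩
      · exact ⟨q, p, h, Finset.pair_comm _ _⟩
    subst hNe
    rw [err_two]
    refine le_D_two h.pos h.le h.third h.four_ninths h.two_means hpq (hN p (by simp)).1
      (hN q (by simp)).2 hF (hoL.imp id fun h => ⟨h.1, ?_⟩) (hoR.imp id fun h => ⟨h.1, ?_⟩)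
    · obtain ⟨a, ha, hlt⟩ := h.2
      rcases Finset.mem_insert.1 ha with rfl | ha
      · exact hlt
      · rw [Finset.mem_singleton.1 ha] at hlt
        linarith
    · obtain ⟨a, ha, hlt⟩ := h.2
      rcases Finset.mem_insert.1 ha with rfl | ha
      · linarith
      · rw [Finset.mem_singleton.1 ha] at hlt
        exact hlt
  · right; right
    refine ⟨hk, ?_⟩
    rcases le_D_union h.pos h.le hN0 hN hF with h2 | h2
    · exact (ih hk).trans h2
    · refine le_trans ?_ h2
      rw [← err_three r G]
      exact h.err_anti (by norm_num) hk

/-- Adding up three blocks: the costs of protruding points cancel the gains, except for points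
protruding from a block with at least three points towards one with a single point. -/
lemma err_le_of_blocks {r G : ℝ} (h : Admits r G) {k₁ k₂ k₃ : ℕ} {x₁ x₂ x₃ e₁₂ e₂₁ e₂₃ e₃₂ : ℝ}
    (he₁₂ : e₁₂ = 0 ∨ e₁₂ = 1 ∧ 247 / 1250 ≤ r) (he₂₁ : e₂₁ = 0 ∨ e₂₁ = 1 ∧ 247 / 1250 ≤ r)
    (he₂₃ : e₂₃ = 0 ∨ e₂₃ = 1 ∧ 247 / 1250 ≤ r) (he₃₂ : e₃₂ = 0 ∨ e₃₂ = 1 ∧ 247 / 1250 ≤ r)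
    (h₁ : BlockBound r G k₁ e₁₂ e₂₁ x₁) (h₂ : BlockBound r G k₂ (e₂₁ + e₂₃) (e₁₂ + e₃₂) x₂)
    (h₃ : BlockBound r G k₃ e₃₂ e₂₃ x₃) :
    err r G (k₁ + k₂ + k₃) ≤ r ^ 2 / 3 * (x₁ + x₂ + x₃) := by
  have hk : 1 ≤ k₁ ∧ 1 ≤ k₂ ∧ 1 ≤ k₃ := by
    refine ⟨?_, ?_, ?_⟩
    · rcases h₁ with h | h | h <;> omega
    · rcases h₂ with h | h | h <;> omega
    · rcases h₃ with h | h | h <;> omega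
  have main : ∀ a b c : ℕ, 1 ≤ a → 1 ≤ b → 1 ≤ c → a + b + c = k₁ + k₂ + k₃ →
      err r G a + err r G b + err r G c ≤ x₁ + x₂ + x₃ →
      err r G (k₁ + k₂ + k₃) ≤ r ^ 2 / 3 * (x₁ + x₂ + x₃) := by
    intro a b c ha hb hc e hx
    rw [← e]
    exact (h.err_le_split ha hb hc).trans (mul_le_mul_of_nonneg_left hx (by positivity))
  rcases lt_or_ge r (247 / 1250) with hr | hr
  · have z : ∀ {e : ℝ}, (e = 0 ∨ e = 1 ∧ 247 / 1250 ≤ r) → e = 0 := by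
      rintro e (h | h)
      · exact h
      · linarith [h.2]
    rw [z he₁₂, z he₂₁, z he₂₃, z he₃₂] at *
    refine main k₁ k₂ k₃ hk.1 hk.2.1 hk.2.2 rfl ?_
    have f₁ : err r G k₁ ≤ x₁ := by
      rcases h₁ with ⟨rfl, h⟩ | ⟨rfl, h⟩ | ⟨-, h⟩ <;> linarith
    have f₂ : err r G k₂ ≤ x₂ := by
      rcases h₂ with ⟨rfl, h⟩ | ⟨rfl, h⟩ | ⟨-, h⟩ <;> linarith
    have f₃ : err r G k₃ ≤ x₃ := by
      rcases h₃ with ⟨rfl, h⟩ | ⟨rfl, h⟩ | ⟨-, h⟩ <;> linarith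
    linarith
  have u : ∀ {e : ℝ}, (e = 0 ∨ e = 1 ∧ 247 / 1250 ≤ r) → 0 ≤ e ∧ e ≤ 1 := by
    rintro e (h | h)
    · rw [h]
      norm_num
    · rw [h.1]
      norm_num
  have u₁₂ := u he₁₂
  have u₂₁ := u he₂₁
  have u₂₃ := u he₂₃
  have u₃₂ := u he₃₂
  -- If the sum does not suffice, one point moves to an interval with a single one.
  rcases h₁ with ⟨rfl, f₁⟩ | ⟨rfl, f₁⟩ | ⟨g₁, f₁⟩ <;>
  rcases h₂ with ⟨rfl, f₂⟩ | ⟨rfl, f₂⟩ | ⟨g₂, f₂⟩ <;>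
  rcases h₃ with ⟨rfl, f₃⟩ | ⟨rfl, f₃⟩ | ⟨g₃, f₃⟩ <;>
  first
  | exact main _ _ _ hk.1 hk.2.1 hk.2.2 rfl (by linarith)
  | exact main (k₁ - 1) 2 k₃ (by omega) (by omega) (by omega) (by omega)
      (by linarith [h.err_swap hr g₁])
  | exact main (k₁ - 1) k₂ 2 (by omega) (by omega) (by omega) (by omega)
      (by linarith [h.err_swap hr g₁])
  | exact main (k₁ - 1) 2 1 (by omega) (by omega) (by omega) (by omega)
      (by linarith [h.err_swap hr g₁])
  | exact main (k₁ - 1) 2 2 (by omega) (by omega) (by omega) (by omega)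
      (by linarith [h.err_swap hr g₁])
  | exact main 2 (k₂ - 1) k₃ (by omega) (by omega) (by omega) (by omega)
      (by linarith [h.err_swap hr g₂])
  | exact main 2 (k₂ - 1) 1 (by omega) (by omega) (by omega) (by omega)
      (by linarith [h.err_swap hr g₂])
  | exact main 2 (k₂ - 1) 2 (by omega) (by omega) (by omega) (by omega)
      (by linarith [h.err_swap hr g₂])
  | exact main 1 2 (k₃ - 1) (by omega) (by omega) (by omega) (by omega)
      (by linarith [h.err_swap hr g₃])
  | exact main 2 2 (k₃ - 1) (by omega) (by omega) (by omega) (by omega)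
      (by linarith [h.err_swap hr g₃])

lemma pull_union (r : ℝ) (j : Fin 3) (A B : Finset ℝ) :
    pull r j (A ∪ B) = pull r j A ∪ pull r j B := Finset.image_union _ _

lemma card_pull {r : ℝ} (h0 : 0 < r) (j : Fin 3) (A : Finset ℝ) :
    (pull r j A).card = A.card := by
  refine Finset.card_image_of_injective _ fun a b h => ?_
  have h2 : a - (j : ℕ) / 2 * (1 - r) = b - (j : ℕ) / 2 * (1 - r) := by
    simpa [h0.ne'] using h
  linarith

lemma forall_mem_pull {r : ℝ} {j : Fin 3} {A : Finset ℝ} {p : ℝ → Prop} :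
    (∀ b ∈ pull r j A, p b) ↔ ∀ a ∈ A, p ((a - (j : ℕ) / 2 * (1 - r)) / r) := by
  simp [pull]

lemma exists_mem_pull {r : ℝ} {j : Fin 3} {A : Finset ℝ} {p : ℝ → Prop} :
    (∃ b ∈ pull r j A, p b) ↔ ∃ a ∈ A, p ((a - (j : ℕ) / 2 * (1 - r)) / r) := by
  simp [pull]

/-- The three coordinates of a point of the line with respect to the three intervals. -/
lemma coord_eq {r : ℝ} (h0 : 0 < r) (a : ℝ) :
    (a - ((1 : Fin 3) : ℕ) / 2 * (1 - r)) / r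
      = (a - ((0 : Fin 3) : ℕ) / 2 * (1 - r)) / r - (1 + 2 * del r) ∧
    (a - ((2 : Fin 3) : ℕ) / 2 * (1 - r)) / r
      = (a - ((0 : Fin 3) : ℕ) / 2 * (1 - r)) / r - 2 * (1 + 2 * del r) := by
  unfold del
  simp only [Fin.val_zero, Fin.val_one, Fin.val_two]
  push_cast
  constructor <;> field_simp <;> ring

lemma clamp_le_D {r : ℝ} (h0 : 0 < r) (h1 : r < 1 / 3) {A : Finset ℝ} (hA : A.Nonempty) :
    D r (A.image fun a => max 0 (min 1 a)) ≤ D r A := by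
  refine D_le_D h0 h1 hA fun x hx b hb => ⟨_, Finset.mem_image_of_mem _ hb, ?_⟩
  obtain ⟨hx0, hx1⟩ := hx
  rcases le_total b 0 with h | h
  · rw [min_eq_right (by linarith), max_eq_left h]
    nlinarith
  rcases le_total b 1 with h2 | h2
  · rw [min_eq_right h2, max_eq_right h]
  · rw [min_eq_left h2, max_eq_right zero_le_one]
    nlinarith

/-- The induction step for a set inside `[0, 1]`: it is cut at the midpoints of the two gaps. -/
lemma err_le_D_of_subset {r G : ℝ} (h : Admits r G) {n : ℕ} (hn : 3 ≤ n)
    (ih : ∀ m < n, 1 ≤ m → ∀ B : Finset ℝ, B.Nonempty → B.card ≤ m → err r G m ≤ D r B)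
    {A : Finset ℝ} (hA : A.Nonempty) (hAn : A.card ≤ n) (hAI : ∀ a ∈ A, 0 ≤ a ∧ a ≤ 1) :
    err r G n ≤ D r A := by
  classical
  have h0 := h.pos
  have h1 := h.lt
  have hd := del_ge h0
  have hle := h.le
  have hd' := del_ge' h0
  set f : ℝ → ℝ := fun a => (a - ((0 : Fin 3) : ℕ) / 2 * (1 - r)) / r with hf
  have hf1 : ∀ a, (a - ((1 : Fin 3) : ℕ) / 2 * (1 - r)) / r = f a - (1 + 2 * del r) := fun a =>
    (coord_eq h0 a).1
  have hf2 : ∀ a, (a - ((2 : Fin 3) : ℕ) / 2 * (1 - r)) / r = f a - 2 * (1 + 2 * del r) :=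
    fun a => (coord_eq h0 a).2
  have hf0 : ∀ a, (a - ((0 : Fin 3) : ℕ) / 2 * (1 - r)) / r = f a := fun a => rfl
  have hfI : ∀ a ∈ A, 0 ≤ f a ∧ f a ≤ 1 + 2 * (1 + 2 * del r) := by
    intro a ha
    obtain ⟨ha0, ha1⟩ := hAI a ha
    have e : r * f a = a := by
      simp only [hf, Fin.val_zero]
      field_simp
      push_cast
      ring
    have := del_mul h0
    constructor
    · by_contra hc
      nlinarith
    · by_contra hc
      nlinarith
  set A₁ := A.filter fun a => f a < 1 + del r with hA₁
  set A₂ := A.filter fun a => 1 + del r ≤ f a ∧ f a ≤ 2 + 3 * del r with hA₂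
  set A₃ := A.filter fun a => 2 + 3 * del r < f a with hA₃
  have hcover : A = A₁ ∪ (A₂ ∪ A₃) := by
    ext a
    simp only [hA₁, hA₂, hA₃, Finset.mem_union, Finset.mem_filter]
    constructor
    · intro ha
      rcases lt_or_ge (f a) (1 + del r) with h | h
      · exact Or.inl ⟨ha, h⟩
      · rcases le_or_gt (f a) (2 + 3 * del r) with h2 | h2
        · exact Or.inr (Or.inl ⟨ha, h, h2⟩)
        · exact Or.inr (Or.inr ⟨ha, h2⟩)
    · rintro (h | h | h) <;> exact h.1
  have hcard : A₁.card + A₂.card + A₃.card = A.card := by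
    conv_rhs => rw [hcover]
    rw [Finset.card_union_of_disjoint, Finset.card_union_of_disjoint, add_assoc]
    · rw [Finset.disjoint_left]
      intro a ha hb
      linarith [(Finset.mem_filter.1 ha).2.2, (Finset.mem_filter.1 hb).2]
    · rw [Finset.disjoint_left]
      intro a ha hb
      have := (Finset.mem_filter.1 ha).2
      rcases Finset.mem_union.1 hb with hb | hb
      · linarith [(Finset.mem_filter.1 hb).2.1]
      · linarith [(Finset.mem_filter.1 hb).2]
  have m₁ : ∀ a ∈ A₁, 0 ≤ f a ∧ f a < 1 + del r := fun a ha =>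
    ⟨(hfI a (Finset.mem_filter.1 ha).1).1, (Finset.mem_filter.1 ha).2⟩
  have m₂ : ∀ a ∈ A₂, 1 + del r ≤ f a ∧ f a ≤ 2 + 3 * del r := fun a ha =>
    (Finset.mem_filter.1 ha).2
  have m₃ : ∀ a ∈ A₃, 2 + 3 * del r < f a ∧ f a ≤ 1 + 2 * (1 + 2 * del r) := fun a ha =>
    ⟨(Finset.mem_filter.1 ha).2, (hfI a (Finset.mem_filter.1 ha).1).2⟩
  -- The far points of each of the three intervals.
  have F₁ : ∀ b ∈ pull r 0 (A₂ ∪ A₃), b ≤ -del r ∨ 1 + del r ≤ b := by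
    refine forall_mem_pull.2 fun a ha => Or.inr ?_
    rw [hf0]
    rcases Finset.mem_union.1 ha with ha | ha
    · exact (m₂ a ha).1
    · linarith [(m₃ a ha).1]
  have F₂ : ∀ b ∈ pull r 1 (A₁ ∪ A₃), b ≤ -del r ∨ 1 + del r ≤ b := by
    refine forall_mem_pull.2 fun a ha => ?_
    rw [hf1]
    rcases Finset.mem_union.1 ha with ha | ha
    · left; linarith [(m₁ a ha).2]
    · right; linarith [(m₃ a ha).1]
  have F₃ : ∀ b ∈ pull r 2 (A₁ ∪ A₂), b ≤ -del r ∨ 1 + del r ≤ b := by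
    refine forall_mem_pull.2 fun a ha => Or.inl ?_
    rw [hf2]
    rcases Finset.mem_union.1 ha with ha | ha
    · linarith [(m₁ a ha).2]
    · linarith [(m₂ a ha).2]
  have c₁ : pull r 0 A = pull r 0 A₁ ∪ pull r 0 (A₂ ∪ A₃) := by rw [← pull_union, ← hcover]
  have c₂ : pull r 1 A = pull r 1 A₂ ∪ pull r 1 (A₁ ∪ A₃) := by
    rw [← pull_union, ← Finset.union_assoc, Finset.union_comm A₂ A₁, Finset.union_assoc, ← hcover]
  have c₃ : pull r 2 A = pull r 2 A₃ ∪ pull r 2 (A₁ ∪ A₂) := by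
    rw [← pull_union, Finset.union_comm A₃, Finset.union_assoc, ← hcover]
  have hne : ∀ j, (pull r j A).Nonempty := fun j => hA.image _
  rw [D_selfSimilar h0 h1 hA]
  -- An interval without near points alone exceeds the error of three points.
  have hempty : ∀ j, 3 * var r ≤ D r (pull r j A) →
      err r G n ≤ r ^ 2 / 3 * (D r (pull r 0 A) + D r (pull r 1 A) + D r (pull r 2 A)) := by
    intro j hj
    have e : err r G n ≤ r ^ 2 / 3 * (3 * var r) := by
      refine (h.err_anti (by norm_num) hn).trans (le_of_eq ?_)
      rw [err_three]
      ring
    refine e.trans (mul_le_mul_of_nonneg_left ?_ (by positivity))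
    have := D_nonneg r (pull r 0 A)
    have := D_nonneg r (pull r 1 A)
    have := D_nonneg r (pull r 2 A)
    fin_cases j <;> simp at hj <;> linarith
  rcases A₁.eq_empty_or_nonempty with z | n₁
  · refine hempty 0 (three_var_le h0 hle (hne 0) ?_)
    rw [c₁, z, show pull r 0 (∅ : Finset ℝ) = ∅ from rfl, Finset.empty_union]
    exact F₁
  rcases A₂.eq_empty_or_nonempty with z | n₂
  · refine hempty 1 (three_var_le h0 hle (hne 1) ?_)
    rw [c₂, z, show pull r 1 (∅ : Finset ℝ) = ∅ from rfl, Finset.empty_union]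
    exact F₂
  rcases A₃.eq_empty_or_nonempty with z | n₃
  · refine hempty 2 (three_var_le h0 hle (hne 2) ?_)
    rw [c₃, z, show pull r 2 (∅ : Finset ℝ) = ∅ from rfl, Finset.empty_union]
    exact F₃
  have p₁ := n₁.card_pos
  have p₂ := n₂.card_pos
  have p₃ := n₃.card_pos
  have hih : ∀ (j : Fin 3) (B : Finset ℝ), B.Nonempty → B.card < n →
      3 ≤ (pull r j B).card → err r G (pull r j B).card ≤ D r (pull r j B) := by
    intro j B hB hBn h3
    exact ih _ (by rwa [card_pull h0]) (by omega) _ (hB.image _) le_rfl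
  obtain ⟨e₁₂, he₁₂⟩ : ∃ e : ℝ, (e = 1 ∧ ∃ a ∈ A₁, 1 + (2 * del r - 103 / 200) < f a) ∨
      (e = 0 ∧ ∀ a ∈ A₁, f a ≤ 1 + (2 * del r - 103 / 200)) := by
    by_cases hc : ∃ a ∈ A₁, 1 + (2 * del r - 103 / 200) < f a
    · exact ⟨1, Or.inl ⟨rfl, hc⟩⟩
    · push Not at hc
      exact ⟨0, Or.inr ⟨rfl, hc⟩⟩
  obtain ⟨e₂₁, he₂₁⟩ : ∃ e : ℝ,
      (e = 1 ∧ ∃ a ∈ A₂, f a - (1 + 2 * del r) < -(2 * del r - 103 / 200)) ∨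
      (e = 0 ∧ ∀ a ∈ A₂, -(2 * del r - 103 / 200) ≤ f a - (1 + 2 * del r)) := by
    by_cases hc : ∃ a ∈ A₂, f a - (1 + 2 * del r) < -(2 * del r - 103 / 200)
    · exact ⟨1, Or.inl ⟨rfl, hc⟩⟩
    · push Not at hc
      exact ⟨0, Or.inr ⟨rfl, hc⟩⟩
  obtain ⟨e₂₃, he₂₃⟩ : ∃ e : ℝ,
      (e = 1 ∧ ∃ a ∈ A₂, 1 + (2 * del r - 103 / 200) < f a - (1 + 2 * del r)) ∨
      (e = 0 ∧ ∀ a ∈ A₂, f a - (1 + 2 * del r) ≤ 1 + (2 * del r - 103 / 200)) := by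
    by_cases hc : ∃ a ∈ A₂, 1 + (2 * del r - 103 / 200) < f a - (1 + 2 * del r)
    · exact ⟨1, Or.inl ⟨rfl, hc⟩⟩
    · push Not at hc
      exact ⟨0, Or.inr ⟨rfl, hc⟩⟩
  obtain ⟨e₃₂, he₃₂⟩ : ∃ e : ℝ,
      (e = 1 ∧ ∃ a ∈ A₃, f a - 2 * (1 + 2 * del r) < -(2 * del r - 103 / 200)) ∨
      (e = 0 ∧ ∀ a ∈ A₃, -(2 * del r - 103 / 200) ≤ f a - 2 * (1 + 2 * del r)) := by
    by_cases hc : ∃ a ∈ A₃, f a - 2 * (1 + 2 * del r) < -(2 * del r - 103 / 200)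
    · exact ⟨1, Or.inl ⟨rfl, hc⟩⟩
    · push Not at hc
      exact ⟨0, Or.inr ⟨rfl, hc⟩⟩
  have q₁₂ : e₁₂ = 0 ∨ e₁₂ = 1 ∧ 247 / 1250 ≤ r := by
    rcases he₁₂ with ⟨rfl, a, ha, hlt⟩ | ⟨rfl, -⟩
    · right
      exact ⟨rfl, by linarith [(m₁ a ha).2]⟩
    · exact Or.inl rfl
  have q₂₁ : e₂₁ = 0 ∨ e₂₁ = 1 ∧ 247 / 1250 ≤ r := by
    rcases he₂₁ with ⟨rfl, a, ha, hlt⟩ | ⟨rfl, -⟩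
    · right
      exact ⟨rfl, by linarith [(m₂ a ha).1]⟩
    · exact Or.inl rfl
  have q₂₃ : e₂₃ = 0 ∨ e₂₃ = 1 ∧ 247 / 1250 ≤ r := by
    rcases he₂₃ with ⟨rfl, a, ha, hlt⟩ | ⟨rfl, -⟩
    · right
      exact ⟨rfl, by linarith [(m₂ a ha).2]⟩
    · exact Or.inl rfl
  have q₃₂ : e₃₂ = 0 ∨ e₃₂ = 1 ∧ 247 / 1250 ≤ r := by
    rcases he₃₂ with ⟨rfl, a, ha, hlt⟩ | ⟨rfl, -⟩
    · right
      exact ⟨rfl, by linarith [(m₃ a ha).1]⟩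
    · exact Or.inl rfl
  have b₁ := blockBound h (N := pull r 0 A₁) (F := pull r 0 (A₂ ∪ A₃)) (oL := 0) (oR := e₁₂)
    (iL := 0) (iR := e₂₁)
    (forall_mem_pull.2 fun a ha => by rw [hf0]; constructor <;> linarith [m₁ a ha]) F₁
    (n₁.image _) (hih 0 A₁ n₁ (by omega)) (Or.inl rfl)
    (by
      rcases he₁₂ with ⟨rfl, hc⟩ | ⟨rfl, -⟩
      · exact Or.inr ⟨rfl, exists_mem_pull.2 hc⟩
      · exact Or.inl rfl)
    (Or.inr ⟨rfl, forall_mem_pull.2 fun a ha => by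
      right
      rw [hf0]
      rcases Finset.mem_union.1 ha with ha | ha
      · linarith [m₂ a ha]
      · linarith [m₃ a ha]⟩)
    (by
      rcases he₂₁ with ⟨rfl, hc⟩ | ⟨rfl, hc⟩
      · exact Or.inl (q₂₁.resolve_left one_ne_zero)
      · refine Or.inr ⟨rfl, forall_mem_pull.2 fun a ha => Or.inr ?_⟩
        rw [hf0]
        rcases Finset.mem_union.1 ha with ha | ha
        · linarith [hc a ha]
        · linarith [m₃ a ha])
  have b₂ := blockBound h (N := pull r 1 A₂) (F := pull r 1 (A₁ ∪ A₃)) (oL := e₂₁) (oR := e₂₃)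
    (iL := e₁₂) (iR := e₃₂)
    (forall_mem_pull.2 fun a ha => by rw [hf1]; constructor <;> linarith [m₂ a ha]) F₂
    (n₂.image _) (hih 1 A₂ n₂ (by omega))
    (by
      rcases he₂₁ with ⟨rfl, hc⟩ | ⟨rfl, -⟩
      · exact Or.inr ⟨rfl, exists_mem_pull.2 (by simpa only [hf1] using hc)⟩
      · exact Or.inl rfl)
    (by
      rcases he₂₃ with ⟨rfl, hc⟩ | ⟨rfl, -⟩
      · exact Or.inr ⟨rfl, exists_mem_pull.2 (by simpa only [hf1] using hc)⟩
      · exact Or.inl rfl)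
    (by
      rcases he₁₂ with ⟨rfl, hc⟩ | ⟨rfl, hc⟩
      · exact Or.inl (q₁₂.resolve_left one_ne_zero)
      · refine Or.inr ⟨rfl, forall_mem_pull.2 fun a ha => ?_⟩
        rw [hf1]
        rcases Finset.mem_union.1 ha with ha | ha
        · left; linarith [hc a ha]
        · right; linarith [m₃ a ha])
    (by
      rcases he₃₂ with ⟨rfl, hc⟩ | ⟨rfl, hc⟩
      · exact Or.inl (q₃₂.resolve_left one_ne_zero)
      · refine Or.inr ⟨rfl, forall_mem_pull.2 fun a ha => ?_⟩
        rw [hf1]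
        rcases Finset.mem_union.1 ha with ha | ha
        · left; linarith [m₁ a ha]
        · right; linarith [hc a ha])
  have b₃ := blockBound h (N := pull r 2 A₃) (F := pull r 2 (A₁ ∪ A₂)) (oL := e₃₂) (oR := 0)
    (iL := e₂₃) (iR := 0)
    (forall_mem_pull.2 fun a ha => by rw [hf2]; constructor <;> linarith [m₃ a ha]) F₃
    (n₃.image _) (hih 2 A₃ n₃ (by omega))
    (by
      rcases he₃₂ with ⟨rfl, hc⟩ | ⟨rfl, -⟩
      · exact Or.inr ⟨rfl, exists_mem_pull.2 (by simpa only [hf2] using hc)⟩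
      · exact Or.inl rfl)
    (Or.inl rfl)
    (by
      rcases he₂₃ with ⟨rfl, hc⟩ | ⟨rfl, hc⟩
      · exact Or.inl (q₂₃.resolve_left one_ne_zero)
      · refine Or.inr ⟨rfl, forall_mem_pull.2 fun a ha => Or.inl ?_⟩
        rw [hf2]
        rcases Finset.mem_union.1 ha with ha | ha
        · linarith [m₁ a ha]
        · linarith [hc a ha])
    (Or.inr ⟨rfl, forall_mem_pull.2 fun a ha => by
      left
      rw [hf2]
      rcases Finset.mem_union.1 ha with ha | ha
      · linarith [m₁ a ha]
      · linarith [m₂ a ha]⟩)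
  rw [← c₁, zero_add, zero_add, card_pull h0] at b₁
  rw [← c₂, card_pull h0] at b₂
  rw [← c₃, add_zero, add_zero, card_pull h0] at b₃
  exact (h.err_anti (by omega) (by omega : A₁.card + A₂.card + A₃.card ≤ n)).trans
    (err_le_of_blocks h q₁₂ q₂₁ q₂₃ q₃₂ b₁ b₂ b₃)

/-- No set of at most `n` points has a smaller distortion than `err r G n`. -/
theorem err_le_D {r G : ℝ} (h : Admits r G) (n : ℕ) (hn : 1 ≤ n) (A : Finset ℝ) (hA : A.Nonempty)
    (hAn : A.card ≤ n) : err r G n ≤ D r A := by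
  induction n using Nat.strong_induction_on generalizing A with
  | _ n ih =>
    have h0 := h.pos
    have h1 := h.lt
    rcases (by omega : n = 1 ∨ n = 2 ∨ 3 ≤ n) with rfl | rfl | h3
    · obtain ⟨b, rfl⟩ := Finset.card_eq_one.1 (le_antisymm hAn hA.card_pos)
      rw [err_one, D_singleton h0 h1]
      nlinarith [sq_nonneg (b - 1 / 2)]
    · rw [err_two]
      have hc := hA.card_pos
      rcases (by omega : A.card = 1 ∨ A.card = 2) with hk | hk
      · obtain ⟨b, rfl⟩ := Finset.card_eq_one.1 hk
        simpa using h.two_means b b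
      · obtain ⟨p, q, -, rfl⟩ := Finset.card_eq_two.1 hk
        exact h.two_means p q
    · refine le_trans ?_ (clamp_le_D h0 h1 hA)
      refine err_le_D_of_subset h h3 (fun m hm hm1 B hB hBm => ih m hm hm1 B hB hBm)
        (hA.image _) (Finset.card_image_le.trans hAn) fun a ha => ?_
      obtain ⟨b, -, rfl⟩ := Finset.mem_image.1 ha
      exact ⟨le_max_left _ _, max_le zero_le_one (min_le_left _ _)⟩

/-! ### Optimal sets in terms of the real distortion -/

lemma distortion_coe {r : ℝ} (h0 : 0 < r) (h1 : r < 1 / 3) {A : Finset ℝ} (hA : A.Nonempty) :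
    distortion (cantorDist r) (A : Set ℝ) = ENNReal.ofReal (D r A) := by
  unfold distortion D
  rw [ofReal_integral_eq_lintegral_ofReal
    (integrable_of_continuous h0 h1 (continuous_infDist_sq A))
    (Filter.Eventually.of_forall fun x => sq_nonneg _)]
  refine lintegral_congr fun x => le_antisymm ?_ ?_
  · obtain ⟨a, ha, e⟩ := exists_infDist_eq hA x
    rw [e, ← sq_abs (x - a)]
    exact iInf₂_le a (by exact_mod_cast ha)
  · refine le_iInf₂ fun a ha => ENNReal.ofReal_le_ofReal ?_
    rw [sq_abs]
    exact infDist_sq_le (by exact_mod_cast ha) x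

lemma distortion_empty {r : ℝ} (h0 : 0 < r) (h1 : r < 1 / 3) :
    distortion (cantorDist r) ∅ = ∞ := by
  have := isProbabilityMeasure_cantorDist h0 h1
  simp [distortion]

/-- A finite set whose distortion attains the lower bound `err` is optimal. -/
lemma isOptimalSet_of_le {r G : ℝ} (h : Admits r G) {n : ℕ} (hn : 1 ≤ n) {A : Finset ℝ}
    (hA : A.Nonempty) (hAn : A.card ≤ n) (hD : D r A ≤ err r G n) :
    IsOptimalSet (cantorDist r) n (A : Set ℝ) := by
  refine ⟨by rw [Set.encard_coe_eq_coe_finsetCard]; exact_mod_cast hAn, le_antisymm ?_ ?_⟩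
  · refine le_iInf₂ fun α hα => ?_
    have hfin : α.Finite := Set.finite_of_encard_le_coe hα
    obtain ⟨B, rfl⟩ := hfin.exists_finset_coe
    rcases B.eq_empty_or_nonempty with rfl | hB
    · rw [Finset.coe_empty, distortion_empty h.pos h.lt]
      exact le_top
    · rw [distortion_coe h.pos h.lt hA, distortion_coe h.pos h.lt hB]
      rw [Set.encard_coe_eq_coe_finsetCard] at hα
      exact ENNReal.ofReal_le_ofReal
        (hD.trans (err_le_D h n hn B hB (by exact_mod_cast hα)))
  · refine iInf₂_le (A : Set ℝ) ?_
    rw [Set.encard_coe_eq_coe_finsetCard]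
    exact_mod_cast hAn

lemma not_isOptimalSet {r : ℝ} (h0 : 0 < r) (h1 : r < 1 / 3) {n : ℕ} {A B : Finset ℝ}
    (hA : A.Nonempty) (hB : B.Nonempty) (hBn : B.card ≤ n) (hD : D r B < D r A) :
    ¬ IsOptimalSet (cantorDist r) n (A : Set ℝ) := by
  rintro ⟨-, h⟩
  have hq : quantizationError (cantorDist r) n ≤ distortion (cantorDist r) (B : Set ℝ) :=
    iInf₂_le (B : Set ℝ) (by rw [Set.encard_coe_eq_coe_finsetCard]; exact_mod_cast hBn)
  rw [← h, distortion_coe h0 h1 hA, distortion_coe h0 h1 hB] at hq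
  exact absurd hq (not_le.2
    ((ENNReal.ofReal_lt_ofReal_iff ((D_nonneg r B).trans_lt hD)).2 hD))

lemma admits_third {r : ℝ} (h0 : 0 < r) (hr : (3 + r) ^ 2 ≤ 10) : Admits r ((1 - r) ^ 2 / 8) := by
  have hle : r ≤ 163 / 1000 := by nlinarith
  have hle' : r ≤ 29 / 125 := by linarith
  have hg : (3 + r) ^ 2 * (1 - r) ^ 2 / 80 ≤ (1 - r) ^ 2 / 8 := by
    nlinarith [sq_nonneg (1 - r)]
  refine ⟨h0, hle', le_rfl, hg, ?_, fun p q => le_D_pair h0 hle' le_rfl hg ?_ p q⟩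
  · have : r ^ 2 ≤ 1 := by nlinarith
    nlinarith [sq_nonneg (1 - r)]
  · have h2 : (9 + 3 * r + r ^ 2) ^ 2 ≤ 91 := by
      have : 9 + 3 * r + r ^ 2 ≤ 9.52 := by nlinarith
      nlinarith
    nlinarith [mul_le_mul_of_nonneg_left h2 (sq_nonneg (1 - r))]

lemma admits_four_ninths {r : ℝ} (h0 : 0 < r) (hle : r ≤ 29 / 125) (hr : 10 ≤ (3 + r) ^ 2)
    (hr' : 10 * (9 + 3 * r + r ^ 2) ^ 2 ≤ 91 * (3 + r) ^ 2) :
    Admits r ((3 + r) ^ 2 * (1 - r) ^ 2 / 80) := by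
  have hb : (1 - r) ^ 2 / 8 ≤ (3 + r) ^ 2 * (1 - r) ^ 2 / 80 := by
    nlinarith [sq_nonneg (1 - r)]
  refine ⟨h0, hle, hb, le_rfl, ?_, fun p q => le_D_pair h0 hle hb le_rfl ?_ p q⟩
  · have h2 : (3 + r) ^ 2 ≤ 12 := by nlinarith
    have h3 : 1 + r ^ 2 / 3 ≤ 10 / 9 := by nlinarith
    have h4 : (3 + r) ^ 2 * (1 + r ^ 2 / 3) ≤ 12 * (10 / 9) :=
      mul_le_mul h2 h3 (by positivity) (by norm_num)
    nlinarith [mul_le_mul_of_nonneg_left h4 (sq_nonneg (1 - r))]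
  · nlinarith [mul_le_mul_of_nonneg_left hr' (sq_nonneg (1 - r))]

/-! ### The distortion of the sets built from words -/

/-- The words of length `l`. -/
def words : ℕ → Finset (List (Fin 3))
  | 0 => {[]}
  | l + 1 => (Finset.univ ×ˢ words l).image fun p => p.1 :: p.2

lemma mem_words {l : ℕ} {ω : List (Fin 3)} : ω ∈ words l ↔ ω.length = l := by
  induction l generalizing ω with
  | zero => simp [words]
  | succ l ih =>
    cases ω with
    | nil => simp [words]
    | cons j ω => simp [words, ih]

lemma sum_words_succ {M : Type*} [AddCommMonoid M] (l : ℕ) (f : List (Fin 3) → M) :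
    ∑ ω ∈ words (l + 1), f ω = ∑ j : Fin 3, ∑ ω ∈ words l, f (j :: ω) := by
  rw [words, Finset.sum_image (by
    rintro ⟨a, b⟩ - ⟨c, d⟩ - h
    simpa using h), Finset.sum_product]

lemma card_words (l : ℕ) : (words l).card = 3 ^ l := by
  induction l with
  | zero => rfl
  | succ l ih =>
    rw [Finset.card_eq_sum_ones, sum_words_succ]
    simp [ih, pow_succ, mul_comm]

/-- The union of copies `S_ω(F ω)` of finite sets, over the words `ω` of length `l`. -/
def assembled (r : ℝ) (l : ℕ) (F : List (Fin 3) → Finset ℝ) : Finset ℝ :=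
  (words l).biUnion fun ω => (F ω).image (SWord r ω)

lemma assembled_nonempty (r : ℝ) (l : ℕ) {F : List (Fin 3) → Finset ℝ}
    (hF : ∀ ω, (F ω).Nonempty) : (assembled r l F).Nonempty := by
  have hw : (words l).Nonempty := by
    rw [← Finset.card_pos, card_words]
    positivity
  exact (Finset.biUnion_nonempty).2 ⟨hw.choose, hw.choose_spec, (hF _).image _⟩

lemma card_assembled_le (r : ℝ) (l : ℕ) (F : List (Fin 3) → Finset ℝ) :
    (assembled r l F).card ≤ ∑ ω ∈ words l, (F ω).card :=
  Finset.card_biUnion_le.trans (Finset.sum_le_sum fun _ _ => Finset.card_image_le)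

lemma D_assembled_le {r : ℝ} (h0 : 0 < r) (h1 : r < 1 / 3) (l : ℕ) {F : List (Fin 3) → Finset ℝ}
    (hF : ∀ ω, (F ω).Nonempty) :
    D r (assembled r l F) ≤ (r ^ 2 / 3) ^ l * ∑ ω ∈ words l, D r (F ω) := by
  induction l generalizing F with
  | zero => simp [assembled, words, SWord]
  | succ l ih =>
    have key : ∀ j : Fin 3, D r (pull r j (assembled r (l + 1) F))
        ≤ (r ^ 2 / 3) ^ l * ∑ ω ∈ words l, D r (F (j :: ω)) := by
      intro j
      refine (D_anti h0 h1 (assembled_nonempty r l fun ω => hF (j :: ω)) ?_).trans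
        (ih fun ω => hF (j :: ω))
      intro x hx
      obtain ⟨ω, hω, hx⟩ := Finset.mem_biUnion.1 hx
      obtain ⟨a, ha, rfl⟩ := Finset.mem_image.1 hx
      refine Finset.mem_image.2 ⟨S r j (SWord r ω a), Finset.mem_biUnion.2
        ⟨j :: ω, mem_words.2 (by simp [mem_words.1 hω]), Finset.mem_image.2 ⟨a, ha, rfl⟩⟩, ?_⟩
      unfold S
      field_simp
      ring
    rw [D_selfSimilar h0 h1 (assembled_nonempty r _ hF), sum_words_succ, Fin.sum_univ_three,
      pow_succ' (r ^ 2 / 3), mul_assoc]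
    refine mul_le_mul_of_nonneg_left ?_ (by positivity)
    rw [mul_add, mul_add]
    exact add_le_add (add_le_add (key 0) (key 1)) (key 2)

lemma D_triple_le {r : ℝ} (h0 : 0 < r) (h1 : r < 1 / 3) :
    D r {centre r [0], centre r [1], centre r [2]} ≤ r ^ 2 * var r := by
  have e : ({centre r [0], centre r [1], centre r [2]} : Finset ℝ)
      = assembled r 1 fun _ => {1 / 2} := by
    ext x
    simp only [assembled, words, Finset.image_singleton, Finset.mem_biUnion, Finset.mem_insert,
      Finset.mem_singleton, Finset.mem_image, Finset.mem_product, centre]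
    simp [Fin.exists_fin_succ]
  rw [e]
  refine (D_assembled_le h0 h1 1 fun _ => Finset.singleton_nonempty _).trans (le_of_eq ?_)
  rw [Finset.sum_const, card_words, D_singleton h0 h1]
  simp
  ring

/-- The sets of the family built from an optimal pair attain the lower bound. -/
lemma meansSet_optimal {r G : ℝ} (h : Admits r G) {A : Finset ℝ} (hA : A.Nonempty)
    (hA2 : A.card ≤ 2) (hD : D r A ≤ var r - G) {n : ℕ} (hn : 3 ≤ n) {I : Finset (List (Fin 3))}
    (hI : Admissible n I) : IsOptimalSet (cantorDist r) n (meansSet r (A : Set ℝ) n I) := by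
  classical
  have h0 := h.pos
  have h1 := h.lt
  obtain ⟨hI1, hI2⟩ := hI
  obtain ⟨hl, hl'⟩ := ell_spec hn
  have hsub : I ⊆ words (ell n) := fun ω hω => mem_words.2 (hI1 ω hω)
  have hdiff : (words (ell n) \ I).card = 3 ^ ell n - I.card := by
    rw [Finset.card_sdiff_of_subset hsub, card_words]
  have hIle : I.card ≤ 3 ^ ell n := by
    rw [← card_words]
    exact Finset.card_le_card hsub
  have split : ∀ {M : Type} [AddCommMonoid M] (B C : Finset ℝ) (f : Finset ℝ → M),
      ∑ ω ∈ words (ell n), f (if ω ∈ I then C else B)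
        = (3 ^ ell n - I.card) • f B + I.card • f C := by
    intro M _ B C f
    rw [← Finset.sum_sdiff hsub, Finset.sum_congr rfl fun ω hω => by
      rw [if_neg (Finset.mem_sdiff.1 hω).2]]
    rw [Finset.sum_congr (s₁ := I) rfl fun ω hω => by rw [if_pos hω]]
    rw [Finset.sum_const, Finset.sum_const, hdiff]
  have coe : ∀ B C : Finset ℝ,
      ((assembled r (ell n) fun ω => if ω ∈ I then C else B : Finset ℝ) : Set ℝ)
        = (⋃ (ω : List (Fin 3)) (_ : ω.length = ell n ∧ ω ∉ I), SWord r ω '' (B : Set ℝ)) ∪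
          ⋃ ω ∈ I, SWord r ω '' (C : Set ℝ) := by
    intro B C
    ext x
    simp only [assembled, Finset.coe_biUnion, Finset.coe_image, Set.mem_iUnion, Set.mem_union,
      Finset.mem_coe, mem_words, exists_prop]
    constructor
    · rintro ⟨ω, hω, hx⟩
      by_cases hωI : ω ∈ I
      · rw [if_pos hωI] at hx
        exact Or.inr ⟨ω, hωI, hx⟩
      · rw [if_neg hωI] at hx
        exact Or.inl ⟨ω, ⟨hω, hωI⟩, hx⟩
    · rintro (⟨ω, ⟨hω, hωI⟩, hx⟩ | ⟨ω, hωI, hx⟩)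
      · exact ⟨ω, hω, by rwa [if_neg hωI]⟩
      · exact ⟨ω, hI1 ω hωI, by rwa [if_pos hωI]⟩
  have main : ∀ B C : Finset ℝ, B.Nonempty → C.Nonempty →
      (3 ^ ell n - I.card) * B.card + I.card * C.card ≤ n →
      (r ^ 2 / 3) ^ ell n * ((3 ^ ell n - I.card) * D r B + I.card * D r C) ≤ err r G n →
      IsOptimalSet (cantorDist r) n
        ((⋃ (ω : List (Fin 3)) (_ : ω.length = ell n ∧ ω ∉ I), SWord r ω '' (B : Set ℝ)) ∪
          ⋃ ω ∈ I, SWord r ω '' (C : Set ℝ)) := by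
    intro B C hB hC hcard hDn
    have hF : ∀ ω : List (Fin 3), (if ω ∈ I then C else B).Nonempty := by
      intro ω
      split_ifs <;> assumption
    rw [← coe]
    refine isOptimalSet_of_le h (by omega) (assembled_nonempty r _ hF)
      ((card_assembled_le r _ _).trans ?_) ((D_assembled_le h0 h1 _ hF).trans ?_)
    · rw [split B C Finset.card]
      simpa using hcard
    · rw [split B C (D r)]
      simp only [nsmul_eq_mul]
      rw [Nat.cast_sub hIle]
      push_cast
      exact hDn
  have hpow : 3 ^ (ell n + 1) = 3 * 3 ^ ell n := by rw [pow_succ]; ring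
  unfold meansSet
  split_ifs with hc
  · rw [if_pos hc] at hI2
    have hcast : (I.card : ℝ) = n - 3 ^ ell n := by
      rw [hI2, Nat.cast_sub hl]
      push_cast
      rfl
    have e : ∀ ω, ({centre r ω} : Set ℝ) = SWord r ω '' (({1 / 2} : Finset ℝ) : Set ℝ) := by
      intro ω
      simp [centre]
    simp only [e]
    refine main {1 / 2} A (Finset.singleton_nonempty _) hA ?_ ?_
    · rw [Finset.card_singleton, mul_one]
      have := Nat.mul_le_mul_left I.card hA2
      omega
    · rw [err_first hl hc]
      refine mul_le_mul_of_nonneg_left ?_ (by positivity)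
      rw [D_singleton h0 h1, hcast]
      have hc' : (0 : ℝ) ≤ n - 3 ^ ell n := by
        rw [← hcast]
        positivity
      nlinarith [mul_le_mul_of_nonneg_left hD hc']
  · rw [if_neg hc] at hI2
    push Not at hc
    have hcast : (I.card : ℝ) = n - 2 * 3 ^ ell n := by
      rw [hI2, Nat.cast_sub hc.le]
      push_cast
      rfl
    have e : triple r = (({centre r [0], centre r [1], centre r [2]} : Finset ℝ) : Set ℝ) := by
      simp [triple]
    rw [e]
    refine main A _ hA (Finset.insert_nonempty _ _) ?_ ?_
    · have h3 : ({centre r [0], centre r [1], centre r [2]} : Finset ℝ).card ≤ 3 :=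
        Finset.card_le_three
      have := Nat.mul_le_mul_left I.card h3
      have := Nat.mul_le_mul_left (3 ^ ell n - I.card) hA2
      omega
    · rw [err_second hc.le (by omega)]
      refine mul_le_mul_of_nonneg_left ?_ (by positivity)
      have h3 : (0 : ℝ) ≤ I.card := by positivity
      have h4 : (0 : ℝ) ≤ 3 ^ ell n - I.card := by
        rw [sub_nonneg]
        exact_mod_cast hIle
      refine (add_le_add (mul_le_mul_of_nonneg_left hD h4)
        (mul_le_mul_of_nonneg_left (D_triple_le h0 h1) h3)).trans (le_of_eq ?_)
      rw [hcast]
      ring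

/-- If a pair attains the lower bound for two points, all sets of its family are optimal. -/
lemma familyOptimal_pair {r G p q : ℝ} (h : Admits r G) (hD : D r {p, q} ≤ var r - G) :
    FamilyOptimal r {p, q} := by
  have e : ({p, q} : Set ℝ) = (({p, q} : Finset ℝ) : Set ℝ) := by simp
  rw [e]
  refine ⟨isOptimalSet_of_le h one_le_two (Finset.insert_nonempty _ _) Finset.card_le_two ?_,
    fun n hn I hI => meansSet_optimal h (Finset.insert_nonempty _ _) Finset.card_le_two hD hn hI⟩
  rwa [err_two]

/-! ### The conditional means -/

lemma continuous_SWord (r : ℝ) (σ : List (Fin 3)) : Continuous (SWord r σ) := by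
  induction σ with
  | nil => exact continuous_id
  | cons j σ ih =>
    refine Continuous.comp ?_ ih
    unfold S
    fun_prop

lemma measurableSet_J (r : ℝ) (σ : List (Fin 3)) : MeasurableSet (J r σ) :=
  (isCompact_Icc.image (continuous_SWord r σ)).isClosed.measurableSet

lemma J_subset_Icc {r : ℝ} (h0 : 0 < r) (h1 : r < 1 / 3) (σ : List (Fin 3)) :
    J r σ ⊆ Icc 0 1 := by
  rintro _ ⟨x, hx, rfl⟩
  induction σ with
  | nil => exact hx
  | cons j σ ih => exact S_mem_Icc h0 h1 j ih

lemma mem_J_nil (r x : ℝ) : x ∈ J r [] ↔ x ∈ Icc (0 : ℝ) 1 := by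
  simp [J, SWord]

lemma S_mem_J_cons {r : ℝ} (h0 : 0 < r) (h1 : r < 1 / 3) {j k : Fin 3} {σ : List (Fin 3)} {x : ℝ}
    (hx : x ∈ Icc (0 : ℝ) 1) : S r j x ∈ J r (k :: σ) ↔ j = k ∧ x ∈ J r σ := by
  constructor
  · rintro ⟨y, hy, e⟩
    have hz : SWord r σ y ∈ J r σ := ⟨y, hy, rfl⟩
    have hzI := J_subset_Icc h0 h1 σ hz
    change S r k (SWord r σ y) = S r j x at e
    obtain ⟨hx0, hx1⟩ := hx
    obtain ⟨hz0, hz1⟩ := hzI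
    have hjk : j = k := by
      by_contra hne
      unfold S at e
      fin_cases j <;> fin_cases k <;>
        first | exact hne rfl | (norm_num at e; nlinarith)
    refine ⟨hjk, ?_⟩
    subst hjk
    have : SWord r σ y = x := by
      unfold S at e
      exact mul_left_cancel₀ h0.ne' (by linarith)
    rwa [← this]
  · rintro ⟨rfl, y, hy, rfl⟩
    exact ⟨y, hy, rfl⟩

/-- The mass and the first moment of a set, in terms of those of its traces on the three
intervals of the first level. -/
lemma mass_moment {r : ℝ} (h0 : 0 < r) (h1 : r < 1 / 3) {U : Set ℝ} (hU : MeasurableSet U)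
    (V : Fin 3 → Set ℝ) (hV : ∀ j, ∀ x ∈ Icc (0 : ℝ) 1, S r j x ∈ U ↔ x ∈ V j) (m k : Fin 3 → ℝ)
    (hm : ∀ j, (cantorDist r).real (V j) = m j ∧ ∫ x in V j, x ∂cantorDist r = k j) :
    (cantorDist r).real U = (m 0 + m 1 + m 2) / 3 ∧ ∫ x in U, x ∂cantorDist r
      = (r * k 0 + (r * k 1 + (1 - r) / 2 * m 1) + (r * k 2 + (1 - r) * m 2)) / 3 := by
  have := isProbabilityMeasure_cantorDist h0 h1
  have hae : ∀ j, S r j ⁻¹' U =ᵐ[cantorDist r] V j := by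
    intro j
    filter_upwards [ae_mem_Icc h0 h1] with x hx
    exact propext (hV j x hx)
  have hpre : ∀ j, MeasurableSet (S r j ⁻¹' U) := fun j => measurable_S r j hU
  have hbd : ∀ g : ℝ → ℝ, (∀ x ∈ Icc (0 : ℝ) 1, |g x| ≤ 1) → Measurable g →
      ∫ x in U, g x ∂cantorDist r
        = (∑ j : Fin 3, ∫ x in V j, g (S r j x) ∂cantorDist r) / 3 := by
    intro g hg hgm
    rw [← integral_indicator hU, integral_cantorDist h0 h1 (hgm.indicator hU) (C := 1)]
    · congr 1
      refine Finset.sum_congr rfl fun j _ => ?_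
      rw [← setIntegral_congr_set (hae j), ← integral_indicator (hpre j)]
      rfl
    · intro x hx
      by_cases hxU : x ∈ U
      · rw [indicator_of_mem hxU]
        exact hg x hx
      · rw [indicator_of_notMem hxU]
        simp
  constructor
  · have e : ∀ W : Set ℝ, (cantorDist r).real W = ∫ x in W, (1 : ℝ) ∂cantorDist r := by
      intro W
      simp
    rw [e U, hbd (fun _ => 1) (fun x _ => by simp) measurable_const]
    simp only [← e, hm, Fin.sum_univ_three]
  · rw [hbd (fun x => x) (fun x hx => by rw [abs_of_nonneg hx.1]; exact hx.2) measurable_id]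
    congr 1
    have e : ∀ j, ∫ x in V j, S r j x ∂cantorDist r = r * k j + (j : ℕ) / 2 * (1 - r) * m j := by
      intro j
      unfold S
      rw [integral_add ((integrable_of_continuous h0 h1 (by fun_prop)).integrableOn)
        ((integrable_of_continuous h0 h1 (by fun_prop)).integrableOn), integral_const_mul,
        (hm j).2, setIntegral_const, (hm j).1, smul_eq_mul]
      ring
    simp only [e, Fin.sum_univ_three, Fin.val_zero, Fin.val_one, Fin.val_two]
    push_cast
    ring

lemma mass_moment_univ {r : ℝ} (h0 : 0 < r) (h1 : r < 1 / 3) :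
    (cantorDist r).real univ = 1 ∧ ∫ x in univ, x ∂cantorDist r = 1 / 2 := by
  have := isProbabilityMeasure_cantorDist h0 h1
  refine ⟨by simp, ?_⟩
  rw [Measure.restrict_univ, integral_id_eq h0 h1]

lemma mass_moment_empty (r : ℝ) :
    (cantorDist r).real ∅ = 0 ∧ ∫ x in (∅ : Set ℝ), x ∂cantorDist r = 0 := by
  simp

lemma mass_moment_left {r : ℝ} (h0 : 0 < r) (h1 : r < 1 / 3) :
    (cantorDist r).real (J r [0]) = 1 / 3 ∧ ∫ x in J r [0], x ∂cantorDist r = r / 6 := by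
  have h := mass_moment h0 h1 (measurableSet_J r [0]) ![univ, ∅, ∅] (by
    intro j x hx
    rw [S_mem_J_cons h0 h1 hx, mem_J_nil]
    fin_cases j <;> simp [hx.1, hx.2]) ![1, 0, 0] ![1 / 2, 0, 0] (by
    intro j
    fin_cases j
    · exact mass_moment_univ h0 h1
    · exact mass_moment_empty r
    · exact mass_moment_empty r)
  refine h.imp (fun h => h.trans ?_) fun h => h.trans ?_
  · simp
  · simp
    ring

lemma mass_moment_right {r : ℝ} (h0 : 0 < r) (h1 : r < 1 / 3) :
    (cantorDist r).real (J r [1] ∪ J r [2]) = 2 / 3 ∧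
      ∫ x in J r [1] ∪ J r [2], x ∂cantorDist r = (3 - r) / 6 := by
  have h := mass_moment h0 h1 ((measurableSet_J r [1]).union (measurableSet_J r [2]))
    ![∅, univ, univ] (by
    intro j x hx
    rw [mem_union, S_mem_J_cons h0 h1 hx, S_mem_J_cons h0 h1 hx, mem_J_nil]
    fin_cases j <;> simp [hx.1, hx.2]) ![0, 1, 1] ![0, 1 / 2, 1 / 2] (by
    intro j
    fin_cases j
    · exact mass_moment_empty r
    · exact mass_moment_univ h0 h1
    · exact mass_moment_univ h0 h1)
  refine h.imp (fun h => h.trans ?_) fun h => h.trans ?_ <;> simp <;> ring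

lemma condMean_right {r : ℝ} (h0 : 0 < r) (h1 : r < 1 / 3) :
    condMean r {[1], [2]} = (3 - r) / 4 := by
  have e : (⋃ σ ∈ ({[1], [2]} : Finset (List (Fin 3))), J r σ) = J r [1] ∪ J r [2] := by
    simp
  obtain ⟨h, h'⟩ := mass_moment_right h0 h1
  rw [condMean, e, h, h']
  ring

lemma condMean_four_ninths {r : ℝ} (h0 : 0 < r) (h1 : r < 1 / 3) :
    condMean r {[0], [1, 0]} = (1 + r) ^ 2 / 8 := by
  have e : (⋃ σ ∈ ({[0], [1, 0]} : Finset (List (Fin 3))), J r σ) = J r [0] ∪ J r [1, 0] := by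
    simp
  obtain ⟨h, h'⟩ := mass_moment h0 h1 ((measurableSet_J r [0]).union (measurableSet_J r [1, 0]))
    ![univ, J r [0], ∅] (by
    intro j x hx
    rw [mem_union, S_mem_J_cons h0 h1 hx, S_mem_J_cons h0 h1 hx, mem_J_nil]
    fin_cases j <;> simp [hx.1, hx.2]) ![1, 1 / 3, 0] ![1 / 2, r / 6, 0] (by
    intro j
    fin_cases j
    · exact mass_moment_univ h0 h1
    · exact mass_moment_left h0 h1
    · exact mass_moment_empty r)
  rw [condMean, e, h, h']
  simp
  ring

lemma condMean_five_ninths {r : ℝ} (h0 : 0 < r) (h1 : r < 1 / 3) :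
    condMean r {[1, 1], [1, 2], [2]} = 9 / 10 - (1 + r) ^ 2 / 10 := by
  have e : (⋃ σ ∈ ({[1, 1], [1, 2], [2]} : Finset (List (Fin 3))), J r σ)
      = J r [1, 1] ∪ (J r [1, 2] ∪ J r [2]) := by
    simp
  obtain ⟨h, h'⟩ := mass_moment h0 h1
    ((measurableSet_J r [1, 1]).union ((measurableSet_J r [1, 2]).union (measurableSet_J r [2])))
    ![∅, J r [1] ∪ J r [2], univ] (by
    intro j x hx
    rw [mem_union, mem_union, S_mem_J_cons h0 h1 hx, S_mem_J_cons h0 h1 hx,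
      S_mem_J_cons h0 h1 hx, mem_J_nil]
    fin_cases j <;> simp [hx.1, hx.2]) ![0, 2 / 3, 1] ![0, (3 - r) / 6, 1 / 2] (by
    intro j
    fin_cases j
    · exact mass_moment_empty r
    · exact mass_moment_right h0 h1
    · exact mass_moment_univ h0 h1)
  rw [condMean, e, h, h']
  simp
  ring

lemma centre_left (r : ℝ) : centre r [0] = r / 2 := by
  simp [centre, SWord, S]
  ring

/-! ### The distortion of the two candidate pairs -/

lemma beta2_eq {r : ℝ} (h0 : 0 < r) (h1 : r < 1 / 3) :
    beta2 r = {r / 2, (3 - r) / 4} := by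
  rw [beta2, centre_left, condMean_right h0 h1]

lemma gamma2_eq {r : ℝ} (h0 : 0 < r) (h1 : r < 1 / 3) :
    gamma2 r = {(1 + r) ^ 2 / 8, 9 / 10 - (1 + r) ^ 2 / 10} := by
  rw [gamma2, condMean_four_ninths h0 h1, condMean_five_ninths h0 h1]

lemma D_beta2_le {r : ℝ} (h0 : 0 < r) (h1 : r < 1 / 3) :
    D r {r / 2, (3 - r) / 4} ≤ var r - (1 - r) ^ 2 / 8 := by
  rw [pair_eq h0 h1 (by linarith)]
  have h := phi_ge_third h0 h1 (r / 2 + (3 - r) / 4)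
  nlinarith [mul_le_mul_of_nonneg_left h (by linarith : 0 ≤ (3 - r) / 4 - r / 2)]

/-- The supporting line of `phi r` that belongs to cutting off four ninths of the mass. -/
lemma phi_ge_four_ninths {r : ℝ} (h0 : 0 < r) (h1 : r < 1 / 3) (s : ℝ) :
    4 / 9 * (s - (1 + r) ^ 2 / 4) ≤ phi r s := by
  have e1 := phi_selfSimilar h0 h1 s
  have a := phi_ge h0 h1 (s / r)
  have b := phi_ge_third h0 h1 ((s - (1 - r)) / r)
  have c := phi_nonneg r ((s - 2 * (1 - r)) / r)
  have e2 : r * (s / r) = s := by field_simp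
  have e3 : r * ((s - (1 - r)) / r) = s - (1 - r) := by field_simp
  rw [e1]
  nlinarith [mul_le_mul_of_nonneg_left a h0.le, mul_le_mul_of_nonneg_left b h0.le,
    mul_nonneg h0.le c]

/-- The supporting line of `phi r` that belongs to cutting off `13 / 27` of the mass. -/
lemma phi_ge_thirteen {r : ℝ} (h0 : 0 < r) (h1 : r < 1 / 3) (s : ℝ) :
    13 / 27 * s - (3 * (1 + r) ^ 2 + 1 - r ^ 2 + r ^ 3) / 27 ≤ phi r s := by
  have e1 := phi_selfSimilar h0 h1 s
  have a := phi_ge h0 h1 (s / r)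
  have b := phi_ge_four_ninths h0 h1 ((s - (1 - r)) / r)
  have c := phi_nonneg r ((s - 2 * (1 - r)) / r)
  have e2 : r * (s / r) = s := by field_simp
  have e3 : r * ((s - (1 - r)) / r) = s - (1 - r) := by field_simp
  rw [e1]
  nlinarith [mul_le_mul_of_nonneg_left a h0.le, mul_le_mul_of_nonneg_left b h0.le,
    mul_nonneg h0.le c]

lemma D_gamma2_le {r : ℝ} (h0 : 0 < r) (h1 : r < 1 / 3) :
    D r {(1 + r) ^ 2 / 8, 9 / 10 - (1 + r) ^ 2 / 10} ≤ var r - (3 + r) ^ 2 * (1 - r) ^ 2 / 80 := by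
  have hq : (1 + r) ^ 2 / 8 ≤ 9 / 10 - (1 + r) ^ 2 / 10 := by nlinarith
  rw [pair_eq h0 h1 hq]
  have h := phi_ge_four_ninths h0 h1 ((1 + r) ^ 2 / 8 + (9 / 10 - (1 + r) ^ 2 / 10))
  nlinarith [mul_le_mul_of_nonneg_left h (sub_nonneg.2 hq)]

/-! ### Failure of the second candidate pair outside the critical interval -/

/-- The upper bounds for `phi r` at the sum of the two points of `gamma2 r`. -/
lemma phi_gamma2_le {r s : ℝ} (h0 : 0 < r) (h1 : r < 1 / 3) (hs : s = 9 / 10 + (1 + r) ^ 2 / 40) :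
    phi r s ≤ 1 / 3 * s - r / 3 ∨ phi r s ≤ 7 / 18 * s - (1 + 5 * r) / 18 ∨
      phi r s ≤ 4 / 9 * s - (1 + r) ^ 2 / 9 ∨
      (247 / 1000 ≤ r ∧ phi r s ≤ 25 / 54 * s - (6 * (1 + r) ^ 2 + 1 - r ^ 2) / 54) := by
  have hs0 : 0 ≤ s := by rw [hs]; positivity
  have hs1 : s ≤ 1 := by nlinarith
  have hr : 1 - r ^ 2 ≤ s → 247 / 1000 ≤ r := by
    intro h
    by_contra hc
    nlinarith
  have hr3 : r ^ 3 ≤ r ^ 2 * (1 / 3) := by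
    rw [pow_succ]
    exact mul_le_mul_of_nonneg_left h1.le (by positivity)
  rcases phi_le_fine h0 h1 hs0 hs1 with h | h | h | h | ⟨z, hz0, hz2, hsz, h⟩ | h |
    ⟨z, hz0, -, hsz, -⟩
  · left
    nlinarith
  · left
    linarith
  · right; left
    linarith
  · right; right; left
    linarith
  · right; right; right
    refine ⟨hr (by rw [hsz]; nlinarith [pow_pos h0 3]), ?_⟩
    have := mul_le_mul_of_nonneg_left (phi_le_half h0 h1 hz0 hz2) (pow_pos h0 3).le
    linarith
  · rcases le_total s (1 - r ^ 2) with hc | hc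
    · right; right; left
      linarith [pow_pos h0 3]
    · right; right; right
      have hr' := hr hc
      refine ⟨hr', ?_⟩
      have : s ≤ 1 - r ^ 2 + 2 * r ^ 3 := by
        nlinarith [mul_nonneg (sub_nonneg.2 hr') (sub_nonneg.2 h1.le),
          mul_nonneg h0.le (mul_nonneg (sub_nonneg.2 hr') (sub_nonneg.2 h1.le))]
      linarith
  · exfalso
    have := mul_nonneg (pow_pos h0 3).le hz0
    nlinarith

lemma lt_D_gamma2_of_lt {r : ℝ} (h0 : 0 < r) (hr : (3 + r) ^ 2 < 10) :
    var r - (1 - r) ^ 2 / 8 < D r {(1 + r) ^ 2 / 8, 9 / 10 - (1 + r) ^ 2 / 10} := by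
  have hle : r ≤ 163 / 1000 := by nlinarith
  have h1 : r < 1 / 3 := by linarith
  have hq : (1 + r) ^ 2 / 8 ≤ 9 / 10 - (1 + r) ^ 2 / 10 := by nlinarith
  have hpos : 0 < (1 - r) ^ 2 := by
    have : 0 < 1 - r := by linarith
    positivity
  rcases phi_gamma2_le h0 h1 (s := (1 + r) ^ 2 / 8 + (9 / 10 - (1 + r) ^ 2 / 10)) (by ring) with
    h | h | h | ⟨h, -⟩
  · -- This is the line of `beta2 r`, whose points are the only minimizers for it.
    rw [pair_eq h0 h1 hq]
    have e := mul_le_mul_of_nonneg_left h (sub_nonneg.2 hq)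
    have e2 : 0 < ((1 - r) ^ 2 / 8) ^ 2 := by positivity
    have e3 := sq_nonneg (9 / 10 - (1 + r) ^ 2 / 10 - (3 - r) / 4)
    nlinarith
  · refine lt_of_lt_of_le ?_ (le_pair_of_line (G := (6 - 5 * r) ^ 2 / 308) h0 h1 hq (by norm_num)
      (by norm_num) (le_of_eq (by ring)) h)
    nlinarith
  · refine lt_of_lt_of_le ?_ (le_pair_of_line (G := (3 + r) ^ 2 * (1 - r) ^ 2 / 80) h0 h1 hq
      (by norm_num) (by norm_num) (le_of_eq (by ring)) h)
    nlinarith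
  · linarith

/-- The distortion of the pair belonging to cutting off `13 / 27` of the mass. -/
lemma D_thirteen_le {r : ℝ} (h0 : 0 < r) (h1 : r < 1 / 3) :
    ∃ p q, D r {p, q} ≤ var r - (1 - r) ^ 2 * (9 + 3 * r + r ^ 2) ^ 2 / 728 := by
  obtain ⟨K, hK⟩ : ∃ K, K = 3 * (1 + r) ^ 2 + 1 - r ^ 2 + r ^ 3 := ⟨_, rfl⟩
  have hK13 : 0 ≤ 13 - K := by
    rw [show 13 - K = (1 - r) * (9 + 3 * r + r ^ 2) by rw [hK]; ring]
    exact mul_nonneg (by linarith) (by positivity)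
  refine ⟨K / 26, (27 - K) / 28, ?_⟩
  rw [pair_eq h0 h1 (by linarith)]
  have h := phi_ge_thirteen h0 h1 (K / 26 + (27 - K) / 28)
  rw [← hK] at h
  have hd : 0 ≤ (27 - K) / 28 - K / 26 := by linarith
  have e : (1 - r) ^ 2 * (9 + 3 * r + r ^ 2) ^ 2 = (13 - K) ^ 2 := by rw [hK]; ring
  rw [e]
  nlinarith [mul_le_mul_of_nonneg_left h hd]

lemma lt_D_gamma2_of_gt {r : ℝ} (h1 : r < 1 / 3) (hr : 231 / 1000 ≤ r)
    (hr' : 91 * (3 + r) ^ 2 < 10 * (9 + 3 * r + r ^ 2) ^ 2) :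
    var r - (1 - r) ^ 2 * (9 + 3 * r + r ^ 2) ^ 2 / 728
      < D r {(1 + r) ^ 2 / 8, 9 / 10 - (1 + r) ^ 2 / 10} := by
  have h0 : 0 < r := by linarith
  have hq : (1 + r) ^ 2 / 8 ≤ 9 / 10 - (1 + r) ^ 2 / 10 := by nlinarith
  have hpos : 0 < (1 - r) ^ 2 := by
    have : 0 < 1 - r := by linarith
    positivity
  have e : (1 - r) ^ 2 * (9 + 3 * r + r ^ 2) ^ 2 = (9 - 6 * r - 2 * r ^ 2 - r ^ 3) ^ 2 := by ring
  rcases phi_gamma2_le h0 h1 (s := (1 + r) ^ 2 / 8 + (9 / 10 - (1 + r) ^ 2 / 10)) (by ring) with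
    h | h | h | ⟨hr2, h⟩
  · refine lt_of_lt_of_le ?_ (le_pair_of_line (G := (1 - r) ^ 2 / 8) h0 h1 hq (by norm_num)
      (by norm_num) (le_of_eq (by ring)) h)
    have h2 : 91 < (9 + 3 * r + r ^ 2) ^ 2 := by nlinarith
    nlinarith [mul_lt_mul_of_pos_left h2 hpos]
  · refine lt_of_lt_of_le ?_ (le_pair_of_line (G := (6 - 5 * r) ^ 2 / 308) h0 h1 hq (by norm_num)
      (by norm_num) (le_of_eq (by ring)) h)
    rw [e]
    -- `1.538 ^ 2` slightly exceeds `728 / 308`.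
    have h2 : 1.538 * (6 - 5 * r) < 9 - 6 * r - 2 * r ^ 2 - r ^ 3 := by
      nlinarith [mul_nonneg (sub_nonneg.2 hr) (sub_nonneg.2 h1.le),
        mul_nonneg h0.le (mul_nonneg (sub_nonneg.2 hr) (sub_nonneg.2 h1.le))]
    have h3 := pow_lt_pow_left₀ h2 (by linarith) two_ne_zero
    have h4 := sq_nonneg (6 - 5 * r)
    rw [mul_pow] at h3
    norm_num at h3
    linarith
  · refine lt_of_lt_of_le ?_ (le_pair_of_line (G := (3 + r) ^ 2 * (1 - r) ^ 2 / 80) h0 h1 hq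
      (by norm_num) (by norm_num) (le_of_eq (by ring)) h)
    nlinarith [mul_lt_mul_of_pos_left hr' hpos]
  · refine lt_of_lt_of_le ?_ (le_pair_of_line (G := (18 - 12 * r - 5 * r ^ 2) ^ 2 / 2900) h0 h1 hq
      (by norm_num) (by norm_num) (le_of_eq (by ring)) h)
    rw [e]
    -- `0.50104 ^ 2` slightly exceeds `728 / 2900`.
    have h2 : 0.50104 * (18 - 12 * r - 5 * r ^ 2) < 9 - 6 * r - 2 * r ^ 2 - r ^ 3 := by
      nlinarith [mul_nonneg (sub_nonneg.2 hr2) (sub_nonneg.2 h1.le),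
        mul_nonneg h0.le (mul_nonneg (sub_nonneg.2 hr2) (sub_nonneg.2 h1.le))]
    have h3 := pow_lt_pow_left₀ h2 (by nlinarith) two_ne_zero
    have h4 := sq_nonneg (18 - 12 * r - 5 * r ^ 2)
    rw [mul_pow] at h3
    norm_num at h3
    linarith

/-! ### The critical ratios -/

lemma eq0_iff {r : ℝ} (h0 : 0 < r) (h1 : r < 1 / 3) : Eq0 r ↔ (3 + r) ^ 2 = 10 := by
  have e1 : -((3 * r ^ 5 + 15 * r ^ 4 + 6 * r ^ 3 - 42 * r ^ 2 + 31 * r - 13) / (240 * (r + 1)))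
      = var r - (3 + r) ^ 2 * (1 - r) ^ 2 / 80 := by
    unfold var
    field_simp
    ring
  have e2 : -((3 * r ^ 3 - 3 * r ^ 2 + r - 1) / (24 * (r + 1))) = var r - (1 - r) ^ 2 / 8 := by
    unfold var
    field_simp
    ring
  rw [Eq0, e1, e2]
  have hpos : (1 - r) ^ 2 ≠ 0 := pow_ne_zero _ (by linarith)
  constructor
  · intro h
    refine mul_right_cancel₀ hpos ?_
    linarith
  · intro h
    rw [h]
    ring

lemma eq1_iff {r : ℝ} (h0 : 0 < r) (h1 : r < 1 / 3) :
    Eq1 r ↔ 10 * (9 + 3 * r + r ^ 2) ^ 2 = 91 * (3 + r) ^ 2 := by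
  have e1 : -((3 * r ^ 5 + 15 * r ^ 4 + 6 * r ^ 3 - 42 * r ^ 2 + 31 * r - 13) / (240 * (r + 1)))
      = var r - (3 + r) ^ 2 * (1 - r) ^ 2 / 80 := by
    unfold var
    field_simp
    ring
  have e2 : -((3 * r ^ 7 + 15 * r ^ 6 + 60 * r ^ 5 + 66 * r ^ 4 + 18 * r ^ 3 - 324 * r ^ 2
      + 283 * r - 121) / (2184 * (r + 1)))
      = var r - (1 - r) ^ 2 * (9 + 3 * r + r ^ 2) ^ 2 / 728 := by
    unfold var
    field_simp
    ring
  rw [Eq1, e1, e2]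
  have hpos : (1 - r) ^ 2 ≠ 0 := pow_ne_zero _ (by linarith)
  constructor
  · intro h
    refine mul_right_cancel₀ hpos ?_
    linarith
  · intro h
    linear_combination (1 - r) ^ 2 / 7280 * h

/-- The quotient `(9 + 3 x + x ^ 2) / (3 + x)` is strictly increasing for `x > 0`. -/
lemma ratio_lt {x y : ℝ} (hx : 0 < x) (hxy : x < y) :
    (9 + 3 * x + x ^ 2) ^ 2 * (3 + y) ^ 2 < (9 + 3 * y + y ^ 2) ^ 2 * (3 + x) ^ 2 := by
  have hy : 0 < y := hx.trans hxy
  rw [← mul_pow, ← mul_pow]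
  refine pow_lt_pow_left₀ ?_ (by positivity) two_ne_zero
  nlinarith [mul_pos (sub_pos.2 hxy) (mul_pos hx hy), mul_pos (sub_pos.2 hxy) (add_pos hx hy)]

lemma lt_of_second_ratio_lt {x y : ℝ} (hx : 0 < x) (hxy : x < y)
    (h : 10 * (9 + 3 * x + x ^ 2) ^ 2 = 91 * (3 + x) ^ 2) :
    91 * (3 + y) ^ 2 < 10 * (9 + 3 * y + y ^ 2) ^ 2 := by
  have h1 := ratio_lt hx hxy
  have h2 : 0 < (3 + x) ^ 2 := by positivity
  refine lt_of_mul_lt_mul_right ?_ h2.le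
  linear_combination 10 * h1 - (3 + y) ^ 2 * h

lemma lt_of_lt_second_ratio {x y : ℝ} (hx : 0 < x) (hxy : x < y)
    (h : 10 * (9 + 3 * y + y ^ 2) ^ 2 = 91 * (3 + y) ^ 2) :
    10 * (9 + 3 * x + x ^ 2) ^ 2 < 91 * (3 + x) ^ 2 := by
  have h1 := ratio_lt hx hxy
  have h2 : 0 < (3 + y) ^ 2 := by
    have := hx.trans hxy
    positivity
  refine lt_of_mul_lt_mul_right ?_ h2.le
  linear_combination 10 * h1 + (3 + x) ^ 2 * h

lemma exists_second_ratio : ∃ x : ℝ, 0.23176263145 < x ∧ x < 0.23176263155 ∧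
    10 * (9 + 3 * x + x ^ 2) ^ 2 = 91 * (3 + x) ^ 2 := by
  have hc : ContinuousOn (fun x : ℝ => 10 * (9 + 3 * x + x ^ 2) ^ 2 - 91 * (3 + x) ^ 2)
      (Icc 0.23176263145 0.23176263155) := by fun_prop
  obtain ⟨x, hx, e⟩ := intermediate_value_Ioo (by norm_num) hc
    (show (0 : ℝ) ∈ Ioo _ _ by constructor <;> norm_num)
  exact ⟨x, hx.1, hx.2, sub_eq_zero.1 e⟩

lemma betaOptimal {r : ℝ} (h0 : 0 < r) (hr : (3 + r) ^ 2 ≤ 10) : BetaOptimal r := by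
  have h := admits_third h0 hr
  rw [BetaOptimal, beta2_eq h0 h.lt]
  exact familyOptimal_pair h (D_beta2_le h0 h.lt)

lemma gammaOptimal {r : ℝ} (h0 : 0 < r) (hle : r ≤ 29 / 125) (hr : 10 ≤ (3 + r) ^ 2)
    (hr' : 10 * (9 + 3 * r + r ^ 2) ^ 2 ≤ 91 * (3 + r) ^ 2) : GammaOptimal r := by
  have h := admits_four_ninths h0 hle hr hr'
  rw [GammaOptimal, gamma2_eq h0 h.lt]
  exact familyOptimal_pair h (D_gamma2_le h0 h.lt)

lemma not_gammaOptimal {r : ℝ} (h0 : 0 < r) (h1 : r < 1 / 3) {p q : ℝ}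
    (h : D r {p, q} < D r {(1 + r) ^ 2 / 8, 9 / 10 - (1 + r) ^ 2 / 10}) : ¬ GammaOptimal r := by
  rintro ⟨ho, -⟩
  rw [gamma2_eq h0 h1] at ho
  refine not_isOptimalSet h0 h1 (Finset.insert_nonempty _ _) (Finset.insert_nonempty _ _)
    (Finset.card_le_two (a := p) (b := q)) h ?_
  simpa using ho

end TriadicCantor

end

open TriadicCantor

theorem theorem5p1 :
    ∃ r₀ r₁ : ℝ,
      (r₀ ∈ Set.Ioo (0 : ℝ) (1 / 3) ∧ Eq0 r₀ ∧ ∀ r ∈ Set.Ioo (0 : ℝ) (1 / 3), Eq0 r → r = r₀) ∧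
      (r₁ ∈ Set.Ioo (0 : ℝ) (1 / 3) ∧ Eq1 r₁ ∧ ∀ r ∈ Set.Ioo (0 : ℝ) (1 / 3), Eq1 r → r = r₁) ∧
      |r₀ - 0.1622776602| < 5 / 10 ^ 11 ∧
      |r₁ - 0.2317626315| < 5 / 10 ^ 11 ∧
      (∀ r : ℝ, 0 < r → r ≤ r₀ → BetaOptimal r) ∧
      {r : ℝ | r ∈ Set.Ioo (0 : ℝ) (1 / 3) ∧ GammaOptimal r} = Set.Icc r₀ r₁ := by

  obtain ⟨r₁, hlo, hhi, e₁⟩ := exists_second_ratio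
  obtain ⟨w, hw0, hw2⟩ : ∃ w : ℝ, 0 ≤ w ∧ w ^ 2 = 10 :=
    ⟨√10, Real.sqrt_nonneg _, Real.sq_sqrt (by norm_num)⟩
  have hw_gt : 3.16227766015 < w := lt_of_pow_lt_pow_left₀ 2 hw0 (by rw [hw2]; norm_num)
  have hw_lt : w < 3.16227766025 := lt_of_pow_lt_pow_left₀ 2 (by norm_num) (by rw [hw2]; norm_num)
  have hpos : 0 < r₁ := by linarith
  refine ⟨w - 3, r₁, ⟨⟨by linarith, by linarith⟩, ?_, ?_⟩, ⟨⟨hpos, by linarith⟩, ?_, ?_⟩, ?_, ?_,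
    ?_, ?_⟩
  · rw [eq0_iff (by linarith) (by linarith), ← hw2]
    ring
  · intro r ⟨h0, h1⟩ h
    rw [eq0_iff h0 h1, ← hw2, pow_left_inj₀ (by linarith) hw0 two_ne_zero] at h
    linarith
  · rwa [eq1_iff hpos (by linarith)]
  · intro r ⟨h0, h1⟩ h
    rw [eq1_iff h0 h1] at h
    rcases lt_trichotomy r r₁ with hlt | rfl | hlt
    · exact absurd e₁ (lt_of_second_ratio_lt h0 hlt h).ne'
    · rfl
    · exact absurd h (lt_of_second_ratio_lt hpos hlt e₁).ne'
  · rw [abs_lt]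
    constructor <;> norm_num <;> linarith
  · rw [abs_lt]
    constructor <;> norm_num <;> linarith
  · intro r h0 h
    refine betaOptimal h0 ?_
    rw [← hw2]
    exact pow_le_pow_left₀ (by linarith) (by linarith) 2
  · ext r
    constructor
    · rintro ⟨⟨h0, h1⟩, hγ⟩
      constructor
      · by_contra hc
        push Not at hc
        have hlt : (3 + r) ^ 2 < 10 := by
          rw [← hw2]
          exact pow_lt_pow_left₀ (by linarith) (by linarith) two_ne_zero
        exact not_gammaOptimal h0 h1
          ((D_beta2_le h0 h1).trans_lt (lt_D_gamma2_of_lt h0 hlt)) hγ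
      · by_contra hc
        push Not at hc
        obtain ⟨p, q, hpq⟩ := D_thirteen_le h0 h1
        exact not_gammaOptimal h0 h1 (hpq.trans_lt (lt_D_gamma2_of_gt h1 (by linarith)
          (lt_of_second_ratio_lt hpos hc e₁))) hγ
    · rintro ⟨hr0, hr1⟩
      have h0 : 0 < r := by linarith
      refine ⟨⟨h0, by linarith⟩, gammaOptimal h0 (by linarith) ?_ ?_⟩
      · rw [← hw2]
        exact pow_le_pow_left₀ hw0 (by linarith) 2
      · rcases hr1.eq_or_lt with rfl | hlt
        · exact e₁.le
        · exact (lt_of_lt_second_ratio h0 hlt e₁).le
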